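/- Notation: for complex $x$ and an integer $n\ge 0$, $(x)_n=x(x+1)\cdots(x+n-1)$; for complex $x,a$, $(x)_a=\Gamma(x+a)/\Gamma(x)$; for $c>0$, $c^a=e^{a\ln c}$; $G=\sum_{n\ge0}(-1)^n/(2n+1)^2$ is Catalan's constant. For complex $a\notin\{-1,-2,-3,\dots\}$ the series $$f(a)=\sum_{n=0}^{\infty}\frac1{2^{4n}}\frac{\left(a+\frac12\right)_n^3\left(a+\frac14\right)_n\left(a+\frac34\right)_n}{(a+1)_n^5}\,[120(n+a)^2+34(n+a)+3],$$ $$g(a)=\sum_{n=0}^{\infty}\frac1{2^{6n}}\frac{\left(a+\frac12\right)_n^3}{(a+1)_n^3}\,[42(n+a)+5]$$ converge, and the following hold (all the series that occur being absolutely convergent). (i) If $\operatorname{Re}a>0$, then $$f(a)=32a\sum_{n=0}^{\infty}\frac{\left(\frac12\right)_n^2\left(a+\frac12\right)_n^2}{(a+1)_n^2(2a+1)_n^2}(4n+4a+1).$$ (ii) If $a\notin\{-1,-2,\dots\}$ and $\cos 2\pi a\neq0$, then $$f(a)=\frac2\pi\cdot\frac1{4^a\cos2\pi a}\cdot\frac{(1)_a^2}{\left(\frac14\right)_a\left(\frac34\right)_a}\,g(a)+\frac{512a^3}{4a-1}\sum_{n=0}^{\infty}\frac{\left(\frac12\right)_n^3}{(a+1)_n^2\left(\frac32-2a\right)_n}.$$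 (iii) If $a\notin\{-1,-2,\dots\}$, $\cos2\pi a\ne0$, $\cos\pi a\neq0$ and $\operatorname{Re}a<\frac12$, then $$f(a)=\frac{32}{\pi^2}\cdot\frac{16^a}{\cos^2\pi a}\cdot\frac1{\cos2\pi a}\cdot\frac{(1)_a^5}{\left(\frac12\right)_a^3\left(\frac14\right)_a\left(\frac34\right)_a}+\frac{512a^3}{4a-1}\sum_{n=0}^{\infty}\frac{\left(\frac12\right)_n^3}{(a+1)_n^2\left(\frac32-2a\right)_n}$$ $$\qquad+\frac{256}\pi\cdot\frac1{4^a\cos2\pi a}\cdot\frac{(1)_a^2}{\left(\frac14\right)_a\left(\frac34\right)_a}\cdot\frac{a^2}{2a-1}\sum_{n=0}^{\infty}\frac{\left(a+\frac12\right)_n^2}{(2a+1)_n\left(\frac32-a\right)_n}.$$ (iv) $f\left(\frac12\right)=\dfrac{16\pi^2}3$. (v) $$\lim_{a\to0}\left[\frac{f(a)}{a^3}-\frac2\pi\cdot\frac1{4^a\cos2\pi a}\cdot\frac{(1)_a^2}{\left(\frac14\right)_a\left(\frac34\right)_a}\cdot\frac{g(a)}{a^3}\right]=-512\sum_{n=0}^{\infty}\frac{\binom{2n}n^2}{16^n(2n+1)}=-2048\,\frac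 G\pi .$$ (vi) $f$ is analytic at $0$, and $$f(0)=\frac{32}{\pi^2},\qquad f'(0)=\frac{512}{\pi^2}\ln2,\qquad f''(0)=\frac{64}{3\pi^2}\left(384\ln^22-7\pi^2\right).$$ -/

import Mathlib

open Filter Topology

noncomputable section

namespace GuilleraSeries

/-- The rising factorial `(x)_n = x (x + 1) ⋯ (x + n - 1)` with a natural index. -/
def rise (x : ℂ) (n : ℕ) : ℂ := (ascPochhammer ℂ n).eval x

/-- The rising factorial `(x)_a = Γ(x + a) / Γ(x)` with a complex index. -/
def riseC (x a : ℂ) : ℂ := Complex.Gamma (x + a) / Complex.Gamma x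

/-- Summand of `f(a)`. -/
def fTerm (a : ℂ) (n : ℕ) : ℂ :=
  1 / 2 ^ (4 * n) *
    (rise (a + 1 / 2) n ^ 3 * rise (a + 1 / 4) n * rise (a + 3 / 4) n / rise (a + 1) n ^ 5) *
    (120 * (n + a) ^ 2 + 34 * (n + a) + 3)

/-- The extended Ramanujan-type series `f(a)`. -/
def f (a : ℂ) : ℂ := ∑' n : ℕ, fTerm a n

/-- Summand of `g(a)`. -/
def gTerm (a : ℂ) (n : ℕ) : ℂ :=
  1 / 2 ^ (6 * n) * (rise (a + 1 / 2) n ^ 3 / rise (a + 1) n ^ 3) * (42 * (n + a) + 5)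

/-- The extended Ramanujan-type series `g(a)`. -/
def g (a : ℂ) : ℂ := ∑' n : ℕ, gTerm a n

/-- Summand of the series in the first form of `f(a)`. -/
def uTerm (a : ℂ) (n : ℕ) : ℂ :=
  rise (1 / 2) n ^ 2 * rise (a + 1 / 2) n ^ 2 / (rise (a + 1) n ^ 2 * rise (2 * a + 1) n ^ 2) *
    (4 * n + 4 * a + 1)

/-- Summand of the series in the second and third forms of `f(a)`. -/
def vTerm (a : ℂ) (n : ℕ) : ℂ :=
  rise (1 / 2) n ^ 3 / (rise (a + 1) n ^ 2 * rise (3 / 2 - 2 * a) n)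

/-- Summand of the additional series in the third form of `f(a)`. -/
def wTerm (a : ℂ) (n : ℕ) : ℂ :=
  rise (a + 1 / 2) n ^ 2 / (rise (2 * a + 1) n * rise (3 / 2 - a) n)

/-- The factor `(2/π) · 1/(4^a cos 2πa) · (1)_a² / ((1/4)_a (3/4)_a)` of `g(a)`. -/
def gCoeff (a : ℂ) : ℂ :=
  2 / (Real.pi : ℂ) * (1 / ((4 : ℂ) ^ a * Complex.cos (2 * Real.pi * a))) *
    (riseC 1 a ^ 2 / (riseC (1 / 4) a * riseC (3 / 4) a))

/-- Catalan's constant `G = ∑ (-1)^n / (2n+1)²`. -/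
def catalanG : ℝ := ∑' n : ℕ, (-1 : ℝ) ^ n / (2 * (n : ℝ) + 1) ^ 2

end GuilleraSeries

end

open Filter Topology

noncomputable section

namespace GuilleraSeries

/-! Forms (i) and (ii) come from WZ pairs. If F(n+1,k) − F(n,k) = G(n,k+1) − G(n,k) and F(n,k) → 0
as n → ∞, then S(k) = Σ_n G(n,k) drops by F(0,k) when k grows by one, so Σ_k F(0,k) = S(0) − lim
S(k), the limit being taken termwise (`wz_hasSum`). Both pairs used here have G(n,0) equal to the
n-th term of f. For `uF`, `uG` the limit is zero. For `sF`, `sG`, k times the hypergeometric factor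
tends to a multiple of the coefficient of g (`tendsto_sFactor`), so the limit is `gCoeff a * g a`.

Form (iii) requires g up to an explicit series. A telescoping certificate `wG` shows that their
difference satisfies gDiff(a) = dRatio(a) · gDiff(a+1) (`gDiff_eq`), while D = `dFun` satisfies
D(a+1) = dRatio(a) · D(a). Hence cos²(πa) D(a) gDiff(a) has period 1. In a vertical strip wider than
one, cos² and the zero of gDiff at −1/2 cancel the triple pole of D there, so the product extends to
an entire periodic function. Its growth is at most |Im a| · |cos πa|², which forces the shape A + B
sin²πa + κ sin 2πa (`eq_trig_of_periodic`). On the imaginary axis it is o(|cos πa|²) (`pFun_decay`),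
so B = κ = 0, and the constant 16/π is read off at a = −1/2 (`pFun_eq_const`).

For (iv), form (i) at 1/2 is a difference of the sums of inverse odd and even squares. For (v), form
(ii) divided by a³ is continuous at 0, and the resulting constant is found by integrating the
arcsine series: both that series and Catalan's constant are tied to ∫ θ/sin θ over [0, π/2]. For
(vi), near 0 one has f = (32/π³) `leadTerm` + a² `restTerm`, where `leadTerm` is a Gamma product
whose derivatives at 0 need only digamma and its derivative at 1 and 1/2. -/

/-! ### Rising factorials and their growth. -/

@[simp] lemma rise_zero (x : ℂ) : rise x 0 = 1 := by simp [rise]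

lemma rise_succ (x : ℂ) (n : ℕ) : rise x (n + 1) = rise x n * (x + n) := by
  simp [rise, ascPochhammer_succ_eval]

@[simp] lemma rise_one (x : ℂ) : rise x 1 = x := by simp [rise]

lemma rise_succ_left (x : ℂ) (n : ℕ) : rise x (n + 1) = x * rise (x + 1) n := by
  induction n with
  | zero => simp
  | succ n ih => rw [rise_succ, ih, rise_succ]; push_cast; ring

lemma rise_shift (x : ℂ) (n : ℕ) : x * rise (x + 1) n = rise x n * (x + n) := by
  rw [← rise_succ_left, rise_succ]

lemma rise_eq_prod (x : ℂ) (n : ℕ) : rise x n = ∏ j ∈ Finset.range n, (x + j) := by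
  induction n with
  | zero => simp
  | succ n ih => rw [rise_succ, ih, Finset.prod_range_succ]

lemma rise_ne_zero {x : ℂ} (hx : ∀ j : ℕ, x + j ≠ 0) (n : ℕ) : rise x n ≠ 0 := by
  rw [rise_eq_prod]
  exact Finset.prod_ne_zero_iff.2 fun j _ => hx j

lemma rise_one_left (n : ℕ) : rise 1 n = (n.factorial : ℂ) := by
  simp [rise, ascPochhammer_eval_one]

lemma add_natCast_ne_zero_of_re_pos {x : ℂ} (hx : 0 < x.re) (j : ℕ) : x + j ≠ 0 := by
  intro h
  have := congrArg Complex.re h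
  simp at this
  have : (0 : ℝ) ≤ j := Nat.cast_nonneg j
  linarith

lemma Gamma_ne_zero_of_add {x : ℂ} (hx : ∀ j : ℕ, x + j ≠ 0) : Complex.Gamma x ≠ 0 :=
  Complex.Gamma_ne_zero fun m h => hx m (by rw [h]; ring)

/-- `(x)_n / (n! n ^ (x - 1))` tends to `1 / Γ(x)`. -/
lemma tendsto_rise {x : ℂ} (hx : ∀ j : ℕ, x + j ≠ 0) :
    Tendsto (fun n : ℕ => rise x n / (n.factorial * (n : ℂ) ^ (x - 1))) atTop
      (𝓝 (Complex.Gamma x)⁻¹) := by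
  -- `GammaSeq x n` is n^x n!/(x)_{n+1}; its extra factor x + n is compensated by n/(x + n) → 1.
  have h1 := (Complex.GammaSeq_tendsto_Gamma x).inv₀ (Gamma_ne_zero_of_add hx)
  have h2 : Tendsto (fun n : ℕ => (n : ℂ) / (x + n)) atTop (𝓝 1) := by
    have h3 : Tendsto (fun n : ℕ => 1 / (x / n + 1)) atTop (𝓝 (1 / (0 + 1))) := by
      refine Tendsto.div tendsto_const_nhds (Tendsto.add ?_ tendsto_const_nhds) (by simp)
      exact tendsto_const_div_atTop_nhds_zero_nat x
    simp only [zero_add, div_one] at h3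
    refine h3.congr' ?_
    filter_upwards [eventually_gt_atTop 0] with n hn
    have hn : (n : ℂ) ≠ 0 := by exact_mod_cast hn.ne'
    have := hx n
    field_simp
  have h4 := h1.mul h2
  rw [mul_one] at h4
  refine h4.congr' ?_
  filter_upwards [eventually_gt_atTop 0] with n hn
  have hn : (n : ℂ) ≠ 0 := by exact_mod_cast hn.ne'
  have hf : (n.factorial : ℂ) ≠ 0 := by exact_mod_cast n.factorial_ne_zero
  have h5 : (n : ℂ) ^ x = (n : ℂ) ^ (x - 1) * n := by
    rw [Complex.cpow_sub _ _ hn, Complex.cpow_one, div_mul_cancel₀ _ hn]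
  have h6 : (n : ℂ) ^ (x - 1) ≠ 0 := by simp [Complex.cpow_eq_zero_iff, hn]
  have := hx n
  rw [Complex.GammaSeq, ← rise_eq_prod, rise_succ, h5]
  field_simp

lemma rise_isBigO {x : ℂ} (hx : ∀ j : ℕ, x + j ≠ 0) :
    (fun n : ℕ => rise x n) =O[atTop] fun n : ℕ => (n.factorial : ℝ) * (n : ℝ) ^ (x.re - 1) := by
  have h := (tendsto_rise hx).isBigO_one ℂ
  have h2 := h.mul (Asymptotics.isBigO_refl
    (fun n : ℕ => (n.factorial : ℂ) * (n : ℂ) ^ (x - 1)) atTop)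
  refine (h2.congr' ?_ EventuallyEq.rfl).trans ?_
  · filter_upwards [eventually_gt_atTop 0] with n hn
    have hn : (n : ℂ) ≠ 0 := by exact_mod_cast hn.ne'
    have hf : (n.factorial : ℂ) ≠ 0 := by exact_mod_cast n.factorial_ne_zero
    have h6 : (n : ℂ) ^ (x - 1) ≠ 0 := by simp [Complex.cpow_eq_zero_iff, hn]
    field_simp
  · refine Asymptotics.IsBigO.of_bound 1 ?_
    filter_upwards [eventually_gt_atTop 0] with n hn
    have := Complex.norm_natCast_cpow_of_pos hn (x - 1)
    simp [this, abs_of_nonneg, Real.rpow_nonneg]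

lemma rise_inv_isBigO {x : ℂ} (hx : ∀ j : ℕ, x + j ≠ 0) :
    (fun n : ℕ => (rise x n)⁻¹) =O[atTop]
      fun n : ℕ => ((n.factorial : ℝ) * (n : ℝ) ^ (x.re - 1))⁻¹ := by
  have h := ((tendsto_rise hx).inv₀ (inv_ne_zero (Gamma_ne_zero_of_add hx))).isBigO_one ℂ
  have h2 := h.mul (Asymptotics.isBigO_refl
    (fun n : ℕ => ((n.factorial : ℂ) * (n : ℂ) ^ (x - 1))⁻¹) atTop)
  refine (h2.congr' ?_ EventuallyEq.rfl).trans ?_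
  · filter_upwards [eventually_gt_atTop 0] with n hn
    have hn : (n : ℂ) ≠ 0 := by exact_mod_cast hn.ne'
    have hf : (n.factorial : ℂ) ≠ 0 := by exact_mod_cast n.factorial_ne_zero
    have h6 : (n : ℂ) ^ (x - 1) ≠ 0 := by simp [Complex.cpow_eq_zero_iff, hn]
    have := rise_ne_zero hx n
    field_simp
  · refine Asymptotics.IsBigO.of_bound 1 ?_
    filter_upwards [eventually_gt_atTop 0] with n hn
    have := Complex.norm_natCast_cpow_of_pos hn (x - 1)
    simp [this, abs_of_nonneg, Real.rpow_nonneg]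

/-! ### Uniform bounds from ratios, and WZ summation. -/

/-- Comparison of a family of sequences with a fixed positive sequence. -/
lemma exists_bound_of_ratio_le {ι : Type*} {T : ℕ → ι → ℂ} {u : ℕ → ℝ} (hu : ∀ n, 0 < u n)
    (hT : ∀ n, ∃ M : ℝ, ∀ i, ‖T n i‖ ≤ M) (N : ℕ)
    (hr : ∀ n, N ≤ n → ∀ i, ‖T (n + 1) i‖ ≤ u (n + 1) / u n * ‖T n i‖) :
    ∃ C : ℝ, 0 ≤ C ∧ ∀ n i, ‖T n i‖ ≤ C * u n := by
  choose M hM using hT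
  have hs : ∀ n ≤ N, |M n| / u n ≤ ∑ j ∈ Finset.range (N + 1), |M j| / u j := fun n hn =>
    Finset.single_le_sum (f := fun j => |M j| / u j)
      (fun j _ => div_nonneg (abs_nonneg _) (hu j).le) (Finset.mem_range.2 (by omega))
  -- This sum dominates each single ratio with j ≤ N; beyond N the ratio hypothesis propagates the
  -- bound.
  refine ⟨∑ j ∈ Finset.range (N + 1), |M j| / u j,
    Finset.sum_nonneg fun j _ => div_nonneg (abs_nonneg _) (hu j).le, ?_⟩
  set S := ∑ j ∈ Finset.range (N + 1), |M j| / u j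
  have key : ∀ n ≤ N, ∀ i, ‖T n i‖ ≤ S * u n := fun n hn i =>
    (hM n i).trans ((le_abs_self _).trans ((div_le_iff₀ (hu n)).1 (hs n hn)))
  intro n i
  rcases le_total n N with h | h
  · exact key n h i
  · induction n, h using Nat.le_induction with
    | base => exact key N le_rfl i
    | succ n hn ih =>
      refine (hr n hn i).trans ?_
      have := hu n
      have := hu (n + 1)
      calc u (n + 1) / u n * ‖T n i‖ ≤ u (n + 1) / u n * (S * u n) := by gcongr
        _ = S * u (n + 1) := by field_simp

lemma exists_bound_of_tendsto {T : ℕ → ℂ} {l : ℂ} (h : Tendsto T atTop (𝓝 l)) :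
    ∃ M : ℝ, ∀ n, ‖T n‖ ≤ M := by
  obtain ⟨M, hM⟩ := (Metric.isBounded_range_of_tendsto T h).exists_norm_le
  exact ⟨M, fun n => hM _ ⟨n, rfl⟩⟩

/-- Summation of a WZ pair with dominated second member. -/
lemma wz_hasSum {F G : ℕ → ℕ → ℂ} {L : ℕ → ℂ} {b : ℕ → ℝ}
    (hwz : ∀ n k, F (n + 1) k - F n k = G n (k + 1) - G n k)
    (hF : ∀ k, Tendsto (fun n => F n k) atTop (𝓝 0)) (hb : Summable b)
    (hG : ∀ n k, ‖G n k‖ ≤ b n) (hL : ∀ n, Tendsto (fun k => G n k) atTop (𝓝 (L n))) :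
    Tendsto (fun K => ∑ k ∈ Finset.range K, F 0 k) atTop (𝓝 (∑' n, G n 0 - ∑' n, L n)) := by
  have hs : ∀ k, Summable fun n => G n k := fun k => Summable.of_norm_bounded hb fun n => hG n k
  -- Summing the WZ identity over n telescopes its left side to 0 − F 0 k.
  have h1 : ∀ k, F 0 k = ∑' n, G n k - ∑' n, G n (k + 1) := by
    intro k
    have h2 : HasSum (fun n => G n (k + 1) - G n k) (0 - F 0 k) := by
      have h3 : Summable fun n => G n (k + 1) - G n k := (hs _).sub (hs _)
      rw [h3.hasSum_iff_tendsto_nat]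
      have h4 : (fun N => ∑ n ∈ Finset.range N, (G n (k + 1) - G n k)) =
          fun N => F N k - F 0 k := by
        funext N
        rw [← Finset.sum_range_sub (fun n => F n k)]
        exact Finset.sum_congr rfl fun n _ => (hwz n k).symm
      rw [h4]
      exact (hF k).sub_const _
    have := h2.unique ((hs (k + 1)).hasSum.sub (hs k).hasSum)
    linear_combination -this
  have h5 : ∀ K, ∑ k ∈ Finset.range K, F 0 k = ∑' n, G n 0 - ∑' n, G n K := fun K => by
    rw [Finset.sum_congr rfl fun k _ => h1 k]
    exact Finset.sum_range_sub' (fun k => ∑' n, G n k) K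
  simp only [h5]
  refine Tendsto.sub tendsto_const_nhds ?_
  exact tendsto_tsum_of_dominated_convergence hb hL (Eventually.of_forall fun k n => hG n k)

lemma norm_le_norm_of_abs_re_le {z w : ℂ} (h1 : |z.re| ≤ |w.re|) (h2 : |z.im| ≤ |w.im|) :
    ‖z‖ ≤ ‖w‖ := by
  rw [← sq_le_sq₀ (norm_nonneg _) (norm_nonneg _), Complex.sq_norm, Complex.sq_norm,
    Complex.normSq_apply, Complex.normSq_apply]
  have := sq_le_sq.2 h1
  have := sq_le_sq.2 h2
  nlinarith

lemma summable_pow_mul_half_pow (p : ℕ) :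
    Summable fun n : ℕ => ((n : ℝ) + 1) ^ p * (1 / 2) ^ n := by
  have h := summable_pow_mul_geometric_of_norm_lt_one (R := ℝ) p (r := 1 / 2) (by norm_num)
  have h2 := ((summable_nat_add_iff 1).2 h).mul_left 2
  refine h2.congr fun n => ?_
  push_cast
  ring

/-! ### Geometric convergence of the series f and g. -/

/-- The hypergeometric coefficient of the summand of `f(a)`. -/
def fCoef (a : ℂ) (n : ℕ) : ℂ :=
  1 / 2 ^ (4 * n) *
    (rise (a + 1 / 2) n ^ 3 * rise (a + 1 / 4) n * rise (a + 3 / 4) n / rise (a + 1) n ^ 5)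

/-- The hypergeometric coefficient of the summand of `g(a)`. -/
def gCoef (a : ℂ) (n : ℕ) : ℂ :=
  1 / 2 ^ (6 * n) * (rise (a + 1 / 2) n ^ 3 / rise (a + 1) n ^ 3)

lemma fTerm_eq (a : ℂ) (n : ℕ) :
    fTerm a n = fCoef a n * (120 * (n + a) ^ 2 + 34 * (n + a) + 3) := rfl

lemma gTerm_eq (a : ℂ) (n : ℕ) : gTerm a n = gCoef a n * (42 * (n + a) + 5) := rfl

@[simp] lemma fCoef_zero (a : ℂ) : fCoef a 0 = 1 := by simp [fCoef]

@[simp] lemma gCoef_zero (a : ℂ) : gCoef a 0 = 1 := by simp [gCoef]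

lemma add_one_add_ne_zero {a : ℂ} (ha : ∀ m : ℕ, a ≠ -((m : ℂ) + 1)) (j : ℕ) :
    a + 1 + j ≠ 0 := fun h => ha j (by linear_combination h)

lemma fCoef_succ (a : ℂ) (n : ℕ) : fCoef a (n + 1) = fCoef a n *
    ((a + n + 1 / 2) ^ 3 * (a + n + 1 / 4) * (a + n + 3 / 4) / (16 * (a + n + 1) ^ 5)) := by
  simp only [fCoef, rise_succ]
  rw [show a + 1 / 2 + (n : ℂ) = a + n + 1 / 2 by ring,
    show a + 1 / 4 + (n : ℂ) = a + n + 1 / 4 by ring,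
    show a + 3 / 4 + (n : ℂ) = a + n + 3 / 4 by ring, show a + 1 + (n : ℂ) = a + n + 1 by ring]
  generalize a + n + 1 / 2 = p
  generalize a + n + 1 / 4 = q
  generalize a + n + 3 / 4 = r
  generalize a + n + 1 = s
  ring

lemma gCoef_succ (a : ℂ) (n : ℕ) : gCoef a (n + 1) = gCoef a n *
    ((a + n + 1 / 2) ^ 3 / (64 * (a + n + 1) ^ 3)) := by
  simp only [gCoef, rise_succ]
  rw [show a + 1 / 2 + (n : ℂ) = a + n + 1 / 2 by ring,
    show a + 1 + (n : ℂ) = a + n + 1 by ring]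
  generalize a + n + 1 / 2 = p
  generalize a + n + 1 = s
  ring

lemma norm_add_natCast_le (a : ℂ) (n : ℕ) : ‖a + n‖ ≤ (‖a‖ + 1) * (n + 1) := by
  have h1 := norm_add_le a (n : ℂ)
  rw [Complex.norm_natCast] at h1
  have h2 := norm_nonneg a
  have h3 : (0 : ℝ) ≤ n := Nat.cast_nonneg n
  nlinarith [mul_nonneg h2 h3]

lemma norm_add_natCast_ge (a : ℂ) (n : ℕ) : (n : ℝ) - ‖a‖ ≤ ‖a + n‖ := by
  have := norm_sub_le (a + n) a
  rw [add_sub_cancel_left, Complex.norm_natCast] at this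
  linarith

/-- For `n` large, small shifts of `a + n + 1` are comparable with `a + n + 1`. -/
lemma norm_shift_le {a : ℂ} {n : ℕ} (hn : 9 * ‖a‖ ≤ n) {s : ℂ} {δ : ℝ} (hs : ‖s - 1‖ ≤ δ) :
    ‖a + n + s‖ ≤ (1 + δ) * ‖a + n + 1‖ := by
  have h1 : (1 : ℝ) ≤ ‖a + n + 1‖ := by
    have := norm_add_natCast_ge a (n + 1)
    push_cast at this
    rw [← add_assoc] at this
    have := norm_nonneg a
    linarith
  have h2 : ‖a + n + s‖ ≤ ‖a + n + 1‖ + ‖s - 1‖ := by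
    have := norm_add_le (a + n + 1) (s - 1)
    rwa [show a + n + 1 + (s - 1) = a + n + s by ring] at this
  have h3 := (norm_nonneg _).trans hs
  nlinarith

lemma half_pow_pos (n : ℕ) : (0 : ℝ) < (1 / 2) ^ n := by positivity

lemma half_pow_ratio (n : ℕ) : (1 / 2 : ℝ) ^ (n + 1) / (1 / 2) ^ n = 1 / 2 := by
  rw [pow_succ]; field_simp

/-- Once n ≥ 9‖a‖, consecutive coefficients have ratio at most (3/2)³(7/4)(5/4)/16 < 1/2. -/
lemma fCoef_bound (a : ℂ) : ∃ C : ℝ, 0 ≤ C ∧ ∀ n, ‖fCoef a n‖ ≤ C * (1 / 2) ^ n := by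
  suffices hr : ∀ n, ⌈9 * ‖a‖⌉₊ ≤ n → ∀ _ : Unit, ‖fCoef a (n + 1)‖ ≤
      (1 / 2) ^ (n + 1) / (1 / 2) ^ n * ‖fCoef a n‖ by
    obtain ⟨C, hC, h⟩ := exists_bound_of_ratio_le (ι := Unit) (T := fun n _ => fCoef a n)
      (u := fun n => (1 / 2) ^ n) half_pow_pos (fun n => ⟨‖fCoef a n‖, fun _ => le_rfl⟩) _ hr
    exact ⟨C, hC, fun n => h n ()⟩
  · intro n hn _
    have hn : 9 * ‖a‖ ≤ n := (Nat.le_ceil _).trans (by exact_mod_cast hn)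
    rw [half_pow_ratio, fCoef_succ, norm_mul, mul_comm]
    refine mul_le_mul_of_nonneg_right ?_ (norm_nonneg _)
    have h1 := norm_shift_le hn (s := 1 / 2) (δ := 1 / 2) (by norm_num)
    have h2 := norm_shift_le hn (s := 1 / 4) (δ := 3 / 4) (by norm_num)
    have h3 := norm_shift_le hn (s := 3 / 4) (δ := 1 / 4) (by norm_num)
    simp only [norm_div, norm_mul, norm_pow]
    have h0 := norm_nonneg (a + n + 1)
    rcases h0.eq_or_lt with h0 | h0
    · rw [← h0]; norm_num
    rw [div_le_iff₀ (by simp; positivity)]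
    calc _ ≤ ((1 + 1 / 2) * ‖a + n + 1‖) ^ 3 * ((1 + 3 / 4) * ‖a + n + 1‖) *
          ((1 + 1 / 4) * ‖a + n + 1‖) := by
          gcongr
      _ ≤ _ := by norm_num; nlinarith [pow_pos h0 5]

lemma gCoef_bound (a : ℂ) : ∃ C : ℝ, 0 ≤ C ∧ ∀ n, ‖gCoef a n‖ ≤ C * (1 / 2) ^ n := by
  suffices hr : ∀ n, ⌈9 * ‖a‖⌉₊ ≤ n → ∀ _ : Unit, ‖gCoef a (n + 1)‖ ≤
      (1 / 2) ^ (n + 1) / (1 / 2) ^ n * ‖gCoef a n‖ by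
    obtain ⟨C, hC, h⟩ := exists_bound_of_ratio_le (ι := Unit) (T := fun n _ => gCoef a n)
      (u := fun n => (1 / 2) ^ n) half_pow_pos (fun n => ⟨‖gCoef a n‖, fun _ => le_rfl⟩) _ hr
    exact ⟨C, hC, fun n => h n ()⟩
  · intro n hn _
    have hn : 9 * ‖a‖ ≤ n := (Nat.le_ceil _).trans (by exact_mod_cast hn)
    rw [half_pow_ratio, gCoef_succ, norm_mul, mul_comm]
    refine mul_le_mul_of_nonneg_right ?_ (norm_nonneg _)
    have h1 := norm_shift_le hn (s := 1 / 2) (δ := 1 / 2) (by norm_num)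
    simp only [norm_div, norm_mul, norm_pow]
    have h0 := norm_nonneg (a + n + 1)
    rcases h0.eq_or_lt with h0 | h0
    · rw [← h0]; norm_num
    rw [div_le_iff₀ (by simp; positivity)]
    calc _ ≤ ((1 + 1 / 2) * ‖a + n + 1‖) ^ 3 := by gcongr
      _ ≤ _ := by norm_num; nlinarith [pow_pos h0 3]

lemma summable_fTerm (a : ℂ) : Summable (fTerm a) := by
  obtain ⟨C, hC, h⟩ := fCoef_bound a
  refine Summable.of_norm_bounded
    ((summable_pow_mul_half_pow 2).mul_left (C * (157 * (‖a‖ + 1) ^ 2))) fun n => ?_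
  have h1 := norm_add_natCast_le a n
  have h2 : (1 : ℝ) ≤ (‖a‖ + 1) * (n + 1) := by
    have := norm_nonneg a
    have : (0 : ℝ) ≤ n := Nat.cast_nonneg n
    nlinarith
  set y := (‖a‖ + 1) * ((n : ℝ) + 1) with hy
  -- 157 = 120 + 34 + 3; since y ≥ 1, every power is absorbed in y².
  have h3 : ‖120 * (n + a) ^ 2 + 34 * (n + a) + 3‖ ≤ 157 * y ^ 2 := by
    calc _ ≤ ‖120 * (n + a) ^ 2‖ + ‖34 * (n + a)‖ + ‖(3 : ℂ)‖ := norm_add₃_le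
      _ = 120 * ‖a + n‖ ^ 2 + 34 * ‖a + n‖ + 3 := by simp [add_comm]
      _ ≤ 120 * y ^ 2 + 34 * y + 3 := by gcongr
      _ ≤ _ := by nlinarith
  rw [fTerm_eq, norm_mul]
  calc _ ≤ (C * (1 / 2) ^ n) * (157 * y ^ 2) := by gcongr; exact h n
    _ = _ := by rw [hy]; ring

lemma summable_gTerm (a : ℂ) : Summable (gTerm a) := by
  obtain ⟨C, hC, h⟩ := gCoef_bound a
  refine Summable.of_norm_bounded
    ((summable_pow_mul_half_pow 1).mul_left (C * (47 * (‖a‖ + 1)))) fun n => ?_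
  have h1 := norm_add_natCast_le a n
  have h2 : (1 : ℝ) ≤ (‖a‖ + 1) * (n + 1) := by
    have := norm_nonneg a
    have : (0 : ℝ) ≤ n := Nat.cast_nonneg n
    nlinarith
  set y := (‖a‖ + 1) * ((n : ℝ) + 1) with hy
  have h3 : ‖42 * (n + a) + 5‖ ≤ 47 * y := by
    calc _ ≤ ‖42 * (n + a)‖ + ‖(5 : ℂ)‖ := norm_add_le _ _
      _ = 42 * ‖a + n‖ + 5 := by simp [add_comm]
      _ ≤ 42 * y + 5 := by gcongr
      _ ≤ _ := by nlinarith
  rw [gTerm_eq, norm_mul]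
  calc _ ≤ (C * (1 / 2) ^ n) * (47 * y) := by gcongr; exact h n
    _ = _ := by rw [hy]; ring

/-! ### The WZ pair behind the second form. -/

lemma rise_add_one {x : ℂ} (hx : x ≠ 0) (k : ℕ) : rise (x + 1) k = rise x k * (x + k) / x := by
  rw [← rise_shift]; field_simp

lemma rise_add_two {x : ℂ} (hx : x ≠ 0) (hx1 : x + 1 ≠ 0) (k : ℕ) :
    rise (x + 2) k = rise x k * (x + k) * (x + 1 + k) / (x * (x + 1)) := by
  rw [show x + 2 = x + 1 + 1 by ring, rise_add_one hx1, rise_add_one hx]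
  field_simp

lemma half_add_natCast_ne_zero (k : ℕ) : (1 / 2 : ℂ) + k ≠ 0 :=
  add_natCast_ne_zero_of_re_pos (by norm_num) k

lemma tendsto_linear_quotient (p q r : ℂ) :
    Tendsto (fun k : ℕ => (p * k + q) / (k + r)) atTop (𝓝 p) := by
  have h : Tendsto (fun k : ℕ => (p + q / k) / (1 + r / k)) atTop (𝓝 ((p + 0) / (1 + 0))) :=
    Tendsto.div (tendsto_const_nhds.add (tendsto_const_div_atTop_nhds_zero_nat q))
      (tendsto_const_nhds.add (tendsto_const_div_atTop_nhds_zero_nat r)) (by simp)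
  simp only [add_zero, div_one] at h
  refine h.congr' ?_
  filter_upwards [eventually_gt_atTop 0] with k hk
  have hk : (k : ℂ) ≠ 0 := by exact_mod_cast hk.ne'
  rw [← mul_div_mul_left _ (1 + r / k) hk]
  congr 1 <;> field_simp

/-- The common hypergeometric factor of the WZ pair behind the second form of `f`. -/
def sFactor (a : ℂ) (n k : ℕ) : ℂ :=
  fCoef a n * (rise (1 / 2) k ^ 3 / (rise (a + n + 1) k ^ 2 * rise (1 / 2 - 2 * (a + n)) k))

/-- First member of the WZ pair behind the second form of `f`. -/
def sF (a : ℂ) (n k : ℕ) : ℂ :=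
  -256 * (a + n) ^ 3 * sFactor a n k / (k + 1 / 2 - 2 * (a + n))

/-- Second member of the WZ pair behind the second form of `f`. -/
def sG (a : ℂ) (n k : ℕ) : ℂ :=
  sFactor a n k * (120 * (a + n) ^ 2 + 34 * (a + n) + 3 + (84 * (a + n) + 10) * k)

section

variable {a : ℂ} (ha : ∀ m : ℕ, a ≠ -((m : ℂ) + 1)) (hc : ∀ m : ℤ, 2 * a ≠ m + 1 / 2)

include ha in
lemma shift_ne_zero (n k : ℕ) : a + n + 1 + k ≠ 0 := fun h => ha (n + k) (by
  push_cast; linear_combination h)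

include hc in
lemma half_shift_ne_zero (n : ℕ) (k : ℤ) : (k : ℂ) + 1 / 2 - 2 * (a + n) ≠ 0 := fun h =>
  hc (k - 2 * n) (by push_cast; linear_combination -h)

lemma sFactor_succ_right (n k : ℕ) : sFactor a n (k + 1) = sFactor a n k *
    ((1 / 2 + k) ^ 3 / ((a + n + 1 + k) ^ 2 * (k + 1 / 2 - 2 * (a + n)))) := by
  simp only [sFactor, rise_succ]
  rw [show 1 / 2 - 2 * (a + n) + (k : ℂ) = k + 1 / 2 - 2 * (a + n) by ring]
  generalize a + n + 1 + k = p
  generalize k + 1 / 2 - 2 * (a + n) = q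
  ring

include ha hc in
-- Raising n lowers the base of (1/2 − 2(a+n))_k by 2; the two constant factors this produces cancel
-- (a+n+1/4)(a+n+3/4) and turn 16 into 64. The shift of (a+n+1)_k lowers the fifth power in the
-- denominator to a third.
lemma sFactor_succ_left (n k : ℕ) : sFactor a (n + 1) k = sFactor a n k *
    ((a + n + 1 / 2) ^ 3 * (k - 1 / 2 - 2 * (a + n)) * (k - 3 / 2 - 2 * (a + n)) /
      (64 * (a + n + 1) ^ 3 * (a + n + 1 + k) ^ 2)) := by
  have h1 := shift_ne_zero ha n 0
  rw [Nat.cast_zero, add_zero] at h1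
  have h2 := half_shift_ne_zero hc n (-2)
  have h3 := half_shift_ne_zero hc n (-1)
  have h4 := shift_ne_zero ha n k
  have h5 := half_shift_ne_zero hc n (k - 1)
  have h6 := half_shift_ne_zero hc n (k - 2)
  have h7 := rise_ne_zero (shift_ne_zero ha n) k
  have h8 := rise_ne_zero (x := -3 / 2 - 2 * (a + n)) (fun j h =>
    half_shift_ne_zero hc n (j - 2) (by push_cast; linear_combination h)) k
  push_cast at h2 h3 h5 h6
  have e1 := rise_add_one h1 k
  have e2 := rise_add_two (x := -3 / 2 - 2 * (a + n)) (fun h => h2 (by linear_combination h))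
    (fun h => h3 (by linear_combination h)) k
  rw [show -3 / 2 - 2 * (a + n) + 2 = 1 / 2 - 2 * (a + n) by ring] at e2
  have e3 : 1 / 2 - 2 * (a + ((n + 1 : ℕ) : ℂ)) = -3 / 2 - 2 * (a + n) := by push_cast; ring
  have e4 : a + ((n + 1 : ℕ) : ℂ) + 1 = a + n + 1 + 1 := by push_cast; ring
  simp only [sFactor, fCoef_succ]
  rw [e3, e4, e1, e2]
  have h9 : -3 / 2 - 2 * (a + n) ≠ 0 := fun h => h2 (by linear_combination h)
  have h10 : -3 / 2 - 2 * (a + n) + 1 ≠ 0 := fun h => h3 (by linear_combination h)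
  have h11 : -3 / 2 - 2 * (a + n) + k ≠ 0 := fun h => h6 (by linear_combination h)
  have h12 : -3 / 2 - 2 * (a + n) + 1 + k ≠ 0 := fun h => h5 (by linear_combination h)
  generalize hx : a + n = x at *
  generalize rise (x + 1) k = r at *
  generalize rise (-3 / 2 - 2 * x) k = s at *
  rw [show (k : ℂ) - 1 / 2 - 2 * x = -3 / 2 - 2 * x + 1 + k by ring,
    show (k : ℂ) - 3 / 2 - 2 * x = -3 / 2 - 2 * x + k by ring,
    show x + 1 / 4 = -(-3 / 2 - 2 * x + 1) / 2 by ring,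
    show x + 3 / 4 = -(-3 / 2 - 2 * x) / 2 by ring]
  generalize -3 / 2 - 2 * x + 1 + k = p at *
  generalize -3 / 2 - 2 * x + k = q at *
  generalize -3 / 2 - 2 * x + 1 = u at *
  generalize -3 / 2 - 2 * x = v at *
  generalize x + 1 + k = w at *
  field_simp
  ring

include ha hc in
-- Divided by the common factor and cleared of denominators, the WZ identity is the polynomial
-- identity `key` in a + n and k.
lemma sF_sub (n k : ℕ) : sF a (n + 1) k - sF a n k = sG a n (k + 1) - sG a n k := by
  have h1 := shift_ne_zero ha n 0
  rw [Nat.cast_zero, add_zero] at h1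
  have h4 := shift_ne_zero ha n k
  have h5 := half_shift_ne_zero hc n k
  have h6 := half_shift_ne_zero hc n (k - 2)
  push_cast at h5 h6
  simp only [sF, sG, sFactor_succ_left ha hc, sFactor_succ_right]
  push_cast
  rw [show (k : ℂ) + 1 / 2 - 2 * (a + (n + 1)) = k - 2 + 1 / 2 - 2 * (a + n) by ring,
    show (k : ℂ) - 3 / 2 - 2 * (a + n) = k - 2 + 1 / 2 - 2 * (a + n) by ring,
    show a + ((n : ℂ) + 1) = a + n + 1 by ring]
  generalize sFactor a n k = t
  generalize a + n = x at *
  generalize (k : ℂ) = k at *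
  rw [← sub_eq_zero]
  have e1 : k - 2 + 1 / 2 - 2 * x ≠ 0 := h6
  -- The shifted denominator of `sF` cancels against the ratio of `sFactor`, leaving only w²q as
  -- common denominator.
  have : -256 * (x + 1) ^ 3 * (t * ((x + 1 / 2) ^ 3 * (k - 1 / 2 - 2 * x) *
      (k - 2 + 1 / 2 - 2 * x) / (64 * (x + 1) ^ 3 * (x + 1 + k) ^ 2))) /
      (k - 2 + 1 / 2 - 2 * x) =
      -4 * t * (x + 1 / 2) ^ 3 * (k - 1 / 2 - 2 * x) / (x + 1 + k) ^ 2 := by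
    generalize k - 2 + 1 / 2 - 2 * x = q at *
    generalize x + 1 + k = w at *
    field_simp
    ring
  rw [this]
  have key : -4 * (x + 1 / 2) ^ 3 * (k - 1 / 2 - 2 * x) * (k + 1 / 2 - 2 * x) +
      256 * x ^ 3 * (x + 1 + k) ^ 2 -
      (1 / 2 + k) ^ 3 * (120 * x ^ 2 + 34 * x + 3 + (84 * x + 10) * (k + 1)) +
      (120 * x ^ 2 + 34 * x + 3 + (84 * x + 10) * k) * ((x + 1 + k) ^ 2 *
        (k + 1 / 2 - 2 * x)) = 0 := by ring
  generalize hq : k + 1 / 2 - 2 * x = q at *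
  generalize x + 1 + k = w at *
  rw [← mul_zero (t / (w ^ 2 * q)), ← key]
  field_simp
  ring

include ha hc in
/-- `k` times the common factor converges as `k → ∞`. -/
lemma tendsto_sFactor (n : ℕ) : Tendsto (fun k : ℕ => sFactor a n k * (k + 1)) atTop
    (𝓝 (Complex.Gamma (a + 1) ^ 2 * Complex.Gamma (1 / 2 - 2 * a) / Complex.Gamma (1 / 2) ^ 3 *
      gCoef a n)) := by
  induction n with
  | zero =>
    have hb : ∀ j : ℕ, 1 / 2 - 2 * a + j ≠ 0 := fun j h =>
      hc j (by push_cast; linear_combination -h)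
    have h1 := tendsto_rise half_add_natCast_ne_zero
    have h2 := tendsto_rise (add_one_add_ne_zero ha)
    have h3 := tendsto_rise hb
    have g1 := Gamma_ne_zero_of_add half_add_natCast_ne_zero
    have g2 := Gamma_ne_zero_of_add (add_one_add_ne_zero ha)
    have g3 := Gamma_ne_zero_of_add hb
    have h4 := ((h1.pow 3).div ((h2.pow 2).mul h3) (mul_ne_zero
      (pow_ne_zero 2 (inv_ne_zero g2)) (inv_ne_zero g3))).mul
      (tendsto_linear_quotient 1 1 0)
    have e : (Complex.Gamma (1 / 2))⁻¹ ^ 3 / ((Complex.Gamma (a + 1))⁻¹ ^ 2 *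
        (Complex.Gamma (1 / 2 - 2 * a))⁻¹) * 1 = Complex.Gamma (a + 1) ^ 2 *
        Complex.Gamma (1 / 2 - 2 * a) / Complex.Gamma (1 / 2) ^ 3 * gCoef a 0 := by
      rw [gCoef_zero]; field_simp
    rw [e] at h4
    refine h4.congr' ?_
    filter_upwards [eventually_gt_atTop 0] with k hk
    have hk : (k : ℂ) ≠ 0 := by exact_mod_cast hk.ne'
    have hf : (k.factorial : ℂ) ≠ 0 := by exact_mod_cast k.factorial_ne_zero
    have hr1 := rise_ne_zero (add_one_add_ne_zero ha) k
    have hr2 := rise_ne_zero hb k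
    -- Both exponents equal −1/2; hence one factor k is exactly what makes `sFactor` converge.
    have e1 : ((k : ℂ) ^ ((1 / 2 : ℂ) - 1)) ^ 3 * k =
        ((k : ℂ) ^ (a + 1 - 1)) ^ 2 * (k : ℂ) ^ (1 / 2 - 2 * a - 1) := by
      simp only [← Complex.cpow_nat_mul]
      nth_rw 2 [← Complex.cpow_one (k : ℂ)]
      rw [← Complex.cpow_add _ _ hk, ← Complex.cpow_add _ _ hk]
      congr 1
      push_cast
      ring
    have n1 : (k : ℂ) ^ (a + 1 - 1) ≠ 0 := by simp [Complex.cpow_eq_zero_iff, hk]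
    have n2 : (k : ℂ) ^ (1 / 2 - 2 * a - 1) ≠ 0 := by simp [Complex.cpow_eq_zero_iff, hk]
    have n3 : (k : ℂ) ^ ((1 / 2 : ℂ) - 1) ≠ 0 := by simp [Complex.cpow_eq_zero_iff, hk]
    simp only [sFactor, fCoef_zero, Nat.cast_zero, add_zero, one_mul, Pi.div_apply]
    generalize (k : ℂ) ^ (a + 1 - 1) = u at *
    generalize (k : ℂ) ^ (1 / 2 - 2 * a - 1) = v at *
    generalize (k : ℂ) ^ ((1 / 2 : ℂ) - 1) = w at *
    have : v = w ^ 3 * k / u ^ 2 := by rw [e1]; field_simp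
    rw [this]
    field_simp
  | succ n ih =>
    have h1 := shift_ne_zero ha n 0
    rw [Nat.cast_zero, add_zero] at h1
    -- As k → ∞ the ratio in `sFactor_succ_left` tends to the ratio of consecutive values of
    -- `gCoef`; this is how g enters.
    have hA := tendsto_linear_quotient 1 (-1 / 2 - 2 * (a + n)) (a + n + 1)
    have hB := tendsto_linear_quotient 1 (-3 / 2 - 2 * (a + n)) (a + n + 1)
    have h2 := ih.mul ((hA.mul hB).const_mul ((a + n + 1 / 2) ^ 3 / (64 * (a + n + 1) ^ 3)))
    refine (h2.congr fun k => ?_).trans (le_of_eq (by rw [gCoef_succ]; congr 1; ring))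
    have h4 := shift_ne_zero ha n k
    have e : (k : ℂ) + (a + n + 1) = a + n + 1 + k := by ring
    rw [sFactor_succ_left ha hc, e]
    generalize a + n + 1 + k = w at *
    field_simp
    ring

include ha hc in
-- Uniformly in k, the ratio in n is at most (3/2)³(5/2)²/64 < 1/2. The threshold n ≥ 9‖a‖ is what
-- yields the factor 5/2; smaller n are bounded because they converge in k.
lemma sFactor_bound : ∃ C : ℝ, 0 ≤ C ∧ ∀ n k, ‖sFactor a n k * (k + 1)‖ ≤ C * (1 / 2) ^ n := by
  refine exists_bound_of_ratio_le half_pow_pos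
    (fun n => exists_bound_of_tendsto (tendsto_sFactor ha hc n)) ⌈9 * ‖a‖⌉₊ fun n hn k => ?_
  have hn : 9 * ‖a‖ ≤ n := (Nat.le_ceil _).trans (by exact_mod_cast hn)
  have h0 : 0 < ‖a + n + 1‖ := by
    have := shift_ne_zero ha n 0
    simpa using this
  have h1 := norm_shift_le hn (s := 1 / 2) (δ := 1 / 2) (by norm_num)
  have h2 : (n : ℝ) + 1 + k - ‖a‖ ≤ ‖a + n + 1 + k‖ := by
    have := norm_add_natCast_ge a (n + 1 + k)
    push_cast at this
    rwa [← add_assoc, ← add_assoc] at this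
  have hk : (0 : ℝ) ≤ k := Nat.cast_nonneg k
  have ha0 := norm_nonneg a
  have h3 : ∀ s : ℝ, 0 ≤ s → s ≤ 3 / 2 → ‖(k : ℂ) - s - 2 * (a + n)‖ ≤
      5 / 2 * ‖a + n + 1 + k‖ := by
    intro s hs0 hs
    have : ‖(k : ℂ) - s - 2 * (a + n)‖ ≤ k + s + 2 * (‖a‖ + n) := by
      calc _ ≤ ‖(k : ℂ) - s‖ + ‖2 * (a + n)‖ := norm_sub_le _ _
        _ ≤ (‖(k : ℂ)‖ + ‖(s : ℂ)‖) + 2 * (‖a‖ + ‖(n : ℂ)‖) := by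
          rw [norm_mul, Complex.norm_two]
          gcongr
          · exact norm_sub_le _ _
          · exact norm_add_le _ _
        _ = _ := by rw [Complex.norm_natCast, Complex.norm_natCast, Complex.norm_real,
          Real.norm_of_nonneg hs0]
    linarith
  have h4 := h3 (1 / 2) (by norm_num) (by norm_num)
  have h5 := h3 (3 / 2) (by norm_num) (by norm_num)
  have h6 : 0 < ‖a + n + 1 + k‖ := by
    have := shift_ne_zero ha n k
    simpa using this
  push_cast at h4 h5
  rw [half_pow_ratio, sFactor_succ_left ha hc, norm_mul, norm_mul, norm_mul, mul_right_comm,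
    mul_comm]
  refine mul_le_mul_of_nonneg_right ?_ (by positivity)
  simp only [norm_div, norm_mul, norm_pow]
  rw [div_le_iff₀ (by simp; positivity)]
  calc _ ≤ ((1 + 1 / 2) * ‖a + n + 1‖) ^ 3 * (5 / 2 * ‖a + n + 1 + k‖) *
        (5 / 2 * ‖a + n + 1 + k‖) := by gcongr
    _ ≤ _ := by norm_num; nlinarith [mul_pos (pow_pos h0 3) (pow_pos h6 2)]

end

/-- The factorials cancel and leave a pure power, so that convergence in k becomes a count of
exponents. -/
lemma rise_div_isBigO {x y : ℂ} (hx : ∀ j : ℕ, x + j ≠ 0) (hy : ∀ j : ℕ, y + j ≠ 0) :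
    (fun n : ℕ => rise x n / rise y n) =O[atTop] fun n : ℕ => (n : ℝ) ^ (x.re - y.re) := by
  refine ((rise_isBigO hx).mul (rise_inv_isBigO hy)).congr' ?_ ?_
  · exact Eventually.of_forall fun n => (div_eq_mul_inv _ _).symm
  · filter_upwards [eventually_gt_atTop 0] with n hn
    have hn : (0 : ℝ) < n := by exact_mod_cast hn
    have hf : (n.factorial : ℝ) ≠ 0 := by exact_mod_cast n.factorial_ne_zero
    rw [show x.re - y.re = (x.re - 1) - (y.re - 1) by ring, Real.rpow_sub hn _ (y.re - 1),
      mul_inv, mul_mul_mul_comm, mul_inv_cancel₀ hf, one_mul, div_eq_mul_inv]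

lemma isBigO_natCast_rpow_mul {u v : ℕ → ℂ} {p q : ℝ}
    (hu : u =O[atTop] fun n : ℕ => (n : ℝ) ^ p) (hv : v =O[atTop] fun n : ℕ => (n : ℝ) ^ q) :
    (fun n => u n * v n) =O[atTop] fun n : ℕ => (n : ℝ) ^ (p + q) := by
  refine (hu.mul hv).congr' EventuallyEq.rfl ?_
  filter_upwards [eventually_gt_atTop 0] with n hn
  rw [Real.rpow_add (by exact_mod_cast hn)]

/-- The exponents add up to −2 for every a: 2(−1/2 − Re a) + (2 Re a − 1). -/
lemma summable_vTerm {a : ℂ} (ha : ∀ j : ℕ, a + 1 + j ≠ 0) (hb : ∀ j : ℕ, 3 / 2 - 2 * a + j ≠ 0) :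
    Summable (vTerm a) := by
  have h1 := rise_div_isBigO half_add_natCast_ne_zero ha
  have h2 := isBigO_natCast_rpow_mul (isBigO_natCast_rpow_mul h1 h1)
    (rise_div_isBigO half_add_natCast_ne_zero hb)
  refine summable_of_isBigO_nat (Real.summable_nat_rpow.2 ?_) (h2.congr_left fun n => ?_)
  · norm_num
    linarith
  · rw [vTerm]; ring

/-- The terms are O(n^(Re a − 3/2)), whence the restriction Re a < 1/2. -/
lemma summable_wTerm {a : ℂ} (h0 : ∀ j : ℕ, a + 1 / 2 + j ≠ 0) (h1 : ∀ j : ℕ, 2 * a + 1 + j ≠ 0)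
    (h2 : ∀ j : ℕ, 3 / 2 - a + j ≠ 0) (ha : a.re < 1 / 2) : Summable (wTerm a) := by
  have h2 := isBigO_natCast_rpow_mul (rise_div_isBigO h0 h1) (rise_div_isBigO h0 h2)
  refine summable_of_isBigO_nat (Real.summable_nat_rpow.2 ?_) (h2.congr_left fun n => ?_)
  · norm_num
    linarith
  · rw [wTerm]; ring

/-! ### Gamma identities for `gCoeff`, and the second form. -/

lemma Gamma_quarter_mul (a : ℂ) : Complex.Gamma (1 / 4 + a) * Complex.Gamma (3 / 4 + a) =
    Complex.Gamma (1 / 2 + 2 * a) * 2 ^ (1 / 2 - 2 * a) * (Real.sqrt Real.pi : ℂ) := by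
  have := Complex.Gamma_mul_Gamma_add_half (1 / 4 + a)
  rw [show 1 / 4 + a + 1 / 2 = 3 / 4 + a by ring,
    show 2 * (1 / 4 + a) = 1 / 2 + 2 * a by ring,
    show 1 - (1 / 2 + 2 * a) = 1 / 2 - 2 * a by ring] at this
  exact this

lemma Gamma_half_reflect (a : ℂ) : Complex.Gamma (1 / 2 + a) * Complex.Gamma (1 / 2 - a) =
    Real.pi / Complex.cos (Real.pi * a) := by
  have := Complex.Gamma_mul_Gamma_one_sub (1 / 2 + a)
  rw [show 1 - (1 / 2 + a) = 1 / 2 - a by ring, mul_add,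
    show (Real.pi : ℂ) * (1 / 2) = Real.pi / 2 by ring, add_comm ((Real.pi : ℂ) / 2),
    Complex.sin_add_pi_div_two] at this
  exact this

lemma Gamma_half_eq_sqrt : Complex.Gamma (1 / 2) = (Real.sqrt Real.pi : ℂ) := by
  have := Complex.Gamma_ofReal (1 / 2)
  rw [Real.Gamma_one_half_eq] at this
  rw [← this]
  norm_num

lemma sqrt_pi_sq : ((Real.sqrt Real.pi : ℝ) : ℂ) ^ 2 = Real.pi := by
  rw [← Complex.ofReal_pow, Real.sq_sqrt Real.pi_pos.le]

lemma sqrt_pi_ne_zero : ((Real.sqrt Real.pi : ℝ) : ℂ) ≠ 0 := by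
  exact_mod_cast (Real.sqrt_pos.2 Real.pi_pos).ne'

lemma four_cpow (a : ℂ) : (4 : ℂ) ^ a = 2 ^ (2 * a) := by
  have := Complex.natCast_cpow_natCast_mul 2 2 a
  push_cast at this
  rw [this]
  norm_num

/-- Duplication turns Γ(1/4+a)Γ(3/4+a) into Γ(1/2+2a), and reflection absorbs cos 2πa. The result is
twice the constant in `tendsto_sFactor`. -/
lemma gCoeff_eq {a : ℂ} (h : Complex.cos (2 * Real.pi * a) ≠ 0) :
    gCoeff a = 2 * (Complex.Gamma (a + 1) ^ 2 * Complex.Gamma (1 / 2 - 2 * a) /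
      Complex.Gamma (1 / 2) ^ 3) := by
  have h1 := Gamma_quarter_mul a
  have h2 := Gamma_quarter_mul 0
  have h3 := Gamma_half_reflect (2 * a)
  rw [show (Real.pi : ℂ) * (2 * a) = 2 * Real.pi * a by ring] at h3
  simp only [add_zero, mul_zero, sub_zero, Gamma_half_eq_sqrt] at h2
  have hpi : (Real.pi : ℂ) ≠ 0 := by exact_mod_cast Real.pi_ne_zero
  have hne : Complex.Gamma (1 / 2 + 2 * a) ≠ 0 := by
    intro h0
    rw [h0, zero_mul] at h3
    exact div_ne_zero hpi h h3.symm
  have e1 : Complex.Gamma (1 / 2 - 2 * a) =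
      Real.pi / Complex.cos (2 * Real.pi * a) / Complex.Gamma (1 / 2 + 2 * a) := by
    rw [← h3, mul_div_cancel_left₀ _ hne]
  have e2 : (2 : ℂ) ^ (1 / 2 - 2 * a) = 2 ^ (1 / 2 : ℂ) / 4 ^ a := by
    rw [four_cpow, Complex.cpow_sub _ _ two_ne_zero]
  have e3 : riseC (1 / 4) a * riseC (3 / 4) a = Complex.Gamma (1 / 2 + 2 * a) / 4 ^ a /
      (Real.sqrt Real.pi : ℂ) := by
    have : (2 : ℂ) ^ (1 / 2 : ℂ) ≠ 0 := by simp [Complex.cpow_eq_zero_iff]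
    have hs := sqrt_pi_ne_zero
    rw [riseC, riseC, div_mul_div_comm, h1, h2, e2]
    field_simp
  have h4 : (4 : ℂ) ^ a ≠ 0 := by simp [Complex.cpow_eq_zero_iff]
  rw [gCoeff, e3, e1, Gamma_half_eq_sqrt, riseC, Complex.Gamma_one, add_comm 1 a]
  have hs := sqrt_pi_ne_zero
  have hs2 := sqrt_pi_sq
  rw [← hs2]
  field_simp

lemma two_mul_ne_of_cos_ne_zero {a : ℂ} (h : Complex.cos (2 * Real.pi * a) ≠ 0) (m : ℤ) :
    2 * a ≠ m + 1 / 2 := by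
  intro h2
  refine h (Complex.cos_eq_zero_iff.2 ⟨m, ?_⟩)
  rw [show (2 : ℂ) * Real.pi * a = Real.pi * (2 * a) by ring, h2]
  ring

lemma three_halves_sub_ne_zero {a : ℂ} (hc : ∀ m : ℤ, 2 * a ≠ m + 1 / 2) (j : ℕ) :
    3 / 2 - 2 * a + j ≠ 0 := fun h => hc (j + 1) (by push_cast; linear_combination -h)

lemma sF_zero {a : ℂ} (hc : ∀ m : ℤ, 2 * a ≠ m + 1 / 2) (k : ℕ) :
    sF a 0 k = 512 * a ^ 3 / (4 * a - 1) * vTerm a k := by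
  have h1 : 1 / 2 - 2 * a ≠ 0 := fun h => hc 0 (by push_cast; linear_combination -h)
  have h2 : 4 * a - 1 ≠ 0 := fun h => hc 0 (by push_cast; linear_combination h / 2)
  have h3 : 1 / 2 - 2 * a + k ≠ 0 := fun h => hc k (by push_cast; linear_combination -h)
  have e := rise_add_one h1 k
  rw [show 1 / 2 - 2 * a + 1 = 3 / 2 - 2 * a by ring] at e
  rw [sF, sFactor, vTerm, e, fCoef_zero, Nat.cast_zero, add_zero,
    show (k : ℂ) + 1 / 2 - 2 * a = 1 / 2 - 2 * a + k by ring,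
    show 4 * a - 1 = -2 * (1 / 2 - 2 * a) by ring]
  generalize 1 / 2 - 2 * a + k = q at *
  generalize 1 / 2 - 2 * a = p at *
  field_simp
  ring

lemma one_le_norm_mul (a : ℂ) (n : ℕ) : (1 : ℝ) ≤ (‖a‖ + 1) * (n + 1) := by
  have := norm_nonneg a
  have : (0 : ℝ) ≤ n := Nat.cast_nonneg n
  nlinarith

lemma tendsto_zero_of_le_geometric {u : ℕ → ℂ} {C : ℝ} {p : ℕ}
    (h : ∀ᶠ n : ℕ in atTop, ‖u n‖ ≤ C * (((n : ℝ) + 1) ^ p * (1 / 2) ^ n)) :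
    Tendsto u atTop (𝓝 0) := by
  have h1 := (summable_pow_mul_half_pow p).tendsto_atTop_zero.const_mul C
  rw [mul_zero] at h1
  exact squeeze_zero_norm' h h1

lemma tendsto_sF {a : ℂ} (ha : ∀ m : ℕ, a ≠ -((m : ℂ) + 1)) (hc : ∀ m : ℤ, 2 * a ≠ m + 1 / 2)
    (k : ℕ) : Tendsto (fun n => sF a n k) atTop (𝓝 0) := by
  obtain ⟨C, hC, h⟩ := sFactor_bound ha hc
  refine tendsto_zero_of_le_geometric (C := 256 * (‖a‖ + 1) ^ 3 * C) (p := 3) ?_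
  -- From this n on, the denominator of `sF` has modulus at least 1.
  filter_upwards [eventually_ge_atTop ⌈‖a‖ + k + 1⌉₊] with n hn
  have hn : ‖a‖ + k + 1 ≤ n := (Nat.le_ceil _).trans (by exact_mod_cast hn)
  have h1 := norm_add_natCast_le a n
  have h2 := norm_add_natCast_ge a n
  have h3 : ‖sFactor a n k‖ ≤ C * (1 / 2) ^ n := by
    refine le_trans ?_ (h n k)
    rw [norm_mul]
    refine le_mul_of_one_le_right (norm_nonneg _) ?_
    have : ‖(k : ℂ) + 1‖ = k + 1 := by
      rw [← Nat.cast_succ, Complex.norm_natCast]; push_cast; rfl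
    rw [this]
    linarith [Nat.cast_nonneg (α := ℝ) k]
  have h4 : 1 ≤ ‖(k : ℂ) + 1 / 2 - 2 * (a + n)‖ := by
    have e1 : ‖2 * (a + n)‖ = 2 * ‖a + n‖ := by rw [norm_mul, Complex.norm_two]
    have e2 : ‖(k : ℂ) + 1 / 2‖ ≤ k + 1 / 2 := by
      refine (norm_add_le _ _).trans ?_
      rw [Complex.norm_natCast]; norm_num
    have e3 := norm_sub_norm_le (2 * (a + n)) ((k : ℂ) + 1 / 2)
    rw [norm_sub_rev] at e3
    have := Nat.cast_nonneg (α := ℝ) k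
    linarith
  rw [sF, norm_div, norm_mul, norm_mul, norm_pow, norm_neg]
  refine (div_le_self (by positivity) h4).trans ?_
  calc _ ≤ 256 * ((‖a‖ + 1) * (n + 1)) ^ 3 * (C * (1 / 2) ^ n) := by
        gcongr; norm_num
    _ = _ := by ring

/-- The weight k + 1 in `sFactor_bound` absorbs the linear growth in k; 251 = (120 + 34 + 3) + (84 +
10). -/
lemma sG_bound {a : ℂ} (ha : ∀ m : ℕ, a ≠ -((m : ℂ) + 1)) (hc : ∀ m : ℤ, 2 * a ≠ m + 1 / 2) :
    ∃ C : ℝ, ∀ n k, ‖sG a n k‖ ≤ C * (((n : ℝ) + 1) ^ 2 * (1 / 2) ^ n) := by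
  obtain ⟨C, hC, h⟩ := sFactor_bound ha hc
  refine ⟨C * (251 * (‖a‖ + 1) ^ 2), fun n k => ?_⟩
  have h1 := norm_add_natCast_le a n
  have h2 := one_le_norm_mul a n
  have h3 := h n k
  have hk := Nat.cast_nonneg (α := ℝ) k
  have e : ‖(k : ℂ) + 1‖ = k + 1 := by
    rw [← Nat.cast_succ, Complex.norm_natCast]; push_cast; rfl
  rw [norm_mul, e] at h3
  set y := (‖a‖ + 1) * ((n : ℝ) + 1) with hy
  have h4 : ‖120 * (a + n) ^ 2 + 34 * (a + n) + 3 + (84 * (a + n) + 10) * k‖ ≤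
      251 * y ^ 2 * (k + 1) := by
    calc _ ≤ ‖120 * (a + n) ^ 2 + 34 * (a + n) + 3‖ + ‖(84 * (a + n) + 10) * k‖ :=
          norm_add_le _ _
      _ ≤ (‖120 * (a + n) ^ 2‖ + ‖34 * (a + n)‖ + ‖(3 : ℂ)‖) +
          (‖84 * (a + n)‖ + ‖(10 : ℂ)‖) * k := by
          rw [norm_mul _ (k : ℂ), Complex.norm_natCast]
          gcongr
          · exact norm_add₃_le
          · exact norm_add_le _ _
      _ = (120 * ‖a + n‖ ^ 2 + 34 * ‖a + n‖ + 3) + (84 * ‖a + n‖ + 10) * k := by simp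
      _ ≤ (120 * y ^ 2 + 34 * y + 3) + (84 * y + 10) * k := by gcongr
      _ ≤ (157 * y ^ 2) + (94 * y ^ 2) * k := by gcongr <;> nlinarith
      _ ≤ _ := by nlinarith [mul_nonneg (sq_nonneg y) hk, sq_nonneg y]
  rw [sG, norm_mul]
  calc _ ≤ ‖sFactor a n k‖ * (251 * y ^ 2 * (k + 1)) := by gcongr
    _ = (‖sFactor a n k‖ * (k + 1)) * (251 * y ^ 2) := by ring
    _ ≤ (C * (1 / 2) ^ n) * (251 * y ^ 2) := by gcongr
    _ = _ := by rw [hy]; ring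

/-- Only the coefficient 84(a+n) + 10 of k survives, and it is twice the linear factor of g. -/
lemma tendsto_sG {a : ℂ} (ha : ∀ m : ℕ, a ≠ -((m : ℂ) + 1))
    (h : Complex.cos (2 * Real.pi * a) ≠ 0) (n : ℕ) :
    Tendsto (fun k => sG a n k) atTop (𝓝 (gCoeff a * gTerm a n)) := by
  have h1 := (tendsto_sFactor ha (two_mul_ne_of_cos_ne_zero h) n).mul
    (tendsto_linear_quotient (84 * (a + n) + 10) (120 * (a + n) ^ 2 + 34 * (a + n) + 3) 1)
  refine (h1.congr fun k => ?_).trans (le_of_eq ?_)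
  · have : (k : ℂ) + 1 ≠ 0 := by exact_mod_cast k.succ_ne_zero
    rw [sG]
    field_simp
    ring
  · rw [gCoeff_eq h, gTerm_eq]
    congr 1
    ring

theorem f_second_form {a : ℂ} (ha : ∀ m : ℕ, a ≠ -((m : ℂ) + 1))
    (h : Complex.cos (2 * Real.pi * a) ≠ 0) :
    Summable (vTerm a) ∧
      f a = gCoeff a * g a + 512 * a ^ 3 / (4 * a - 1) * ∑' n : ℕ, vTerm a n := by
  have hc := two_mul_ne_of_cos_ne_zero h
  have hv := summable_vTerm (add_one_add_ne_zero ha) (three_halves_sub_ne_zero hc)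
  refine ⟨hv, ?_⟩
  obtain ⟨C, hC⟩ := sG_bound ha hc
  have h1 := wz_hasSum (sF_sub ha hc) (tendsto_sF ha hc)
    ((summable_pow_mul_half_pow 2).mul_left C) hC (tendsto_sG ha h)
  have h2 : Tendsto (fun K => ∑ k ∈ Finset.range K, sF a 0 k) atTop
      (𝓝 (512 * a ^ 3 / (4 * a - 1) * ∑' n : ℕ, vTerm a n)) := by
    simp only [sF_zero hc, ← Finset.mul_sum]
    exact hv.hasSum.tendsto_sum_nat.const_mul _
  have h3 := tendsto_nhds_unique h1 h2
  have h4 : ∀ n, sG a n 0 = fTerm a n := fun n => by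
    rw [sG, sFactor, fTerm_eq]; simp [add_comm]
  simp only [h4, tsum_mul_left] at h3
  rw [← h3, f, g]
  ring

/-! ### The WZ pair behind the first form. -/

/-- The common hypergeometric factor of the WZ pair behind the first form of `f`. -/
def uFactor (a : ℂ) (n k : ℕ) : ℂ :=
  fCoef a n * (rise (1 / 2) k ^ 2 * rise (a + n + 1 / 2) k ^ 2 /
    (rise (a + n + 1) k ^ 2 * rise (2 * (a + n) + 1) k ^ 2))

/-- First member of the WZ pair behind the first form of `f`. -/
def uF (a : ℂ) (n k : ℕ) : ℂ := 32 * (a + n) * (4 * k + 4 * (a + n) + 1) * uFactor a n k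

/-- The polynomial in the second member of the WZ pair behind the first form of `f`. -/
def uPoly (x k : ℂ) : ℂ :=
  3 + 46 * x + 268 * x ^ 2 + 616 * x ^ 3 + 480 * x ^ 4 +
    k * (24 + 288 * x + 992 * x ^ 2 + 1024 * x ^ 3) + k ^ 2 * (68 + 488 * x + 768 * x ^ 2) +
    k ^ 3 * (80 + 256 * x) + 32 * k ^ 4

/-- Second member of the WZ pair behind the first form of `f`. -/
def uG (a : ℂ) (n k : ℕ) : ℂ :=
  uFactor a n k * (uPoly (a + n) k / (2 * (a + n) + 1 + k) ^ 2)

lemma uFactor_succ_right (a : ℂ) (n k : ℕ) : uFactor a n (k + 1) = uFactor a n k *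
    ((1 / 2 + k) ^ 2 * (a + n + 1 / 2 + k) ^ 2 /
      ((a + n + 1 + k) ^ 2 * (2 * (a + n) + 1 + k) ^ 2)) := by
  simp only [uFactor, rise_succ]
  generalize a + n + 1 + k = p
  generalize 2 * (a + n) + 1 + k = q
  ring

section

variable {a : ℂ} (ha : 0 < a.re)

include ha in
lemma re_add_natCast_pos (n : ℕ) : 0 < (a + n).re := by
  simp; positivity

lemma add_ofReal_ne_zero {x : ℂ} (hx : 0 < x.re) {s : ℝ} (hs : 0 ≤ s) : x + s ≠ 0 := by
  intro h
  have := congrArg Complex.re h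
  simp at this
  linarith

include ha in
lemma uFactor_succ_left (n k : ℕ) : uFactor a (n + 1) k = uFactor a n k *
    ((a + n + 1 / 2) ^ 3 * (a + n + 1 / 4) * (a + n + 3 / 4) * (a + n + 1 / 2 + k) ^ 2 /
      ((a + n + 1) * (a + n + 1 + k) ^ 2 * (2 * (a + n) + 1 + k) ^ 2 *
        (2 * (a + n) + 2 + k) ^ 2)) := by
  have hx := re_add_natCast_pos ha n
  have h2x : 0 < (2 * (a + n)).re := by simpa using hx
  have h1 : a + n + 1 / 2 ≠ 0 := by simpa using add_ofReal_ne_zero hx (s := 1 / 2) (by norm_num)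
  have h2 : a + n + 1 ≠ 0 := by simpa using add_ofReal_ne_zero hx (s := 1) (by norm_num)
  have h3 : 2 * (a + n) + 1 ≠ 0 := by simpa using add_ofReal_ne_zero h2x (s := 1) (by norm_num)
  have h4 : 2 * (a + n) + 1 + 1 ≠ 0 := fun h => h2 (by linear_combination h / 2)
  have r1 := rise_ne_zero (x := a + n + 1) (fun j => add_natCast_ne_zero_of_re_pos
    (by simp; positivity) j) k
  have r2 := rise_ne_zero (x := 2 * (a + n) + 1) (fun j => add_natCast_ne_zero_of_re_pos
    (by simp; positivity) j) k
  have h5 : a + n + 1 + k ≠ 0 := add_natCast_ne_zero_of_re_pos (by simp; positivity) k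
  have h6 : 2 * (a + n) + 1 + k ≠ 0 := add_natCast_ne_zero_of_re_pos (by simp; positivity) k
  have h7 : 2 * (a + n) + 2 + k ≠ 0 := add_natCast_ne_zero_of_re_pos (by simp; positivity) k
  have e1 := rise_add_one h1 k
  have e2 := rise_add_one h2 k
  have e3 := rise_add_two h3 h4 k
  simp only [uFactor, fCoef_succ]
  rw [show a + ((n + 1 : ℕ) : ℂ) + 1 / 2 = a + n + 1 / 2 + 1 by push_cast; ring,
    show a + ((n + 1 : ℕ) : ℂ) + 1 = a + n + 1 + 1 by push_cast; ring,
    show 2 * (a + ((n + 1 : ℕ) : ℂ)) + 1 = 2 * (a + n) + 1 + 2 by push_cast; ring, e1, e2, e3,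
    show 2 * (a + n) + 1 + 1 + k = 2 * (a + n) + 2 + k by ring]
  rw [show 2 * (a + n) + 1 + 1 = 2 * (a + n + 1) by ring] at h4 ⊢
  generalize 2 * (a + n) + 2 + k = p at *
  generalize 2 * (a + n) + 1 + k = q at *
  have e4 : 2 * (a + n) + 1 = 2 * (a + n + 1 / 2) := by ring
  rw [e4] at h3 r2 ⊢
  generalize rise (2 * (a + n + 1 / 2)) k = r at *
  generalize rise (a + n + 1) k = r' at *
  generalize a + n + 1 + k = w at *
  generalize a + n + 1 / 2 + k = w' at *
  generalize a + n + 1 / 2 = u at *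
  generalize a + n + 1 = v at *
  field_simp
  ring

include ha in
lemma uF_sub (n k : ℕ) : uF a (n + 1) k - uF a n k = uG a n (k + 1) - uG a n k := by
  have hx := re_add_natCast_pos ha n
  have h2 : a + n + 1 ≠ 0 := by simpa using add_ofReal_ne_zero hx (s := 1) (by norm_num)
  have h5 : a + n + 1 + k ≠ 0 := add_natCast_ne_zero_of_re_pos (by simp; positivity) k
  have h6 : 2 * (a + n) + 1 + k ≠ 0 := add_natCast_ne_zero_of_re_pos (by simp; positivity) k
  have h7 : 2 * (a + n) + 2 + k ≠ 0 := add_natCast_ne_zero_of_re_pos (by simp; positivity) k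
  simp only [uF, uG, uFactor_succ_left ha, uFactor_succ_right]
  push_cast
  rw [show 2 * (a + (n : ℂ)) + 1 + (k + 1) = 2 * (a + n) + 2 + k by ring,
    show a + ((n : ℂ) + 1) = a + n + 1 by ring]
  generalize uFactor a n k = t
  generalize a + n = x at *
  generalize (k : ℂ) = k at *
  rw [← sub_eq_zero]
  have key : 32 * (4 * k + 4 * (x + 1) + 1) * ((x + 1 / 2) ^ 3 * (x + 1 / 4) * (x + 3 / 4) *
      (x + 1 / 2 + k) ^ 2) - 32 * x * (4 * k + 4 * x + 1) * (x + 1 + k) ^ 2 *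
      (2 * x + 1 + k) ^ 2 * (2 * x + 2 + k) ^ 2 -
      ((1 / 2 + k) ^ 2 * (x + 1 / 2 + k) ^ 2 * uPoly x (k + 1) -
        uPoly x k * (x + 1 + k) ^ 2 * (2 * x + 2 + k) ^ 2) = 0 := by
    simp only [uPoly]
    ring
  generalize 2 * x + 1 + k = p at *
  generalize 2 * x + 2 + k = q at *
  generalize x + 1 + k = w at *
  generalize uPoly x k = P at *
  generalize uPoly x (k + 1) = Q at *
  rw [← mul_zero (t / (w ^ 2 * p ^ 2 * q ^ 2)), ← key]
  generalize x + 1 / 2 + k = w' at *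
  generalize 4 * k + 4 * x + 1 = c1 at *
  generalize 4 * k + 4 * (x + 1) + 1 = c2 at *
  generalize x + 1 / 2 = c3 at *
  generalize x + 1 / 4 = c4 at *
  generalize x + 3 / 4 = c5 at *
  generalize 1 / 2 + k = c6 at *
  field_simp

include ha in
-- The weighted factor is O(k^(−4 Re(a+n))), which uses Re a > 0. Writing k + 1 as (2)_k/(1)_k lets
-- `rise_div_isBigO` handle the weight too.
lemma tendsto_uFactor (n : ℕ) : Tendsto (fun k : ℕ => uFactor a n k * (k + 1) ^ 2) atTop (𝓝 0) := by
  have hx := re_add_natCast_pos ha n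
  have b1 : ∀ j : ℕ, a + n + 1 / 2 + j ≠ 0 := fun j => add_natCast_ne_zero_of_re_pos
    (by rw [Complex.add_re]; norm_num at hx ⊢; linarith) j
  have b2 : ∀ j : ℕ, a + n + 1 + j ≠ 0 := fun j => add_natCast_ne_zero_of_re_pos
    (by simp; positivity) j
  have b3 : ∀ j : ℕ, 2 * (a + n) + 1 + j ≠ 0 := fun j => add_natCast_ne_zero_of_re_pos
    (by simp; positivity) j
  have b4 : ∀ j : ℕ, (1 : ℂ) + j ≠ 0 := fun j => add_natCast_ne_zero_of_re_pos (by simp) j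
  have b5 : ∀ j : ℕ, (2 : ℂ) + j ≠ 0 := fun j => add_natCast_ne_zero_of_re_pos (by simp) j
  have o1 := isBigO_natCast_rpow_mul (rise_div_isBigO half_add_natCast_ne_zero b2)
    (rise_div_isBigO b1 b3)
  have o2 := rise_div_isBigO b5 b4
  have o3 := isBigO_natCast_rpow_mul (isBigO_natCast_rpow_mul o1 o1) (isBigO_natCast_rpow_mul o2 o2)
  have o4 : (fun k : ℕ => uFactor a n k * (k + 1) ^ 2) =O[atTop]
      fun k : ℕ => (k : ℝ) ^ (-(4 * (a + n).re)) := by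
    refine ((o3.const_mul_left (fCoef a n)).congr_left fun k => ?_).congr_right fun k => ?_
    · have e : rise 2 k / rise 1 k = k + 1 := by
        have := rise_add_one (x := 1) one_ne_zero k
        rw [show (1 : ℂ) + 1 = 2 by norm_num] at this
        have h1 := rise_ne_zero b4 k
        rw [this]
        field_simp
        ring
      rw [e, uFactor]
      ring
    · congr 1
      simp
      ring
  refine o4.trans_tendsto ?_
  exact (tendsto_rpow_neg_atTop (by linarith)).comp tendsto_natCast_atTop_atTop

include ha in
-- For Re a > 0 the comparisons of moduli hold for all n and k, so the ratio bound 1/2 starts at n =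
-- 0.
lemma uFactor_bound :
    ∃ C : ℝ, 0 ≤ C ∧ ∀ n k, ‖uFactor a n k * (k + 1) ^ 2‖ ≤ C * (1 / 2) ^ n := by
  refine exists_bound_of_ratio_le half_pow_pos
    (fun n => exists_bound_of_tendsto (tendsto_uFactor ha n)) 0 fun n _ k => ?_
  have hx := re_add_natCast_pos ha n
  have hk := Nat.cast_nonneg (α := ℝ) k
  rw [half_pow_ratio, uFactor_succ_left ha, norm_mul, norm_mul, norm_mul, mul_right_comm,
    mul_comm]
  refine mul_le_mul_of_nonneg_right ?_ (by positivity)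
  generalize a + n = x at *
  have c1 : ‖x + 1 / 2‖ ≤ ‖x + 1‖ := norm_le_norm_of_abs_re_le
    (by simp; rw [abs_of_pos, abs_of_pos] <;> linarith) (by simp)
  have c2 : ‖x + 1 / 4‖ ≤ ‖x + 1‖ := norm_le_norm_of_abs_re_le
    (by simp; rw [abs_of_pos, abs_of_pos] <;> linarith) (by simp)
  have c3 : ‖x + 3 / 4‖ ≤ ‖x + 1‖ := norm_le_norm_of_abs_re_le
    (by simp; rw [abs_of_pos, abs_of_pos] <;> linarith) (by simp)
  have c4 : ‖x + 1 / 2 + k‖ ≤ ‖x + 1 + k‖ := norm_le_norm_of_abs_re_le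
    (by simp; rw [abs_of_pos, abs_of_pos] <;> linarith) (by simp)
  have c5 : 2 * ‖x + 1 / 2‖ ≤ ‖2 * x + 1 + k‖ := by
    rw [← Complex.norm_two, ← norm_mul]
    exact norm_le_norm_of_abs_re_le
      (by simp; rw [abs_of_pos, abs_of_pos] <;> linarith) (by simp)
  have c6 : 2 * ‖x + 1‖ ≤ ‖2 * x + 2 + k‖ := by
    rw [← Complex.norm_two, ← norm_mul]
    exact norm_le_norm_of_abs_re_le
      (by simp; rw [abs_of_pos, abs_of_pos] <;> linarith) (by simp)
  have h1 : 0 < ‖x + 1 / 2‖ := by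
    have : x + 1 / 2 ≠ 0 := by simpa using add_ofReal_ne_zero hx (s := 1 / 2) (by norm_num)
    simpa using this
  have h5 : 0 < ‖x + 1 + k‖ :=
    norm_pos_iff.2 (add_natCast_ne_zero_of_re_pos (by simp; positivity) k)
  have h3 : 0 < ‖x + 1‖ := h1.trans_le c1
  simp only [norm_div, norm_mul, norm_pow]
  have h6 : 0 < ‖2 * x + 1 + k‖ := lt_of_lt_of_le (by positivity) c5
  have h7 : 0 < ‖2 * x + 2 + k‖ := lt_of_lt_of_le (by positivity) c6
  rw [div_le_iff₀ (by positivity)]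
  calc _ ≤ ‖x + 1 / 2‖ ^ 2 * ‖x + 1‖ * ‖x + 1‖ * ‖x + 1‖ * ‖x + 1 + k‖ ^ 2 := by
        rw [pow_succ ‖x + 1 / 2‖ 2]; gcongr
    _ ≤ 1 / 2 * (‖x + 1‖ * ‖x + 1 + k‖ ^ 2 * (2 * ‖x + 1 / 2‖) ^ 2 * (2 * ‖x + 1‖) ^ 2) := by
        have : 0 ≤ ‖x + 1 / 2‖ ^ 2 * ‖x + 1‖ ^ 3 * ‖x + 1 + k‖ ^ 2 := by positivity
        nlinarith
    _ ≤ _ := by gcongr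

/-- 5433 is the sum of the coefficients; the degree in each variable is at most 4. -/
lemma norm_uPoly_le {x : ℂ} {y κ : ℝ} (hx : ‖x‖ ≤ y) (hy : 1 ≤ y) {k : ℂ} (hk : ‖k‖ ≤ κ)
    (hκ : 1 ≤ κ) : ‖uPoly x k‖ ≤ 5433 * (y ^ 4 * κ ^ 4) := by
  have t : ∀ (c : ℝ) (i j : ℕ), 0 ≤ c → i ≤ 4 → j ≤ 4 →
      ‖(c : ℂ) * x ^ i * k ^ j‖ ≤ c * (y ^ 4 * κ ^ 4) := by
    intro c i j hc hi hj
    rw [norm_mul, norm_mul, norm_pow, norm_pow, Complex.norm_real, Real.norm_of_nonneg hc, mul_assoc]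
    gcongr
    · exact (pow_le_pow_left₀ (norm_nonneg _) hx i).trans (pow_le_pow_right₀ hy hi)
    · exact (pow_le_pow_left₀ (norm_nonneg _) hk j).trans (pow_le_pow_right₀ hκ hj)
  have e : uPoly x k = ((3 : ℝ) : ℂ) * x ^ 0 * k ^ 0 + ((46 : ℝ) : ℂ) * x ^ 1 * k ^ 0 +
      ((268 : ℝ) : ℂ) * x ^ 2 * k ^ 0 + ((616 : ℝ) : ℂ) * x ^ 3 * k ^ 0 +
      ((480 : ℝ) : ℂ) * x ^ 4 * k ^ 0 + ((24 : ℝ) : ℂ) * x ^ 0 * k ^ 1 +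
      ((288 : ℝ) : ℂ) * x ^ 1 * k ^ 1 + ((992 : ℝ) : ℂ) * x ^ 2 * k ^ 1 +
      ((1024 : ℝ) : ℂ) * x ^ 3 * k ^ 1 + ((68 : ℝ) : ℂ) * x ^ 0 * k ^ 2 +
      ((488 : ℝ) : ℂ) * x ^ 1 * k ^ 2 + ((768 : ℝ) : ℂ) * x ^ 2 * k ^ 2 +
      ((80 : ℝ) : ℂ) * x ^ 0 * k ^ 3 + ((256 : ℝ) : ℂ) * x ^ 1 * k ^ 3 +
      ((32 : ℝ) : ℂ) * x ^ 0 * k ^ 4 := by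
    rw [uPoly]; push_cast; ring
  rw [e]
  have h := (t 3 0 0 (by norm_num) (by norm_num) (by norm_num))
  replace h := norm_add_le_of_le h (t 46 1 0 (by norm_num) (by norm_num) (by norm_num))
  replace h := norm_add_le_of_le h (t 268 2 0 (by norm_num) (by norm_num) (by norm_num))
  replace h := norm_add_le_of_le h (t 616 3 0 (by norm_num) (by norm_num) (by norm_num))
  replace h := norm_add_le_of_le h (t 480 4 0 (by norm_num) (by norm_num) (by norm_num))
  replace h := norm_add_le_of_le h (t 24 0 1 (by norm_num) (by norm_num) (by norm_num))
  replace h := norm_add_le_of_le h (t 288 1 1 (by norm_num) (by norm_num) (by norm_num))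
  replace h := norm_add_le_of_le h (t 992 2 1 (by norm_num) (by norm_num) (by norm_num))
  replace h := norm_add_le_of_le h (t 1024 3 1 (by norm_num) (by norm_num) (by norm_num))
  replace h := norm_add_le_of_le h (t 68 0 2 (by norm_num) (by norm_num) (by norm_num))
  replace h := norm_add_le_of_le h (t 488 1 2 (by norm_num) (by norm_num) (by norm_num))
  replace h := norm_add_le_of_le h (t 768 2 2 (by norm_num) (by norm_num) (by norm_num))
  replace h := norm_add_le_of_le h (t 80 0 3 (by norm_num) (by norm_num) (by norm_num))
  replace h := norm_add_le_of_le h (t 256 1 3 (by norm_num) (by norm_num) (by norm_num))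
  replace h := norm_add_le_of_le h (t 32 0 4 (by norm_num) (by norm_num) (by norm_num))
  exact h.trans (le_of_eq (by ring))

include ha in
-- Of the four powers of k + 1 in the polynomial, two are paid for by (2(a+n)+1+k)² and two go to
-- the weight on `uFactor`.
lemma norm_uG_le (n k : ℕ) : ‖uG a n k‖ ≤
    ‖uFactor a n k * (k + 1) ^ 2‖ * (5433 * ((‖a‖ + 1) * (n + 1)) ^ 4) := by
  have hx := re_add_natCast_pos ha n
  have hk := Nat.cast_nonneg (α := ℝ) k
  have h1 : (k : ℝ) + 1 ≤ ‖2 * (a + n) + 1 + k‖ := by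
    refine le_trans ?_ (Complex.re_le_norm _)
    norm_num at hx ⊢
    linarith
  have h2 := norm_uPoly_le (norm_add_natCast_le a n) (one_le_norm_mul a n) (k := k)
    (κ := k + 1) (by rw [Complex.norm_natCast]; linarith) (by linarith)
  have e : ‖(k : ℂ) + 1‖ = k + 1 := by
    rw [← Nat.cast_succ, Complex.norm_natCast]; push_cast; rfl
  have h3 : 0 < ‖2 * (a + n) + 1 + k‖ := lt_of_lt_of_le (by positivity) h1
  rw [uG, norm_mul, norm_mul, norm_pow, e, mul_assoc, norm_div, norm_pow]
  refine mul_le_mul_of_nonneg_left ?_ (norm_nonneg _)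
  rw [div_le_iff₀ (by positivity)]
  refine h2.trans ?_
  calc _ = ((k : ℝ) + 1) ^ 2 * (5433 * ((‖a‖ + 1) * (n + 1)) ^ 4) * ((k : ℝ) + 1) ^ 2 := by ring
    _ ≤ _ := by gcongr

include ha in
-- Writing 4n + 4a + 1 as 4(a+1/4)(a+5/4)_n/(a+1/4)_n gives terms O(n^(−1 − 4 Re a)).
lemma summable_uTerm : Summable (uTerm a) := by
  have b1 : ∀ j : ℕ, a + 1 / 2 + j ≠ 0 := fun j => add_natCast_ne_zero_of_re_pos
    (by rw [Complex.add_re]; norm_num; linarith) j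
  have b2 : ∀ j : ℕ, a + 1 + j ≠ 0 := fun j => add_natCast_ne_zero_of_re_pos
    (by simp; positivity) j
  have b3 : ∀ j : ℕ, 2 * a + 1 + j ≠ 0 := fun j => add_natCast_ne_zero_of_re_pos
    (by simp; positivity) j
  have b6 : ∀ j : ℕ, a + 1 / 4 + j ≠ 0 := fun j => add_natCast_ne_zero_of_re_pos
    (by rw [Complex.add_re]; norm_num; linarith) j
  have b7 : ∀ j : ℕ, a + 5 / 4 + j ≠ 0 := fun j => add_natCast_ne_zero_of_re_pos
    (by rw [Complex.add_re]; norm_num; linarith) j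
  have o1 := isBigO_natCast_rpow_mul (rise_div_isBigO half_add_natCast_ne_zero b2)
    (rise_div_isBigO b1 b3)
  have o3 := isBigO_natCast_rpow_mul (isBigO_natCast_rpow_mul o1 o1) (rise_div_isBigO b7 b6)
  refine summable_of_isBigO_nat (Real.summable_nat_rpow.2 ?_)
    ((o3.const_mul_left (4 * (a + 1 / 4))).congr_left fun k => ?_)
  · norm_num
    linarith
  · have h0 : a + 1 / 4 ≠ 0 := by simpa using b6 0
    have h1 := rise_add_one h0 k
    have h2 := rise_ne_zero b6 k
    rw [show a + 1 / 4 + 1 = a + 5 / 4 by ring] at h1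
    rw [h1, uTerm, show 4 * (k : ℂ) + 4 * a + 1 = 4 * (a + 1 / 4 + k) by ring]
    generalize a + 1 / 4 + k = p
    generalize a + 1 / 4 = q at *
    field_simp

include ha in
theorem f_first_form : f a = 32 * a * ∑' n : ℕ, uTerm a n := by
  obtain ⟨C, hC, h⟩ := uFactor_bound ha
  have hF : ∀ k, Tendsto (fun n => uF a n k) atTop (𝓝 0) := by
    intro k
    have hk := Nat.cast_nonneg (α := ℝ) k
    refine tendsto_zero_of_le_geometric (C := 32 * (‖a‖ + 1) ^ 2 * (4 * k + 5) * C) (p := 2)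
      (Eventually.of_forall fun n => ?_)
    have h1 := norm_add_natCast_le a n
    have h2 := one_le_norm_mul a n
    have h3 : ‖uFactor a n k‖ ≤ C * (1 / 2) ^ n := by
      refine le_trans ?_ (h n k)
      have e : ‖(k : ℂ) + 1‖ = k + 1 := by
        rw [← Nat.cast_succ, Complex.norm_natCast]; push_cast; rfl
      rw [norm_mul, norm_pow, e]
      exact le_mul_of_one_le_right (norm_nonneg _) (by nlinarith)
    set y := (‖a‖ + 1) * ((n : ℝ) + 1) with hy
    have h4 : ‖4 * (k : ℂ) + 4 * (a + n) + 1‖ ≤ (4 * k + 5) * y := by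
      calc _ ≤ ‖4 * (k : ℂ)‖ + ‖4 * (a + n)‖ + ‖(1 : ℂ)‖ := norm_add₃_le
        _ = 4 * k + 4 * ‖a + n‖ + 1 := by simp
        _ ≤ 4 * k + 4 * y + 1 := by gcongr
        _ ≤ _ := by nlinarith
    rw [uF, norm_mul, norm_mul, norm_mul]
    calc _ ≤ 32 * y * ((4 * k + 5) * y) * (C * (1 / 2) ^ n) := by gcongr; norm_num
      _ = _ := by rw [hy]; ring
  have h1 := wz_hasSum (uF_sub ha) hF (L := fun _ => 0)
    ((summable_pow_mul_half_pow 4).mul_left (C * (5433 * (‖a‖ + 1) ^ 4)))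
    (fun n k => (norm_uG_le ha n k).trans ?_) (fun n => ?_)
  · have h2 : Tendsto (fun K => ∑ k ∈ Finset.range K, uF a 0 k) atTop
        (𝓝 (32 * a * ∑' n : ℕ, uTerm a n)) := by
      have e : ∀ k, uF a 0 k = 32 * a * uTerm a k := fun k => by
        rw [uF, uFactor, uTerm, fCoef_zero]; simp only [Nat.cast_zero, add_zero]; ring
      simp only [e, ← Finset.mul_sum]
      exact (summable_uTerm ha).hasSum.tendsto_sum_nat.const_mul _
    have h3 := tendsto_nhds_unique h1 h2
    have h4 : ∀ n, uG a n 0 = fTerm a n := fun n => by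
      have h6 : 2 * (a + n) + 1 ≠ 0 := by
        have := re_add_natCast_pos ha n
        simpa using add_natCast_ne_zero_of_re_pos (x := 2 * (a + n) + 1) (by simp; positivity) 0
      -- At k = 0 the polynomial contains the square that `uG` divides by, leaving the quadratic of
      -- f.
      have e : uPoly (a + n) 0 =
          (2 * (a + n) + 1) ^ 2 * (120 * (n + a) ^ 2 + 34 * (n + a) + 3) := by
        rw [uPoly]; ring
      rw [uG, uFactor, fTerm_eq]
      simp only [rise_zero, Nat.cast_zero, add_zero, e]
      field_simp
    simp only [h4, tsum_zero, sub_zero] at h3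
    rw [← h3, f]
  · refine (mul_le_mul_of_nonneg_right (h n k) (by positivity)).trans (le_of_eq ?_)
    ring
  · refine squeeze_zero_norm (norm_uG_le ha n) ?_
    simpa using (tendsto_uFactor ha n).norm.mul_const (5433 * ((‖a‖ + 1) * ((n : ℝ) + 1)) ^ 4)

end

/-! ### The value at 1/2. -/

/-- Since 4n + 3 = 4((n+1)² − (n+1/2)²), the term splits into two inverse squares. -/
lemma uTerm_half (n : ℕ) : uTerm (1 / 2) n =
    ((4 * (1 / (2 * (n : ℝ) + 1) ^ 2 - 1 / (2 * (n : ℝ) + 2) ^ 2) : ℝ) : ℂ) := by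
  have b1 : ∀ j : ℕ, (1 : ℂ) + j ≠ 0 := fun j => add_natCast_ne_zero_of_re_pos (by simp) j
  have r1 := rise_ne_zero b1 n
  have r2 := rise_ne_zero half_add_natCast_ne_zero n
  have e1 := rise_add_one (x := 1) one_ne_zero n
  have e2 := rise_add_one (x := 1 / 2) (by norm_num) n
  have h1 := b1 n
  have h2 := half_add_natCast_ne_zero n
  rw [uTerm, show (1 / 2 + 1 / 2 : ℂ) = 1 by norm_num, show (2 * (1 / 2) + 1 : ℂ) = 1 + 1 by norm_num,
    e1, e2]
  push_cast
  rw [show (2 * (n : ℂ) + 1) = 2 * (1 / 2 + n) by ring, show (2 * (n : ℂ) + 2) = 2 * (1 + n) by ring,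
    show 4 * (n : ℂ) + 4 * (1 / 2) + 1 = 4 * ((1 + n) ^ 2 - (1 / 2 + n) ^ 2) by ring]
  generalize (1 : ℂ) / 2 + n = p at *
  generalize (1 : ℂ) + n = q at *
  field_simp

/-- The even squares contribute a quarter of ζ(2), the odd squares the remaining three quarters. -/
lemma hasSum_inv_even_odd : HasSum (fun n : ℕ => 1 / (2 * (n : ℝ) + 1) ^ 2 -
    1 / (2 * (n : ℝ) + 2) ^ 2) (Real.pi ^ 2 / 12) := by
  have h1 : HasSum (fun n : ℕ => 1 / ((n : ℝ) + 1) ^ 2) (Real.pi ^ 2 / 6) := by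
    have h := (hasSum_nat_add_iff' 1).2 hasSum_zeta_two
    simpa using h
  have he : HasSum (fun n : ℕ => 1 / (2 * (n : ℝ) + 2) ^ 2) (1 / 4 * (Real.pi ^ 2 / 6)) := by
    have e : (fun n : ℕ => 1 / (2 * (n : ℝ) + 2) ^ 2) =
        fun n : ℕ => 1 / 4 * (1 / ((n : ℝ) + 1) ^ 2) := by
      funext n
      rw [show (2 * (n : ℝ) + 2) = 2 * (n + 1) by ring]
      generalize (n : ℝ) + 1 = p
      ring
    rw [e]
    exact h1.mul_left _
  have ho : Summable fun n : ℕ => 1 / (2 * (n : ℝ) + 1) ^ 2 := by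
    refine (h1.summable.comp_injective (i := fun n : ℕ => 2 * n)
      (fun x y h => by simpa using h)).congr fun n => ?_
    simp
  have h2 : HasSum (fun n : ℕ => 1 / ((n : ℝ) + 1) ^ 2)
      (∑' n : ℕ, 1 / (2 * (n : ℝ) + 1) ^ 2 + 1 / 4 * (Real.pi ^ 2 / 6)) := by
    refine HasSum.even_add_odd ?_ ?_
    · simpa using ho.hasSum
    · have e : (fun n : ℕ => 1 / (((2 * n + 1 : ℕ) : ℝ) + 1) ^ 2) =
          fun n : ℕ => 1 / (2 * (n : ℝ) + 2) ^ 2 := by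
        funext n
        push_cast
        ring_nf
      rwa [e]
  have h3 := h2.unique h1
  have h4 := ho.hasSum.sub he
  rwa [show ∑' n : ℕ, 1 / (2 * (n : ℝ) + 1) ^ 2 - 1 / 4 * (Real.pi ^ 2 / 6) = Real.pi ^ 2 / 12 by
    linear_combination h3] at h4

theorem f_half : f (1 / 2) = ((16 * Real.pi ^ 2 / 3 : ℝ) : ℂ) := by
  rw [f_first_form (by norm_num)]
  simp only [uTerm_half]
  rw [← Complex.ofReal_tsum, tsum_mul_left, hasSum_inv_even_odd.tsum_eq]
  push_cast
  ring

/-! ### Holomorphy of f and g on right half-planes. -/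

lemma differentiable_rise (n : ℕ) : Differentiable ℂ fun x => rise x n :=
  (ascPochhammer ℂ n).differentiable

/-- −3/4 is the midpoint of −1/2 and −1: to its right |x + 1/2| ≤ |x + 1|, so each ratio is at most
1/64 without any threshold on n. -/
lemma norm_gCoef_le {a : ℂ} (ha : -(3 / 4) ≤ a.re) (n : ℕ) : ‖gCoef a n‖ ≤ (1 / 2) ^ n := by
  induction n with
  | zero => simp
  | succ n ih =>
    have hn := Nat.cast_nonneg (α := ℝ) n
    have h1 : ‖a + n + 1 / 2‖ ≤ ‖a + n + 1‖ := norm_le_norm_of_abs_re_le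
      (by simp; rw [abs_le, abs_of_pos] <;> [constructor; skip] <;> linarith) (by simp)
    rw [gCoef_succ, norm_mul, pow_succ (1 / 2 : ℝ)]
    gcongr
    simp only [norm_div, norm_mul, norm_pow]
    refine div_le_of_le_mul₀ (by positivity) (by norm_num) ?_
    calc _ ≤ ‖a + n + 1‖ ^ 3 := by gcongr
      _ ≤ _ := by norm_num; nlinarith [pow_nonneg (norm_nonneg (a + n + 1)) 3]

/-- Here the worst shift is 1/4, and −5/8 is the midpoint of −1/4 and −1. -/
lemma norm_fCoef_le {a : ℂ} (ha : -(5 / 8) ≤ a.re) (n : ℕ) : ‖fCoef a n‖ ≤ (1 / 2) ^ n := by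
  induction n with
  | zero => simp
  | succ n ih =>
    have hn := Nat.cast_nonneg (α := ℝ) n
    have h1 : ‖a + n + 1 / 2‖ ≤ ‖a + n + 1‖ := norm_le_norm_of_abs_re_le
      (by simp; rw [abs_le, abs_of_pos] <;> [constructor; skip] <;> linarith) (by simp)
    have h2 : ‖a + n + 1 / 4‖ ≤ ‖a + n + 1‖ := norm_le_norm_of_abs_re_le
      (by simp; rw [abs_le, abs_of_pos] <;> [constructor; skip] <;> linarith) (by simp)
    have h3 : ‖a + n + 3 / 4‖ ≤ ‖a + n + 1‖ := norm_le_norm_of_abs_re_le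
      (by simp; rw [abs_le, abs_of_pos] <;> [constructor; skip] <;> linarith) (by simp)
    rw [fCoef_succ, norm_mul, pow_succ (1 / 2 : ℝ)]
    gcongr
    simp only [norm_div, norm_mul, norm_pow]
    refine div_le_of_le_mul₀ (by positivity) (by norm_num) ?_
    calc _ ≤ ‖a + n + 1‖ ^ 3 * ‖a + n + 1‖ * ‖a + n + 1‖ := by gcongr
      _ ≤ _ := by norm_num; nlinarith [pow_nonneg (norm_nonneg (a + n + 1)) 5]

lemma norm_gTerm_le {a : ℂ} (ha : -(3 / 4) ≤ a.re) (n : ℕ) :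
    ‖gTerm a n‖ ≤ 47 * (‖a‖ + 1) * (((n : ℝ) + 1) ^ 1 * (1 / 2) ^ n) := by
  have h1 := norm_add_natCast_le a n
  have h2 := one_le_norm_mul a n
  set y := (‖a‖ + 1) * ((n : ℝ) + 1) with hy
  have h3 : ‖42 * (n + a) + 5‖ ≤ 47 * y := by
    calc _ ≤ ‖42 * (n + a)‖ + ‖(5 : ℂ)‖ := norm_add_le _ _
      _ = 42 * ‖a + n‖ + 5 := by simp [add_comm]
      _ ≤ 42 * y + 5 := by gcongr
      _ ≤ _ := by nlinarith
  rw [gTerm_eq, norm_mul]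
  calc _ ≤ (1 / 2) ^ n * (47 * y) := by gcongr; exact norm_gCoef_le ha n
    _ = _ := by rw [hy]; ring

lemma norm_fTerm_le {a : ℂ} (ha : -(5 / 8) ≤ a.re) (n : ℕ) :
    ‖fTerm a n‖ ≤ 157 * (‖a‖ + 1) ^ 2 * (((n : ℝ) + 1) ^ 2 * (1 / 2) ^ n) := by
  have h1 := norm_add_natCast_le a n
  have h2 := one_le_norm_mul a n
  set y := (‖a‖ + 1) * ((n : ℝ) + 1) with hy
  have h3 : ‖120 * (n + a) ^ 2 + 34 * (n + a) + 3‖ ≤ 157 * y ^ 2 := by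
    calc _ ≤ ‖120 * (n + a) ^ 2‖ + ‖34 * (n + a)‖ + ‖(3 : ℂ)‖ := norm_add₃_le
      _ = 120 * ‖a + n‖ ^ 2 + 34 * ‖a + n‖ + 3 := by simp [add_comm]
      _ ≤ 120 * y ^ 2 + 34 * y + 3 := by gcongr
      _ ≤ _ := by nlinarith
  rw [fTerm_eq, norm_mul]
  calc _ ≤ (1 / 2) ^ n * (157 * y ^ 2) := by gcongr; exact norm_fCoef_le ha n
    _ = _ := by rw [hy]; ring

lemma rise_add_one_ne_zero {a : ℂ} (ha : -1 < a.re) (n : ℕ) : rise (a + 1) n ≠ 0 :=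
  rise_ne_zero (fun j => add_natCast_ne_zero_of_re_pos (by simp; linarith) j) n

lemma isOpen_re_gt_inter_ball (c R : ℝ) : IsOpen ({a : ℂ | c < a.re} ∩ Metric.ball 0 R) :=
  (isOpen_lt continuous_const Complex.continuous_re).inter Metric.isOpen_ball

lemma differentiableAt_g {a : ℂ} (ha : -(3 / 4) < a.re) : DifferentiableAt ℂ g a := by
  -- The majorant grows with ‖a‖, so the half-plane is cut down by a ball.
  have hU := isOpen_re_gt_inter_ball (-(3 / 4)) (‖a‖ + 1)
  have h : DifferentiableOn ℂ g ({a : ℂ | -(3 / 4) < a.re} ∩ Metric.ball 0 (‖a‖ + 1)) := by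
    refine Complex.differentiableOn_tsum_of_summable_norm
      ((summable_pow_mul_half_pow 1).mul_left (47 * (‖a‖ + 1 + 1))) (fun n => ?_) hU
      fun n w hw => ?_
    · intro w hw
      have := rise_add_one_ne_zero (a := w) (by have := hw.1; simp at this; linarith) n
      have h1 := differentiable_rise n
      have h2 : DifferentiableAt ℂ (fun w => rise (w + 1) n) w := by fun_prop
      have h3 : DifferentiableAt ℂ (fun w => rise (w + 1 / 2) n) w := by fun_prop
      refine DifferentiableAt.differentiableWithinAt ?_
      unfold gTerm
      fun_prop (disch := simpa using this)
    · have h1 := hw.2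
      rw [mem_ball_zero_iff] at h1
      refine (norm_gTerm_le (le_of_lt hw.1) n).trans ?_
      gcongr
  exact h.differentiableAt (hU.mem_nhds ⟨ha, by simp⟩)

lemma differentiableAt_f {a : ℂ} (ha : -(5 / 8) < a.re) : DifferentiableAt ℂ f a := by
  have hU := isOpen_re_gt_inter_ball (-(5 / 8)) (‖a‖ + 1)
  have h : DifferentiableOn ℂ f ({a : ℂ | -(5 / 8) < a.re} ∩ Metric.ball 0 (‖a‖ + 1)) := by
    refine Complex.differentiableOn_tsum_of_summable_norm
      ((summable_pow_mul_half_pow 2).mul_left (157 * (‖a‖ + 1 + 1) ^ 2)) (fun n => ?_) hU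
      fun n w hw => ?_
    · intro w hw
      have := rise_add_one_ne_zero (a := w) (by have := hw.1; simp at this; linarith) n
      have h1 := differentiable_rise n
      have h2 : DifferentiableAt ℂ (fun w => rise (w + 1) n) w := by fun_prop
      have h3 : DifferentiableAt ℂ (fun w => rise (w + 1 / 2) n) w := by fun_prop
      have h4 : DifferentiableAt ℂ (fun w => rise (w + 1 / 4) n) w := by fun_prop
      have h5 : DifferentiableAt ℂ (fun w => rise (w + 3 / 4) n) w := by fun_prop
      refine DifferentiableAt.differentiableWithinAt ?_
      unfold fTerm
      fun_prop (disch := simpa using this)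
    · have h1 := hw.2
      rw [mem_ball_zero_iff] at h1
      refine (norm_fTerm_le (le_of_lt hw.1) n).trans ?_
      gcongr
  exact h.differentiableAt (hU.mem_nhds ⟨ha, by simp⟩)

lemma analyticAt_f : AnalyticAt ℂ f 0 := by
  have hU : IsOpen {a : ℂ | -(5 / 8) < a.re} := isOpen_lt continuous_const Complex.continuous_re
  exact DifferentiableOn.analyticAt (s := {a : ℂ | -(5 / 8) < a.re})
    (fun a ha => (differentiableAt_f ha).differentiableWithinAt) (hU.mem_nhds (by simp))

lemma norm_g_le : ∃ C : ℝ, 0 ≤ C ∧ ∀ a : ℂ, -(3 / 4) ≤ a.re → ‖g a‖ ≤ C * (‖a‖ + 1) := by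
  refine ⟨47 * ∑' n : ℕ, ((n : ℝ) + 1) ^ 1 * (1 / 2) ^ n, ?_, fun a ha => ?_⟩
  · exact mul_nonneg (by norm_num) (tsum_nonneg fun n => by positivity)
  · have h := tsum_of_norm_bounded
      ((summable_pow_mul_half_pow 1).mul_left (47 * (‖a‖ + 1))).hasSum (norm_gTerm_le ha)
    rw [tsum_mul_left] at h
    calc _ ≤ _ := h
      _ = _ := by ring

/-! ### The shift a ↦ a + 1 for g, and the additional series on a strip. -/

/-- The factor by which `D(a) = ((1/2)_a / (1)_a)³ / 64^a` changes under `a ↦ a + 1`. -/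
def dRatio (a : ℂ) : ℂ := (a + 1 / 2) ^ 3 / (64 * (a + 1) ^ 3)

lemma gTerm_succ (a : ℂ) (n : ℕ) : gTerm a (n + 1) = dRatio a * gTerm (a + 1) n := by
  simp only [gTerm, dRatio, rise_succ_left]
  rw [show a + 1 / 2 + 1 = a + 1 + 1 / 2 by ring]
  generalize rise (a + 1 + 1 / 2) n = r
  generalize rise (a + 1 + 1) n = s
  generalize a + 1 / 2 = p
  push_cast
  rw [show (42 : ℂ) * (n + 1 + a) + 5 = 42 * (n + (a + 1)) + 5 by ring]
  generalize (42 : ℂ) * (n + (a + 1)) + 5 = c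
  generalize a + 1 = q
  ring

lemma g_eq (a : ℂ) : g a = 42 * a + 5 + dRatio a * g (a + 1) := by
  rw [g, (summable_gTerm a).tsum_eq_zero_add, g, ← tsum_mul_left]
  simp only [gTerm_succ]
  simp [gTerm]

/-- The terms of the additional series after removal of its first term and of a common factor. -/
def wTail (a : ℂ) (n : ℕ) : ℂ :=
  rise (a + 3 / 2) n ^ 2 / (rise (2 * a + 2) n * rise (5 / 2 - a) n)

lemma wTail_succ (a : ℂ) (n : ℕ) : wTail a (n + 1) =
    wTail a n * ((a + 3 / 2 + n) ^ 2 / ((2 * a + 2 + n) * (5 / 2 - a + n))) := by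
  simp only [wTail, rise_succ]
  generalize a + 3 / 2 + n = p
  generalize 2 * a + 2 + n = q
  generalize 5 / 2 - a + n = r
  ring

/-- At a = −1/2 the numerator has a double zero and (2a+1)_{n+1} a simple one. Cancelling it
explicitly makes `wTail` regular across that point, where both sides here are 0. -/
lemma wTerm_succ (a : ℂ) (n : ℕ) :
    wTerm a (n + 1) = (a + 1 / 2) / (2 * (3 / 2 - a)) * wTail a n := by
  simp only [wTerm, wTail, rise_succ_left]
  rw [show a + 1 / 2 + 1 = a + 3 / 2 by ring, show 2 * a + 1 + 1 = 2 * a + 2 by ring,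
    show 3 / 2 - a + 1 = 5 / 2 - a by ring, show 2 * a + 1 = 2 * (a + 1 / 2) by ring]
  generalize a + 1 / 2 = p
  generalize 3 / 2 - a = q
  rcases eq_or_ne p 0 with rfl | hp
  · simp
  · field_simp

/-- A summable majorant of `wTail`. -/
def wMaj (n : ℕ) : ℝ := ∏ j ∈ Finset.range n, ((j : ℝ) + 1) / (j + 33 / 16)

lemma wMaj_pos (n : ℕ) : 0 < wMaj n := Finset.prod_pos fun j _ => by positivity

lemma wMaj_succ (n : ℕ) : wMaj (n + 1) / wMaj n = ((n : ℝ) + 1) / (n + 33 / 16) := by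
  rw [wMaj, Finset.prod_range_succ, ← wMaj, mul_div_cancel_left₀ _ (wMaj_pos n).ne']

/-- The decay is n^(−17/16). On Re a ≤ 3/8 the terms of `wTail` decay at worst like n^(−9/8), so
33/16 leaves a margin of 1/16 on either side. -/
lemma summable_wMaj : Summable wMaj := by
  have b1 : ∀ j : ℕ, (1 : ℂ) + j ≠ 0 := fun j => add_natCast_ne_zero_of_re_pos (by simp) j
  have b2 : ∀ j : ℕ, (33 / 16 : ℂ) + j ≠ 0 := fun j =>
    add_natCast_ne_zero_of_re_pos (by norm_num) j
  have h := rise_div_isBigO b1 b2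
  refine summable_of_isBigO_nat (Real.summable_nat_rpow.2 ?_) (h.norm_left.congr_left fun n => ?_)
  · norm_num
  · rw [rise_eq_prod, rise_eq_prod, ← Finset.prod_div_distrib, norm_prod]
    refine Finset.prod_congr rfl fun j _ => ?_
    have e : ((1 : ℂ) + j) / (33 / 16 + j) = ((((j : ℝ) + 1) / (j + 33 / 16) : ℝ) : ℂ) := by
      push_cast; rw [add_comm, add_comm (j : ℂ) (33 / 16)]
    rw [e, Complex.norm_real, Real.norm_of_nonneg (by positivity)]

/-- Uniformity in Im a: the squared modulus of the numerator contains (Im a)², while the real part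
of the denominator contains 2(Im a)². What remains is an inequality in Re a and n. -/
lemma wTail_ratio_le {a : ℂ} (h1 : -(3 / 4) ≤ a.re) (h2 : a.re ≤ 3 / 8) {n : ℕ} (hn : 20 ≤ n) :
    ‖(a + 3 / 2 + n) ^ 2 / ((2 * a + 2 + n) * (5 / 2 - a + n))‖ ≤
      ((n : ℝ) + 1) / (n + 33 / 16) := by
  have hn : (20 : ℝ) ≤ n := by exact_mod_cast hn
  have e1 : ‖a + 3 / 2 + n‖ ^ 2 = (a.re + 3 / 2 + n) ^ 2 + a.im ^ 2 := by
    rw [Complex.sq_norm, Complex.normSq_apply]; simp; ring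
  have e2 : (n + 2 * a.re + 2) * (n + 5 / 2 - a.re) + 2 * a.im ^ 2 ≤
      ‖(2 * a + 2 + n) * (5 / 2 - a + n)‖ := by
    refine le_trans (le_of_eq ?_) (Complex.re_le_norm _)
    simp
    ring
  have e3 : 0 < (n + 2 * a.re + 2) * (n + 5 / 2 - a.re) :=
    mul_pos (by linarith) (by linarith)
  rw [norm_div, norm_pow, e1, div_le_div_iff₀ (by nlinarith [sq_nonneg a.im]) (by linarith)]
  refine le_trans ?_ (mul_le_mul_of_nonneg_left e2 (by linarith))
  have e4 : (a.re + 3 / 2 + n) ^ 2 * (n + 33 / 16) ≤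
      (n + 1) * ((n + 2 * a.re + 2) * (n + 5 / 2 - a.re)) := by
    -- In terms of p, the product (n+1)(n + 2 Re a + 2) is p² − (Re a + 1/2)², and the quantity
    -- squared on the left is p.
    obtain ⟨p, hp⟩ : ∃ p, p = n + a.re + 3 / 2 := ⟨_, rfl⟩
    have h5 : (a.re + 1 / 2) ^ 2 ≤ 49 / 64 := by nlinarith
    have hp1 : 20 ≤ p := by linarith
    have h6 : (a.re + 1 / 2) ^ 2 * (1 - 2 * a.re) ≤ 49 / 64 * (5 / 2) := by
      apply mul_le_mul h5 (by linarith) (by linarith) (by norm_num)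
    have h7 : 0 ≤ (7 / 16 - a.re - 1 / 16) * p ^ 2 := mul_nonneg (by linarith) (sq_nonneg _)
    have h8 : (n : ℝ) = p - a.re - 3 / 2 := by linarith
    have h9 : (a.re + 1 / 2) ^ 2 * p ≤ 49 / 64 * p := by gcongr
    rw [h8, ← sub_nonneg]
    have : (p - a.re - 3 / 2 + 1) * ((p - a.re - 3 / 2 + 2 * a.re + 2) *
        (p - a.re - 3 / 2 + 5 / 2 - a.re)) -
        (a.re + 3 / 2 + (p - a.re - 3 / 2)) ^ 2 * (p - a.re - 3 / 2 + 33 / 16) =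
        (7 / 16 - a.re - 1 / 16) * p ^ 2 + p ^ 2 / 16 - (a.re + 1 / 2) ^ 2 * p -
          (a.re + 1 / 2) ^ 2 * (1 - 2 * a.re) := by ring
    rw [this]
    nlinarith
  nlinarith [sq_nonneg a.im]

lemma wTail_ratio_le' {a : ℂ} (h1 : -(3 / 4) ≤ a.re) (h2 : a.re ≤ 3 / 8) (n : ℕ) :
    ‖(a + 3 / 2 + n) ^ 2 / ((2 * a + 2 + n) * (5 / 2 - a + n))‖ ≤ 3 / 2 := by
  have hn := Nat.cast_nonneg (α := ℝ) n
  have e1 : ‖a + 3 / 2 + n‖ ≤ ‖5 / 2 - a + n‖ := norm_le_norm_of_abs_re_le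
    (by simp; rw [abs_of_pos, abs_of_pos] <;> linarith) (by simp)
  have e2 : ‖a + 3 / 2 + n‖ ≤ 3 / 2 * ‖2 * a + 2 + n‖ := by
    have : (3 / 2 : ℝ) = ‖(3 / 2 : ℂ)‖ := by norm_num
    rw [this, ← norm_mul]
    refine norm_le_norm_of_abs_re_le ?_ ?_
    · simp
      rw [abs_of_pos, abs_of_pos, abs_of_pos] <;> linarith
    · simp
      nlinarith [abs_nonneg a.im]
  rw [norm_div, norm_pow, norm_mul]
  refine div_le_of_le_mul₀ (by positivity) (by norm_num) ?_
  rw [sq]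
  calc _ ≤ (3 / 2 * ‖2 * a + 2 + n‖) * ‖5 / 2 - a + n‖ := by gcongr
    _ = _ := by ring

lemma wTail_bound : ∃ C : ℝ, 0 ≤ C ∧ ∀ a : ℂ, -(3 / 4) ≤ a.re → a.re ≤ 3 / 8 →
    ∀ n, ‖wTail a n‖ ≤ C * wMaj n := by
  obtain ⟨C, hC, h⟩ := exists_bound_of_ratio_le
    (ι := {a : ℂ // -(3 / 4) ≤ a.re ∧ a.re ≤ 3 / 8}) (T := fun n a => wTail a n) wMaj_pos
    (fun n => ⟨(3 / 2) ^ n, fun a => by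
      induction n with
      | zero => simp [wTail]
      | succ n ih =>
        rw [wTail_succ, norm_mul, pow_succ (3 / 2 : ℝ)]
        gcongr
        exact wTail_ratio_le' a.2.1 a.2.2 n⟩) 20
    (fun n hn a => by
      rw [wMaj_succ, wTail_succ, norm_mul, mul_comm]
      gcongr
      exact wTail_ratio_le a.2.1 a.2.2 hn)
  exact ⟨C, hC, fun a h1 h2 n => h n ⟨a, h1, h2⟩⟩

lemma summable_wTail {a : ℂ} (h1 : -(3 / 4) ≤ a.re) (h2 : a.re ≤ 3 / 8) : Summable (wTail a) := by
  obtain ⟨C, hC, h⟩ := wTail_bound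
  exact Summable.of_norm_bounded (summable_wMaj.mul_left C) (h a h1 h2)

lemma norm_tsum_wTail_le : ∃ C : ℝ, 0 ≤ C ∧ ∀ a : ℂ, -(3 / 4) ≤ a.re → a.re ≤ 3 / 8 →
    ‖∑' n, wTail a n‖ ≤ C := by
  obtain ⟨C, hC, h⟩ := wTail_bound
  refine ⟨C * ∑' n, wMaj n, mul_nonneg hC (tsum_nonneg fun n => (wMaj_pos n).le),
    fun a h1 h2 => ?_⟩
  rw [← tsum_mul_left]
  exact tsum_of_norm_bounded (summable_wMaj.mul_left C).hasSum (h a h1 h2)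

lemma isOpen_strip (c d : ℝ) : IsOpen {a : ℂ | c < a.re ∧ a.re < d} :=
  (isOpen_lt continuous_const Complex.continuous_re).inter
    (isOpen_lt Complex.continuous_re continuous_const)

lemma differentiableAt_tsum_wTail {a : ℂ} (h1 : -(3 / 4) < a.re) (h2 : a.re < 3 / 8) :
    DifferentiableAt ℂ (fun a => ∑' n, wTail a n) a := by
  obtain ⟨C, hC, h⟩ := wTail_bound
  have hU := isOpen_strip (-(3 / 4)) (3 / 8)
  have : DifferentiableOn ℂ (fun a => ∑' n, wTail a n) {a : ℂ | -(3 / 4) < a.re ∧ a.re < 3 / 8} := by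
    refine Complex.differentiableOn_tsum_of_summable_norm (summable_wMaj.mul_left C)
      (fun n => ?_) hU fun n w hw => h w hw.1.le hw.2.le n
    intro w hw
    have b1 := rise_ne_zero (x := 2 * w + 2) (fun j => add_natCast_ne_zero_of_re_pos
      (by have := hw.1; simp; linarith) j) n
    have b2 := rise_ne_zero (x := 5 / 2 - w) (fun j => add_natCast_ne_zero_of_re_pos
      (by have := hw.2; simp; linarith) j) n
    have h1 := differentiable_rise n
    have h2 : DifferentiableAt ℂ (fun w => rise (w + 3 / 2) n) w := by fun_prop
    have h3 : DifferentiableAt ℂ (fun w => rise (2 * w + 2) n) w := by fun_prop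
    have h4 : DifferentiableAt ℂ (fun w => rise (5 / 2 - w) n) w := by fun_prop
    refine DifferentiableAt.differentiableWithinAt ?_
    unfold wTail
    fun_prop (disch := simp [b1, b2])
  exact this.differentiableAt (hU.mem_nhds ⟨h1, h2⟩)

lemma tsum_wTerm {a : ℂ} (h1 : -(3 / 4) ≤ a.re) (h2 : a.re ≤ 3 / 8) :
    ∑' n, wTerm a n = 1 + (a + 1 / 2) / (2 * (3 / 2 - a)) * ∑' n, wTail a n := by
  have hs : Summable (wTerm a) := by
    rw [← summable_nat_add_iff 1]
    simp only [wTerm_succ]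
    exact (summable_wTail h1 h2).mul_left _
  rw [hs.tsum_eq_zero_add, ← tsum_mul_left]
  simp only [wTerm_succ]
  simp [wTerm]

/-- The difference of `g` and its additional series. -/
def gDiff (a : ℂ) : ℂ := g a - 128 * a ^ 2 / (2 * a - 1) * ∑' n, wTerm a n

lemma differentiableAt_tsum_wTerm {a : ℂ} (h1 : -(3 / 4) < a.re) (h2 : a.re < 3 / 8) :
    DifferentiableAt ℂ (fun a => ∑' n, wTerm a n) a := by
  have e : (fun a => ∑' n, wTerm a n) =ᶠ[𝓝 a]
      fun a => 1 + (a + 1 / 2) / (2 * (3 / 2 - a)) * ∑' n, wTail a n := by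
    filter_upwards [(isOpen_strip (-(3 / 4)) (3 / 8)).mem_nhds ⟨h1, h2⟩] with w hw
    exact tsum_wTerm hw.1.le hw.2.le
  refine DifferentiableAt.congr_of_eventuallyEq ?_ e
  have h3 := differentiableAt_tsum_wTail h1 h2
  have h4 : 3 / 2 - a ≠ 0 := by
    simpa using add_natCast_ne_zero_of_re_pos (x := 3 / 2 - a) (by simp; linarith) 0
  fun_prop (disch := simpa using h4)

lemma two_mul_sub_one_ne_zero {a : ℂ} (h : a.re < 1 / 2) : 2 * a - 1 ≠ 0 := by
  intro h0
  have := congrArg Complex.re h0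
  simp at this
  linarith

lemma differentiableAt_gDiff {a : ℂ} (h1 : -(3 / 4) < a.re) (h2 : a.re < 3 / 8) :
    DifferentiableAt ℂ gDiff a := by
  have h3 := differentiableAt_tsum_wTerm h1 h2
  have h4 := differentiableAt_g h1
  have h5 := two_mul_sub_one_ne_zero (a := a) (by linarith)
  unfold gDiff
  fun_prop (disch := simpa using h5)

/-- Since Re a ≤ 3/8 keeps 2a − 1 away from 0, a²/(2a−1) grows only linearly; the periodicity
argument tolerates linear growth. -/
lemma norm_gDiff_le : ∃ C : ℝ, 0 ≤ C ∧ ∀ a : ℂ, -(3 / 4) ≤ a.re → a.re ≤ 3 / 8 →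
    ‖gDiff a‖ ≤ C * (‖a‖ + 1) := by
  obtain ⟨C1, hC1, h1⟩ := norm_g_le
  obtain ⟨C2, hC2, h2⟩ := norm_tsum_wTail_le
  refine ⟨C1 + 512 * (1 + C2), by positivity, fun a ha hb => ?_⟩
  have e1 : ‖a‖ ≤ 4 * ‖2 * a - 1‖ := by
    have h3 : ‖2 * a - 1‖ ≥ 1 / 4 := by
      have := Complex.abs_re_le_norm (2 * a - 1)
      have h4 : |(2 * a - 1).re| = 1 - 2 * a.re := by
        simp; rw [abs_of_neg] <;> linarith
      rw [h4] at this
      linarith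
    have h5 := norm_sub_norm_le (2 * a) 1
    rw [norm_mul, Complex.norm_two, norm_one] at h5
    have := norm_nonneg a
    nlinarith
  have e2 : ‖a + 1 / 2‖ ≤ ‖3 / 2 - a‖ := norm_le_norm_of_abs_re_le
    (by
      simp
      rw [abs_of_pos (show 0 < 3 / 2 - a.re by linarith), abs_le]
      constructor <;> linarith) (by simp)
  have e3 : ‖∑' n, wTerm a n‖ ≤ 1 + C2 := by
    rw [tsum_wTerm ha hb]
    refine (norm_add_le _ _).trans ?_
    rw [norm_one, norm_mul]
    gcongr
    have h3 : ‖(a + 1 / 2) / (2 * (3 / 2 - a))‖ ≤ 1 := by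
      rw [norm_div, norm_mul, Complex.norm_two]
      refine div_le_of_le_mul₀ (by positivity) zero_le_one ?_
      linarith [norm_nonneg (3 / 2 - a)]
    calc _ ≤ 1 * C2 := mul_le_mul h3 (h2 a ha hb) (norm_nonneg _) zero_le_one
      _ = C2 := one_mul _
  have e4 : ‖128 * a ^ 2 / (2 * a - 1)‖ ≤ 512 * (‖a‖ + 1) := by
    rw [norm_div, norm_mul, norm_pow]
    refine div_le_of_le_mul₀ (norm_nonneg _) (by positivity) ?_
    norm_num
    have := norm_nonneg a
    nlinarith [mul_le_mul_of_nonneg_left e1 this, norm_nonneg (2 * a - 1)]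
  calc _ ≤ ‖g a‖ + ‖128 * a ^ 2 / (2 * a - 1) * ∑' n, wTerm a n‖ := norm_sub_le _ _
    _ ≤ C1 * (‖a‖ + 1) + 512 * (‖a‖ + 1) * (1 + C2) := by
      rw [norm_mul]
      gcongr
      exact h1 a ha
    _ = _ := by ring

/-! ### Sine and cosine off the real axis; periodic entire functions. -/

/-- The difference of moduli is 2 sinh(Im z), and |sinh y| ≥ |y|. -/
lemma abs_im_le_norm_exp_sub (z : ℂ) :
    2 * |z.im| ≤ |‖Complex.exp (-z * Complex.I)‖ - ‖Complex.exp (z * Complex.I)‖| := by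
  have h1 : ‖Complex.exp (-z * Complex.I)‖ = Real.exp z.im := by rw [Complex.norm_exp]; simp
  have h2 : ‖Complex.exp (z * Complex.I)‖ = Real.exp (-z.im) := by rw [Complex.norm_exp]; simp
  rw [h1, h2]
  have h3 : Real.exp z.im - Real.exp (-z.im) = 2 * Real.sinh z.im := by
    rw [Real.sinh_eq]; ring
  rw [h3, abs_mul, abs_two]
  refine mul_le_mul_of_nonneg_left ?_ zero_le_two
  rcases le_total 0 z.im with h | h
  · rw [abs_of_nonneg h, abs_of_nonneg (Real.sinh_nonneg_iff.2 h)]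
    exact Real.self_le_sinh_iff.2 h
  · rw [abs_of_nonpos h, abs_of_nonpos (Real.sinh_nonpos_iff.2 h)]
    exact neg_le_neg (Real.sinh_le_self_iff.2 h)

lemma abs_im_le_norm_sin (z : ℂ) : |z.im| ≤ ‖Complex.sin z‖ := by
  have h := (abs_im_le_norm_exp_sub z).trans (abs_norm_sub_norm_le _ _)
  have : ‖Complex.sin z‖ = ‖Complex.exp (-z * Complex.I) - Complex.exp (z * Complex.I)‖ / 2 := by
    rw [Complex.sin]; simp
  linarith

lemma abs_im_le_norm_cos (z : ℂ) : |z.im| ≤ ‖Complex.cos z‖ := by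
  have h0 := abs_norm_sub_norm_le (Complex.exp (-z * Complex.I)) (-Complex.exp (z * Complex.I))
  rw [norm_neg] at h0
  have h := (abs_im_le_norm_exp_sub z).trans h0
  have h2 : ‖Complex.cos z‖ =
      ‖Complex.exp (-z * Complex.I) - -Complex.exp (z * Complex.I)‖ / 2 := by
    rw [Complex.cos, sub_neg_eq_add, add_comm]; simp
  linarith

lemma norm_sin_le_two_mul_norm_cos {z : ℂ} (h : 1 ≤ |z.im|) :
    ‖Complex.sin z‖ ≤ 2 * ‖Complex.cos z‖ := by
  have h1 := h.trans (abs_im_le_norm_cos z)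
  have h2 : Complex.sin z ^ 2 = 1 - Complex.cos z ^ 2 := by
    rw [← Complex.sin_sq_add_cos_sq z]; ring
  have h3 : ‖Complex.sin z‖ ^ 2 ≤ 1 + ‖Complex.cos z‖ ^ 2 := by
    rw [← norm_pow, h2, ← norm_pow]
    exact (norm_sub_le _ _).trans (by simp)
  nlinarith [norm_nonneg (Complex.sin z)]

lemma norm_cos_le_two_mul_norm_sin {z : ℂ} (h : 1 ≤ |z.im|) :
    ‖Complex.cos z‖ ≤ 2 * ‖Complex.sin z‖ := by
  have h1 := h.trans (abs_im_le_norm_sin z)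
  have h2 : Complex.cos z ^ 2 = 1 - Complex.sin z ^ 2 := by
    rw [← Complex.sin_sq_add_cos_sq z]; ring
  have h3 : ‖Complex.cos z‖ ^ 2 ≤ 1 + ‖Complex.sin z‖ ^ 2 := by
    rw [← norm_pow, h2, ← norm_pow]
    exact (norm_sub_le _ _).trans (by simp)
  nlinarith [norm_nonneg (Complex.cos z)]

lemma abs_im_pi_mul {z : ℂ} (h : 1 ≤ |z.im|) : 1 ≤ |((Real.pi : ℂ) * z).im| := by
  rw [Complex.im_ofReal_mul, abs_mul, abs_of_pos Real.pi_pos]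
  nlinarith [Real.pi_gt_three]

/-- An entire `1`-periodic function of at most linear growth is constant. -/
lemma eq_of_periodic_of_linear_growth {K : ℂ → ℂ} (hK : Differentiable ℂ K)
    (hp : ∀ z, K (z + 1) = K z) {C : ℝ} (hC : ∀ z, ‖K z‖ ≤ C * (1 + ‖z‖)) (z : ℂ) :
    K z = K 0 := by
  -- The difference quotient at 0 is entire and, by linear growth, bounded. Liouville makes K
  -- affine, and periodicity kills the slope.
  have hM : Differentiable ℂ (dslope K 0) := by
    rw [← differentiableOn_univ, Complex.differentiableOn_dslope univ_mem]
    exact hK.differentiableOn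
  have hC0 : 0 ≤ C := by
    have := (norm_nonneg _).trans (hC 0)
    simpa using this
  have hb : Bornology.IsBounded (Set.range (dslope K 0)) := by
    obtain ⟨M, hM1⟩ := (isCompact_closedBall (0 : ℂ) 1).exists_bound_of_continuousOn
      hM.continuous.continuousOn
    refine isBounded_iff_forall_norm_le.2 ⟨max M (2 * C + ‖K 0‖), ?_⟩
    rintro _ ⟨z, rfl⟩
    rcases le_total ‖z‖ 1 with h | h
    · exact (hM1 z (by simpa using h)).trans (le_max_left _ _)
    · refine le_trans ?_ (le_max_right _ _)
      have hz : z ≠ 0 := by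
        rintro rfl
        simp at h
        linarith
      rw [dslope_of_ne _ hz, slope_def_field, sub_zero, norm_div]
      refine div_le_of_le_mul₀ (norm_nonneg _) (by positivity) ?_
      calc _ ≤ ‖K z‖ + ‖K 0‖ := norm_sub_le _ _
        _ ≤ C * (1 + ‖z‖) + ‖K 0‖ := by gcongr; exact hC z
        _ ≤ _ := by nlinarith [norm_nonneg (K 0)]
  have h1 : ∀ w, K w = K 0 + w * dslope K 0 0 := fun w => by
    have h2 := hM.apply_eq_apply_of_bounded hb w 0
    have h3 := sub_smul_dslope K 0 w
    rw [h2, sub_zero, smul_eq_mul] at h3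
    rw [h3]
    ring
  have h2 := hp 0
  rw [zero_add, h1 1] at h2
  rw [h1 z]
  have : dslope K 0 0 = 0 := by linear_combination h2
  rw [this]
  ring

lemma sin_two_pi_eq_zero {z : ℂ} (h : Complex.sin (2 * Real.pi * z) = 0) :
    ∃ n : ℤ, z = n ∨ z = n + 1 / 2 := by
  obtain ⟨m, hm⟩ := Complex.sin_eq_zero_iff.1 h
  have hpi : (Real.pi : ℂ) ≠ 0 := by exact_mod_cast Real.pi_ne_zero
  have hz : z = m / 2 := by
    apply mul_left_cancel₀ (mul_ne_zero two_ne_zero hpi)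
    rw [hm]
    ring
  rcases Int.even_or_odd' m with ⟨n, rfl | rfl⟩
  · exact ⟨n, Or.inl (by rw [hz]; push_cast; ring)⟩
  · exact ⟨n, Or.inr (by rw [hz]; push_cast; ring)⟩

lemma periodic_int {F : ℂ → ℂ} (hp : ∀ z, F (z + 1) = F z) (z : ℂ) (n : ℤ) : F (z + n) = F z := by
  have : Function.Periodic F 1 := hp
  simpa using this.int_mul n z

/-- The quotient of two entire functions with simple zeros of the denominator filled in. -/
lemma differentiable_div_of_simple_zeros {N S : ℂ → ℂ} (hN : Differentiable ℂ N)
    (hS : Differentiable ℂ S) (h0 : ∀ z, S z = 0 → N z = 0) (h1 : ∀ z, S z = 0 → deriv S z ≠ 0) :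
    Differentiable ℂ fun z => if S z = 0 then deriv N z / deriv S z else N z / S z := by
  intro z
  by_cases hz : S z = 0
  · have e : (fun w => if S w = 0 then deriv N w / deriv S w else N w / S w) =ᶠ[𝓝 z]
        fun w => dslope N z w / dslope S z w := by
      have h2 := ((hS z).hasDerivAt.eventually_ne (c := 0) (h1 z hz))
      rw [eventually_nhdsWithin_iff] at h2
      filter_upwards [h2] with w hw
      rcases eq_or_ne w z with rfl | hwz
      · simp [hz]
      · have h3 := hw hwz
        rw [if_neg h3, dslope_of_ne _ hwz, dslope_of_ne _ hwz, slope_def_field, slope_def_field,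
          hz, h0 z hz, sub_zero, sub_zero, div_div_div_cancel_right₀ (sub_ne_zero.2 hwz)]
    refine DifferentiableAt.congr_of_eventuallyEq ?_ e
    have hd : ∀ F : ℂ → ℂ, Differentiable ℂ F → DifferentiableAt ℂ (dslope F z) z := by
      intro F hF
      have : Differentiable ℂ (dslope F z) := by
        rw [← differentiableOn_univ, Complex.differentiableOn_dslope univ_mem]
        exact hF.differentiableOn
      exact this z
    exact (hd N hN).div (hd S hS) (by rw [dslope_same]; exact h1 z hz)
  · have e : (fun w => if S w = 0 then deriv N w / deriv S w else N w / S w) =ᶠ[𝓝 z]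
        fun w => N w / S w := by
      filter_upwards [hS.continuous.continuousAt.eventually_ne hz] with w hw
      rw [if_neg hw]
    exact DifferentiableAt.congr_of_eventuallyEq ((hN z).div (hS z) hz) e

/-- An entire `1`-periodic function which grows at most like `|Im z| cos² πz` is a trigonometric
polynomial of degree one in `2πz`. -/
lemma eq_trig_of_periodic {H : ℂ → ℂ} (hH : Differentiable ℂ H) (hp : ∀ z, H (z + 1) = H z)
    {C : ℝ} (hC : 0 ≤ C)
    (hb : ∀ z : ℂ, 1 ≤ |z.im| → ‖H z‖ ≤ C * (1 + |z.im|) * ‖Complex.cos (Real.pi * z)‖ ^ 2) :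
    ∃ A B κ : ℂ, ∀ z, H z = A + B * Complex.sin (Real.pi * z) ^ 2 +
      κ * Complex.sin (2 * Real.pi * z) := by
  have hpi : (Real.pi : ℂ) ≠ 0 := by exact_mod_cast Real.pi_ne_zero
  -- This B makes N vanish at integers and half-integers alike, that is, at all zeros of sin 2πz.
  set B := H (1 / 2) - H 0 with hB
  set N : ℂ → ℂ := fun z => H z - H 0 - B * Complex.sin (Real.pi * z) ^ 2 with hN
  set S : ℂ → ℂ := fun z => Complex.sin (2 * Real.pi * z) with hS
  have dN : Differentiable ℂ N := by
    have : Differentiable ℂ fun z : ℂ => Complex.sin (Real.pi * z) :=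
      Complex.differentiable_sin.comp (differentiable_id.const_mul _)
    fun_prop
  have dS : Differentiable ℂ S := Complex.differentiable_sin.comp (differentiable_id.const_mul _)
  have dS' : ∀ z, deriv S z = Complex.cos (2 * Real.pi * z) * (2 * Real.pi) := by
    intro z
    have h1 : HasDerivAt (fun z : ℂ => 2 * (Real.pi : ℂ) * z) (2 * Real.pi) z := by
      simpa using (hasDerivAt_id z).const_mul (2 * (Real.pi : ℂ))
    exact h1.csin.deriv
  have pN : ∀ z, N (z + 1) = N z := by
    intro z
    simp only [hN]
    rw [hp, mul_add, mul_one, Complex.sin_add_pi]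
    ring
  have pS : ∀ z, S (z + 1) = S z := by
    intro z
    simp only [hS]
    rw [mul_add, mul_one, Complex.sin_add_two_pi]
  have h0 : ∀ z, S z = 0 → N z = 0 := by
    intro z hz
    obtain ⟨n, hn | hn⟩ := sin_two_pi_eq_zero hz
    · have := periodic_int pN 0 n
      rw [zero_add] at this
      rw [hn, this]
      simp [hN]
    · have := periodic_int pN (1 / 2) n
      rw [add_comm] at this
      rw [hn, this]
      simp only [hN]
      rw [show (Real.pi : ℂ) * (1 / 2) = Real.pi / 2 by ring, Complex.sin_pi_div_two, hB]
      ring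
  have h1 : ∀ z, S z = 0 → deriv S z ≠ 0 := by
    intro z hz
    rw [dS']
    refine mul_ne_zero ?_ (mul_ne_zero two_ne_zero hpi)
    intro hc
    have := Complex.sin_sq_add_cos_sq (2 * Real.pi * z)
    rw [hc, show Complex.sin (2 * Real.pi * z) = 0 from hz] at this
    simp at this
  set K : ℂ → ℂ := fun z => if S z = 0 then deriv N z / deriv S z else N z / S z with hK
  have dK : Differentiable ℂ K := differentiable_div_of_simple_zeros dN dS h0 h1
  have pK : ∀ z, K (z + 1) = K z := by
    intro z
    have e1 : deriv N (z + 1) = deriv N z := by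
      rw [← deriv_comp_add_const]; congr 1; funext w; exact pN w
    have e2 : deriv S (z + 1) = deriv S z := by
      rw [← deriv_comp_add_const]; congr 1; funext w; exact pS w
    simp only [hK]
    rw [e1, e2, pN, pS]
  have hNK : ∀ z, N z = K z * S z := by
    intro z
    by_cases hz : S z = 0
    · rw [h0 z hz, hz, mul_zero]
    · simp only [hK]
      rw [if_neg hz, div_mul_cancel₀ _ hz]
  -- For |Im z| ≥ 1, |sin 2πz| dominates 1, |sin πz|² and |cos πz|², so division by it leaves linear
  -- growth in Im z.
  have bK1 : ∀ z : ℂ, 1 ≤ |z.im| → ‖K z‖ ≤ C * (1 + |z.im|) + ‖H 0‖ + ‖B‖ := by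
    intro z hz
    have hz' := abs_im_pi_mul hz
    have s1 := hz'.trans (abs_im_le_norm_sin _)
    have c1 := hz'.trans (abs_im_le_norm_cos _)
    have sc := norm_sin_le_two_mul_norm_cos hz'
    have cs := norm_cos_le_two_mul_norm_sin hz'
    have eS : S z = 2 * Complex.sin (Real.pi * z) * Complex.cos (Real.pi * z) := by
      simp only [hS]
      rw [mul_assoc, Complex.sin_two_mul]
    have nS : ‖S z‖ = 2 * ‖Complex.sin (Real.pi * z)‖ * ‖Complex.cos (Real.pi * z)‖ := by
      rw [eS, norm_mul, norm_mul, Complex.norm_two]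
    have nN : ‖N z‖ ≤ C * (1 + |z.im|) * ‖Complex.cos (Real.pi * z)‖ ^ 2 + ‖H 0‖ +
        ‖B‖ * ‖Complex.sin (Real.pi * z)‖ ^ 2 := by
      calc _ ≤ ‖H z‖ + ‖H 0‖ + ‖B * Complex.sin (Real.pi * z) ^ 2‖ :=
            (norm_sub_le _ _).trans (add_le_add_left (norm_sub_le _ _) _)
        _ ≤ _ := by rw [norm_mul, norm_pow]; gcongr; exact hb z hz
    have eK := hNK z
    generalize ‖Complex.sin (Real.pi * z)‖ = s at *
    generalize ‖Complex.cos (Real.pi * z)‖ = c at *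
    have hpos : 0 < 2 * s * c := by positivity
    have : ‖K z‖ * (2 * s * c) = ‖N z‖ := by rw [eK, norm_mul, nS]
    rw [← mul_le_mul_iff_of_pos_right hpos, this]
    refine nN.trans ?_
    have hsc : c ^ 2 ≤ 2 * s * c := by nlinarith
    have hcs : s ^ 2 ≤ 2 * s * c := by nlinarith
    have h1' : 1 ≤ 2 * s * c := by nlinarith
    calc _ ≤ C * (1 + |z.im|) * (2 * s * c) + ‖H 0‖ * (2 * s * c) + ‖B‖ * (2 * s * c) := by
          gcongr
          exact le_mul_of_one_le_right (norm_nonneg _) h1'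
      _ = _ := by ring
  -- For |Im z| ≤ 1, periodicity reduces the bound to a compact rectangle.
  obtain ⟨M, hM⟩ := ((isCompact_Icc (a := (0 : ℝ)) (b := 1)).reProdIm
    (isCompact_Icc (a := (-1 : ℝ)) (b := 1))).exists_bound_of_continuousOn
    dK.continuous.continuousOn
  have bK : ∀ z, ‖K z‖ ≤ (C + ‖H 0‖ + ‖B‖ + |M|) * (1 + ‖z‖) := by
    intro z
    have hz0 := norm_nonneg z
    rcases le_total 1 |z.im| with h | h
    · have := Complex.abs_im_le_norm z
      calc _ ≤ _ := bK1 z h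
        _ ≤ C * (1 + ‖z‖) + ‖H 0‖ * (1 + ‖z‖) + ‖B‖ * (1 + ‖z‖) := by
          gcongr
          · exact le_mul_of_one_le_right (norm_nonneg _) (by linarith)
          · exact le_mul_of_one_le_right (norm_nonneg _) (by linarith)
        _ ≤ _ := by nlinarith [abs_nonneg M, mul_nonneg (abs_nonneg M) hz0]
    · have e := periodic_int pK z (-⌊z.re⌋)
      have h2 := hM (z + (-⌊z.re⌋ : ℤ)) (by
        rw [Complex.mem_reProdIm]
        constructor
        · rw [Complex.add_re, Complex.intCast_re, Set.mem_Icc, Int.cast_neg]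
          constructor <;> linarith [Int.floor_le z.re, Int.lt_floor_add_one z.re]
        · simpa [Set.mem_Icc, abs_le] using h)
      rw [e] at h2
      have h3 := le_abs_self M
      have h4 : 0 ≤ C + ‖H 0‖ + ‖B‖ := by positivity
      nlinarith [abs_nonneg M, mul_nonneg (abs_nonneg M) hz0, mul_nonneg h4 hz0]
  refine ⟨H 0, B, K 0, fun z => ?_⟩
  have h2 := hNK z
  rw [eq_of_periodic_of_linear_growth dK pK bK z] at h2
  simp only [hN, hS] at h2
  linear_combination h2

/-- A function which is holomorphic on a strip a little wider than one and agrees with its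
translate on the overlap extends to an entire periodic function. -/
lemma exists_periodic_extension {h : ℂ → ℂ}
    (hd : ∀ a : ℂ, -(3 / 4) < a.re → a.re < 3 / 8 → DifferentiableAt ℂ h a)
    (hp : ∀ a : ℂ, -(3 / 4) < a.re → a.re < -(5 / 8) → h (a + 1) = h a) :
    ∃ H : ℂ → ℂ, Differentiable ℂ H ∧ (∀ z, H (z + 1) = H z) ∧
      ∀ a : ℂ, -(3 / 4) < a.re → a.re < 3 / 8 → H a = h a := by
  -- The floor moves Re z into [−11/16, 5/16), which keeps a margin of 1/16 inside the strip on both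
  -- sides.
  set H : ℂ → ℂ := fun z => h (z - (⌊z.re + 11 / 16⌋ : ℤ)) with hH
  have key : ∀ (z : ℂ) (m : ℤ), -(3 / 4) < z.re - m → z.re - m < 3 / 8 → H z = h (z - m) := by
    intro z m h1 h2
    have f1 := Int.floor_le (z.re + 11 / 16)
    have f2 := Int.lt_floor_add_one (z.re + 11 / 16)
    simp only [hH]
    generalize ⌊z.re + 11 / 16⌋ = n at *
    have l1 : n < m + 2 := by
      have : (n : ℝ) < m + 2 := by linarith
      exact_mod_cast this
    have l2 : m < n + 2 := by
      have : (m : ℝ) < n + 2 := by linarith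
      exact_mod_cast this
    have : n = m ∨ n = m + 1 ∨ m = n + 1 := by omega
    rcases this with rfl | rfl | rfl
    · rfl
    · push_cast at *
      rw [← hp (z - (m + 1)) (by simp; linarith) (by simp; linarith)]
      congr 1
      ring
    · push_cast at *
      rw [← hp (z - (n + 1)) (by simp; linarith) (by simp; linarith)]
      congr 1
      ring
  refine ⟨H, fun z => ?_, fun z => ?_, fun a h1 h2 => ?_⟩
  · have f1 := Int.floor_le (z.re + 11 / 16)
    have f2 := Int.lt_floor_add_one (z.re + 11 / 16)
    set m := ⌊z.re + 11 / 16⌋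
    have e : H =ᶠ[𝓝 z] fun w => h (w - m) := by
      have : Continuous fun w : ℂ => w.re - (m : ℝ) := Complex.continuous_re.sub continuous_const
      have o : IsOpen {w : ℂ | -(3 / 4) < w.re - m ∧ w.re - m < 3 / 8} :=
        (isOpen_lt continuous_const this).inter (isOpen_lt this continuous_const)
      filter_upwards [o.mem_nhds (x := z) ⟨by linarith, by linarith⟩] with w hw
      exact key w m hw.1 hw.2
    refine DifferentiableAt.congr_of_eventuallyEq ?_ e
    have h1 := hd (z - m) (by simp; linarith) (by simp; linarith)
    exact h1.comp z (differentiableAt_id.sub_const _)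
  · simp only [hH]
    rw [Complex.add_re, Complex.one_re, show z.re + 1 + 11 / 16 = z.re + 11 / 16 + 1 by ring,
      Int.floor_add_one]
    push_cast
    congr 1
    ring
  · simpa using key a 0 (by simpa using h1) (by simpa using h2)

/-! ### The functional equation of `gDiff`. -/

/-- The common factor of the WZ pair relating the additional series at `a` and `a + 1`. -/
def wFactor (a : ℂ) (k : ℕ) : ℂ :=
  rise (a + 1 / 2) k ^ 2 / (rise (2 * a + 1) k * rise (1 / 2 - a) k)

/-- Second member of the WZ pair relating the additional series at `a` and `a + 1`. -/
def wG (a : ℂ) (k : ℕ) : ℂ :=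
  wFactor a k * ((4 * k ^ 2 + (56 * a + 12) * k + (42 * a + 5) * (2 * a + 1)) / (2 * a + 1 + k))

section

variable {a : ℂ} (h0 : ∀ j : ℕ, a + 1 / 2 + j ≠ 0) (h1 : ∀ j : ℕ, 2 * a + 1 + j ≠ 0)
  (h2 : ∀ j : ℕ, 1 / 2 - a + j ≠ 0)

include h2 in
lemma wTerm_eq_wFactor (k : ℕ) : 128 * a ^ 2 / (2 * a - 1) * wTerm a k =
    wFactor a k * (-64 * a ^ 2 / (1 / 2 - a + k)) := by
  have n0 : 1 / 2 - a ≠ 0 := by simpa using h2 0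
  have nk := h2 k
  have nr := rise_ne_zero h2 k
  have e := rise_add_one n0 k
  rw [show 1 / 2 - a + 1 = 3 / 2 - a by ring] at e
  rw [wTerm, wFactor, e, show 2 * a - 1 = -2 * (1 / 2 - a) by ring]
  generalize 1 / 2 - a + k = p at *
  generalize 1 / 2 - a = q at *
  field_simp
  ring

include h0 h1 in
lemma wTerm_add_one_eq_wFactor (k : ℕ) :
    dRatio a * (128 * (a + 1) ^ 2 / (2 * (a + 1) - 1)) * wTerm (a + 1) k =
    wFactor a k * (4 * (a + 1 / 2) * (a + 1 / 2 + k) ^ 2 /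
      ((2 * a + 1 + k) * (2 * a + 2 + k))) := by
  have n0 : a + 1 / 2 ≠ 0 := by simpa using h0 0
  have n1 : 2 * a + 1 ≠ 0 := by simpa using h1 0
  have n2 : 2 * a + 1 + 1 ≠ 0 := by simpa using h1 1
  have n3 : a + 1 ≠ 0 := fun h => n2 (by linear_combination 2 * h)
  have n4 := h1 k
  have n5 : 2 * a + 2 + k ≠ 0 := fun h => h1 (k + 1) (by push_cast; linear_combination h)
  have r1 := rise_ne_zero h1 k
  have e1 := rise_add_one n0 k
  have e2 := rise_add_two n1 n2 k
  rw [wTerm, wFactor, dRatio, show a + 1 + 1 / 2 = a + 1 / 2 + 1 by ring,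
    show 2 * (a + 1) + 1 = 2 * a + 1 + 2 by ring, show 3 / 2 - (a + 1) = 1 / 2 - a by ring, e1, e2,
    show 2 * a + 1 + 1 + k = 2 * a + 2 + k by ring, show 2 * a + 1 + 1 = 2 * (a + 1) by ring,
    show 2 * (a + 1) - 1 = 2 * a + 1 by ring]
  generalize 2 * a + 2 + k = p at *
  generalize 2 * a + 1 + k = q at *
  generalize a + 1 / 2 + k = u at *
  generalize a + 1 / 2 = v at *
  generalize a + 1 = w at *
  generalize 2 * a + 1 = z at *
  field_simp
  ring

include h1 h2 in
-- The certificate for the shift: cleared of denominators it is the polynomial identity `key` in a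
-- and k.
lemma wG_sub (k : ℕ) : wFactor a k * (4 * (a + 1 / 2) * (a + 1 / 2 + k) ^ 2 /
      ((2 * a + 1 + k) * (2 * a + 2 + k))) - wFactor a k * (-64 * a ^ 2 / (1 / 2 - a + k)) =
    wG a (k + 1) - wG a k := by
  have n4 := h1 k
  have n5 : 2 * a + 2 + k ≠ 0 := fun h => h1 (k + 1) (by push_cast; linear_combination h)
  have n6 := h2 k
  have e : wFactor a (k + 1) = wFactor a k * ((a + 1 / 2 + k) ^ 2 /
      ((2 * a + 1 + k) * (1 / 2 - a + k))) := by
    simp only [wFactor, rise_succ]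
    generalize a + 1 / 2 + k = p
    generalize 2 * a + 1 + k = q
    generalize 1 / 2 - a + k = r
    ring
  simp only [wG, e]
  push_cast
  rw [show 2 * a + 1 + ((k : ℂ) + 1) = 2 * a + 2 + k by ring]
  clear e
  generalize wFactor a k = t
  generalize (k : ℂ) = k at *
  have key : 4 * (a + 1 / 2) * (a + 1 / 2 + k) ^ 2 * (1 / 2 - a + k) +
      64 * a ^ 2 * ((2 * a + 1 + k) * (2 * a + 2 + k)) -
      (a + 1 / 2 + k) ^ 2 * (4 * (k + 1) ^ 2 + (56 * a + 12) * (k + 1) +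
        (42 * a + 5) * (2 * a + 1)) + (4 * k ^ 2 + (56 * a + 12) * k +
        (42 * a + 5) * (2 * a + 1)) * ((2 * a + 2 + k) * (1 / 2 - a + k)) = 0 := by ring
  generalize 4 * k ^ 2 + (56 * a + 12) * k + (42 * a + 5) * (2 * a + 1) = P at *
  generalize 4 * (k + 1) ^ 2 + (56 * a + 12) * (k + 1) + (42 * a + 5) * (2 * a + 1) = Q at *
  generalize 2 * a + 2 + k = p at *
  generalize 2 * a + 1 + k = q at *
  generalize 1 / 2 - a + k = r at *
  generalize a + 1 / 2 + k = u at *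
  generalize a + 1 / 2 = v at *
  rw [← sub_eq_zero, ← mul_zero (t / (p * q * r)), ← key]
  field_simp
  ring

include h0 h1 h2 in
-- `wFactor a k * (k + 1)` is O(k^(Re a + 1/2)), and the rational factor divided by k + 1 is bounded
-- for large k.
lemma tendsto_wG (ha : a.re < -(1 / 2)) : Tendsto (wG a) atTop (𝓝 0) := by
  have o1 := isBigO_natCast_rpow_mul (rise_div_isBigO h0 h1) (rise_div_isBigO h0 h2)
  have b1 : ∀ j : ℕ, (1 : ℂ) + j ≠ 0 := fun j => add_natCast_ne_zero_of_re_pos (by simp) j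
  have b2 : ∀ j : ℕ, (2 : ℂ) + j ≠ 0 := fun j => add_natCast_ne_zero_of_re_pos (by simp) j
  have o2 := isBigO_natCast_rpow_mul o1 (rise_div_isBigO b2 b1)
  have o3 : Tendsto (fun k : ℕ => wFactor a k * (k + 1)) atTop (𝓝 0) := by
    have o4 : (fun k : ℕ => wFactor a k * (k + 1)) =O[atTop]
        fun k : ℕ => (k : ℝ) ^ (-(-(a.re + 1 / 2))) := by
      refine (o2.congr_left fun k => ?_).congr_right fun k => ?_
      · have e : rise 2 k / rise 1 k = k + 1 := by
          have := rise_add_one (x := 1) one_ne_zero k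
          rw [show (1 : ℂ) + 1 = 2 by norm_num] at this
          have h1 := rise_ne_zero b1 k
          rw [this]
          field_simp
          ring
        rw [e, wFactor]
        ring
      · congr 1
        norm_num
        ring
    refine o4.trans_tendsto ?_
    exact (tendsto_rpow_neg_atTop (by linarith)).comp tendsto_natCast_atTop_atTop
  have o6 := ((tendsto_linear_quotient (4 : ℂ) (56 * a + 12) (2 * a + 1)).mul
    (tendsto_linear_quotient 1 0 1)).add
    ((tendsto_const_div_atTop_nhds_zero_nat ((42 * a + 5) * (2 * a + 1))).mul
      ((tendsto_linear_quotient 1 0 (2 * a + 1)).mul (tendsto_linear_quotient 0 1 1)))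
  have o7 := o3.mul o6
  rw [zero_mul] at o7
  refine o7.congr' ?_
  filter_upwards [eventually_gt_atTop 0] with k hk
  have hk : (k : ℂ) ≠ 0 := by exact_mod_cast hk.ne'
  have n1 : (k : ℂ) + (2 * a + 1) ≠ 0 := fun h => h1 k (by linear_combination h)
  have n2 : (k : ℂ) + 1 ≠ 0 := by exact_mod_cast k.succ_ne_zero
  rw [wG, show 2 * a + 1 + (k : ℂ) = k + (2 * a + 1) by ring]
  generalize (42 * a + 5) * (2 * a + 1) = c
  generalize (k : ℂ) + (2 * a + 1) = q at *
  field_simp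
  ring

lemma three_halves_sub_add_ne_zero (h : ∀ j : ℕ, 1 / 2 - a + j ≠ 0) (j : ℕ) :
    3 / 2 - a + j ≠ 0 := fun h' => h (j + 1) (by push_cast; linear_combination h')

include h0 h1 h2 in
-- Summing the certificate leaves −wG(0) = −(42a+5), which cancels the polynomial in `g_eq`. The
-- condition on Re a also makes the additional series at a + 1 converge.
lemma gDiff_eq (ha : a.re < -(1 / 2)) : gDiff a = dRatio a * gDiff (a + 1) := by
  have s0 : Summable (wTerm a) :=
    summable_wTerm h0 h1 (three_halves_sub_add_ne_zero h2) (by linarith)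
  have s1 : Summable (wTerm (a + 1)) := by
    refine summable_wTerm (fun j h => h0 (j + 1) (by push_cast; linear_combination h))
      (fun j h => h1 (j + 2) (by push_cast; linear_combination h))
      (fun j h => h2 j (by linear_combination h)) (by rw [Complex.add_re, Complex.one_re]; linarith)
  have t := ((s1.hasSum.mul_left (dRatio a * (128 * (a + 1) ^ 2 / (2 * (a + 1) - 1)))).sub
    (s0.hasSum.mul_left (128 * a ^ 2 / (2 * a - 1)))).tendsto_sum_nat
  simp only [wTerm_eq_wFactor h2, wTerm_add_one_eq_wFactor h0 h1, wG_sub h1 h2,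
    Finset.sum_range_sub] at t
  have t2 := tendsto_nhds_unique t ((tendsto_wG h0 h1 h2 ha).sub_const _)
  have e : wG a 0 = 42 * a + 5 := by
    have n1 : 2 * a + 1 ≠ 0 := by simpa using h1 0
    simp [wG, wFactor, n1]
  rw [e] at t2
  rw [gDiff, gDiff, g_eq a]
  linear_combination t2

end

/-! ### The periodic function `pFun` and its constancy. -/

/-- The holomorphic prefactor of `dslope gDiff (-1/2)` in the periodic function. -/
def pFactor (a : ℂ) : ℂ := (Real.sqrt Real.pi : ℂ) * Complex.Gamma (3 / 2 + a) *
  (Complex.Gamma (1 / 2 - a))⁻¹ ^ 2 * (Complex.Gamma (1 + a))⁻¹ ^ 3 * (64 : ℂ) ^ (-a)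

/-- `cos² πa ((1/2)_a / (1)_a)³ 64 ^ (-a) gDiff a`, with the singularity at `-1/2` removed. -/
def pFun (a : ℂ) : ℂ := pFactor a * dslope gDiff (-1 / 2) a

/-- The quotient `Γ(a + 1/2) / Γ(a + 1)`. -/
def gammaQuot (a : ℂ) : ℂ := Complex.Gamma (a + 1 / 2) / Complex.Gamma (a + 1)

/-- Both `dRatio` and the coefficient of `wTail` vanish at −1/2, which leaves −16 − (−16). -/
lemma gDiff_neg_half : gDiff (-1 / 2) = 0 := by
  rw [gDiff, tsum_wTerm (by norm_num) (by norm_num), g_eq, dRatio]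
  norm_num

lemma differentiableAt_pFun {a : ℂ} (h1 : -(3 / 4) < a.re) (h2 : a.re < 3 / 8) :
    DifferentiableAt ℂ pFun a := by
  have hU := isOpen_strip (-(3 / 4)) (3 / 8)
  have d1 : DifferentiableOn ℂ (dslope gDiff (-1 / 2)) {a : ℂ | -(3 / 4) < a.re ∧ a.re < 3 / 8} := by
    rw [Complex.differentiableOn_dslope (hU.mem_nhds (by norm_num))]
    exact fun a ha => (differentiableAt_gDiff ha.1 ha.2).differentiableWithinAt
  have d2 : DifferentiableAt ℂ Complex.Gamma (3 / 2 + a) :=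
    Complex.differentiableAt_Gamma _ fun m h => add_natCast_ne_zero_of_re_pos (x := 3 / 2 + a)
      (by norm_num; linarith) m (by rw [h]; ring)
  have d3 := Complex.differentiable_one_div_Gamma
  have d4 : DifferentiableAt ℂ (fun a => Complex.Gamma (3 / 2 + a)) a := by fun_prop
  have d5 : DifferentiableAt ℂ (fun a => (Complex.Gamma (1 / 2 - a))⁻¹) a :=
    (d3.comp (by fun_prop : Differentiable ℂ fun a : ℂ => 1 / 2 - a)) a
  have d6 : DifferentiableAt ℂ (fun a => (Complex.Gamma (1 + a))⁻¹) a :=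
    (d3.comp (by fun_prop : Differentiable ℂ fun a : ℂ => 1 + a)) a
  have d7 : DifferentiableAt ℂ (fun a : ℂ => (64 : ℂ) ^ (-a)) a :=
    DifferentiableAt.const_cpow (by fun_prop) (Or.inl (by norm_num))
  have d8 := d1.differentiableAt (hU.mem_nhds ⟨h1, h2⟩)
  unfold pFun pFactor
  fun_prop

/-- By reflection cos²πa cancels two of the three factors Γ(1/2+a). The third is Γ(3/2+a)/(1/2+a),
and its pole is absorbed by the difference quotient of `gDiff`. -/
lemma pFun_eq {a : ℂ} (hc : Complex.cos (Real.pi * a) ≠ 0) : pFun a =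
    Complex.cos (Real.pi * a) ^ 2 *
      ((gammaQuot a / (Real.sqrt Real.pi : ℂ)) ^ 3 * (64 : ℂ) ^ (-a)) * gDiff a := by
  have hpi : (Real.pi : ℂ) ≠ 0 := by exact_mod_cast Real.pi_ne_zero
  have h1 := Gamma_half_reflect a
  have hne : Complex.Gamma (1 / 2 + a) * Complex.Gamma (1 / 2 - a) ≠ 0 := by
    rw [h1]; exact div_ne_zero hpi hc
  have n1 := left_ne_zero_of_mul hne
  have n2 := right_ne_zero_of_mul hne
  have n0 : 1 / 2 + a ≠ 0 := by
    intro h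
    rw [h, Complex.Gamma_zero] at n1
    exact n1 rfl
  have na : a ≠ -1 / 2 := fun h => n0 (by rw [h]; ring)
  have e1 := Complex.Gamma_add_one _ n0
  rw [show 1 / 2 + a + 1 = 3 / 2 + a by ring] at e1
  have e2 : Complex.cos (Real.pi * a) =
      Real.pi / (Complex.Gamma (1 / 2 + a) * Complex.Gamma (1 / 2 - a)) := by
    rw [h1]; field_simp
  have hs := sqrt_pi_ne_zero
  rw [pFun, pFactor, gammaQuot, e1, e2, dslope_of_ne _ na, slope_def_field, gDiff_neg_half,
    sub_zero, show a - -1 / 2 = 1 / 2 + a by ring, add_comm a (1 / 2), add_comm a 1, ← sqrt_pi_sq]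
  generalize Complex.Gamma (1 + a) = r
  generalize 1 / 2 + a = p at *
  field_simp

lemma pFun_add_one {a : ℂ} (h1 : -(3 / 4) < a.re) (h2 : a.re < -(5 / 8)) :
    pFun (a + 1) = pFun a := by
  have hg := gDiff_eq (a := a) (fun j h => by
      have := congrArg Complex.re h
      norm_num at this
      rcases j with _ | j
      · norm_num at this; linarith
      · push_cast at this; linarith [Nat.cast_nonneg (α := ℝ) j])
    (fun j h => by
      have := congrArg Complex.re h
      norm_num at this
      rcases j with _ | j
      · norm_num at this; linarith
      · push_cast at this; linarith [Nat.cast_nonneg (α := ℝ) j])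
    (add_natCast_ne_zero_of_re_pos (by norm_num; linarith)) (by linarith)
  have n0 : 3 / 2 + a ≠ 0 := by
    simpa using add_natCast_ne_zero_of_re_pos (x := 3 / 2 + a) (by norm_num; linarith) 0
  have n1 : 1 + a ≠ 0 := by
    simpa using add_natCast_ne_zero_of_re_pos (x := 1 + a) (by norm_num; linarith) 0
  have n2 : -1 / 2 - a ≠ 0 := by
    simpa using add_natCast_ne_zero_of_re_pos (x := -1 / 2 - a) (by norm_num; linarith) 0
  have n3 := Complex.Gamma_ne_zero_of_re_pos (s := -1 / 2 - a) (by norm_num; linarith)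
  have n4 := Complex.Gamma_ne_zero_of_re_pos (s := 1 + a) (by norm_num; linarith)
  have n5 : a + 1 ≠ 0 := by rwa [add_comm]
  have na : a ≠ -1 / 2 := by rintro rfl; norm_num at h2
  have na' : a + 1 ≠ -1 / 2 := fun h => n0 (by linear_combination h)
  have e1 := Complex.Gamma_add_one _ n0
  have e2 := Complex.Gamma_add_one _ n1
  have e3 := Complex.Gamma_add_one _ n2
  have e4 : (64 : ℂ) ^ (-(a + 1)) = (64 : ℂ) ^ (-a) / 64 := by
    rw [neg_add, ← sub_eq_add_neg, Complex.cpow_sub _ _ (by norm_num), Complex.cpow_one]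
  rw [pFun, pFun, pFactor, pFactor, dslope_of_ne _ na, dslope_of_ne _ na', slope_def_field,
    slope_def_field, gDiff_neg_half, sub_zero, sub_zero, hg, dRatio, e4,
    show 3 / 2 + (a + 1) = 3 / 2 + a + 1 by ring, e1, show 1 + (a + 1) = 1 + a + 1 by ring, e2,
    show 1 / 2 - (a + 1) = -1 / 2 - a by ring, show 1 / 2 - a = -1 / 2 - a + 1 by ring, e3,
    show a + 1 - -1 / 2 = 3 / 2 + a by ring, show a - -1 / 2 = -(-1 / 2 - a) by ring,
    show a + 1 / 2 = -(-1 / 2 - a) by ring, add_comm a 1]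
  rw [add_comm] at n5
  generalize -1 / 2 - a = p at *
  generalize 3 / 2 + a = q at *
  generalize 1 + a = r at *
  field_simp

lemma norm_betaIntegral_half_le : ∃ C : ℝ, ∀ s : ℂ, 1 ≤ s.re →
    ‖Complex.betaIntegral s (1 / 2)‖ ≤ C := by
  refine ⟨∫ x in (0 : ℝ)..1, (1 - x) ^ (-(1 / 2) : ℝ), fun s hs => ?_⟩
  refine intervalIntegral.norm_integral_le_of_norm_le zero_le_one
    (Eventually.of_forall fun x hx => ?_) ?_
  · rw [norm_mul]
    rcases eq_or_lt_of_le hx.2 with rfl | h1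
    · norm_num
    · have e : (1 : ℂ) - x = ((1 - x : ℝ) : ℂ) := by push_cast; rfl
      rw [e, Complex.norm_cpow_eq_rpow_re_of_pos hx.1,
        Complex.norm_cpow_eq_rpow_re_of_pos (sub_pos.2 h1)]
      have h2 : x ^ (s - 1).re ≤ 1 :=
        Real.rpow_le_one hx.1.le hx.2 (by simpa using hs)
      have h3 : ((1 / 2 : ℂ) - 1).re = -(1 / 2) := by norm_num
      rw [h3]
      exact mul_le_of_le_one_left (Real.rpow_nonneg (sub_pos.2 h1).le _) h2
  · have h := (intervalIntegral.intervalIntegrable_rpow' (a := 0) (b := 1)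
      (r := -(1 / 2)) (by norm_num)).comp_sub_left 1
    simpa using h.symm

/-- Γ(s)/Γ(s+1/2) is a Beta integral over √π, bounded for Re s ≥ 1. Two shifts lead from a + 1/2 to
a + 5/2, and the factors they cost are bounded because |Im a| ≥ 1. -/
lemma norm_gammaQuot_le : ∃ C : ℝ, 0 ≤ C ∧ ∀ a : ℂ, -(3 / 4) ≤ a.re → 1 ≤ |a.im| →
    ‖gammaQuot a‖ ≤ C := by
  obtain ⟨C, hC⟩ := norm_betaIntegral_half_le
  refine ⟨4 * |C|, by positivity, fun a ha hi => ?_⟩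
  have hne : ∀ s : ℂ, a + s ≠ 0 ∨ s.im ≠ 0 := fun s => by
    by_contra! h
    have h1 := congrArg Complex.im h.1
    simp [h.2] at h1
    rw [h1] at hi
    norm_num at hi
  have n1 : a + 1 / 2 ≠ 0 := (hne _).resolve_right (by norm_num)
  have n2 : a + 1 ≠ 0 := (hne _).resolve_right (by norm_num)
  have n3 : a + 3 / 2 ≠ 0 := (hne _).resolve_right (by norm_num)
  have n4 : a + 2 ≠ 0 := (hne _).resolve_right (by norm_num)
  have g1 := Complex.Gamma_add_one _ n1
  have g2 := Complex.Gamma_add_one _ n2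
  have g3 := Complex.Gamma_add_one _ n3
  have g4 := Complex.Gamma_add_one _ n4
  rw [show a + 1 / 2 + 1 = a + 3 / 2 by ring] at g1
  rw [show a + 1 + 1 = a + 2 by ring] at g2
  rw [show a + 3 / 2 + 1 = a + 5 / 2 by ring] at g3
  rw [show a + 2 + 1 = a + 3 by ring] at g4
  have n5 : Complex.Gamma (a + 3) ≠ 0 := Complex.Gamma_ne_zero_of_re_pos (by norm_num; linarith)
  have hb := Complex.Gamma_mul_Gamma_eq_betaIntegral (s := a + 5 / 2) (t := 1 / 2)
    (by norm_num; linarith) (by norm_num)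
  rw [show a + 5 / 2 + 1 / 2 = a + 3 by ring, Gamma_half_eq_sqrt] at hb
  have hs := sqrt_pi_ne_zero
  have e : gammaQuot a = (a + 1) / (a + 1 / 2) * ((a + 2) / (a + 3 / 2)) *
      (Complex.betaIntegral (a + 5 / 2) (1 / 2) / (Real.sqrt Real.pi : ℂ)) := by
    have e1 : Complex.betaIntegral (a + 5 / 2) (1 / 2) / (Real.sqrt Real.pi : ℂ) =
        Complex.Gamma (a + 5 / 2) / Complex.Gamma (a + 3) := by
      rw [div_eq_div_iff hs n5]
      linear_combination -hb
    rw [g4, g2] at n5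
    have n6 := right_ne_zero_of_mul (right_ne_zero_of_mul n5)
    rw [e1, gammaQuot, g4, g3, g2, g1]
    generalize a + 1 / 2 = p at *
    generalize a + 3 / 2 = q at *
    generalize a + 2 = r at *
    generalize Complex.Gamma (a + 1) = x at *
    generalize a + 1 = t at *
    field_simp
  have hq : ∀ s : ℝ, ‖(a + s + 1 / 2) / (a + s)‖ ≤ 2 := by
    intro s
    have h1 : 1 ≤ ‖a + s‖ := by
      refine hi.trans ?_
      have := Complex.abs_im_le_norm (a + s)
      simpa using this
    rw [norm_div]
    refine div_le_of_le_mul₀ (norm_nonneg _) zero_le_two ?_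
    have h2 := norm_add_le (a + s) (1 / 2)
    have h3 : ‖(1 / 2 : ℂ)‖ = 1 / 2 := by norm_num
    linarith
  have q1 := hq (1 / 2)
  have q2 := hq (3 / 2)
  push_cast at q1 q2
  rw [show a + 1 / 2 + 1 / 2 = a + 1 by ring] at q1
  rw [show a + 3 / 2 + 1 / 2 = a + 2 by ring] at q2
  have h3 : ‖Complex.betaIntegral (a + 5 / 2) (1 / 2) / (Real.sqrt Real.pi : ℂ)‖ ≤ |C| := by
    rw [norm_div, Complex.norm_real, Real.norm_of_nonneg (Real.sqrt_nonneg _)]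
    have : 1 ≤ Real.sqrt Real.pi := Real.one_le_sqrt.2 (by linarith [Real.pi_gt_three])
    exact (div_le_self (norm_nonneg _) this).trans
      ((hC _ (by norm_num; linarith)).trans (le_abs_self C))
  rw [e, norm_mul, norm_mul]
  calc _ ≤ 2 * 2 * |C| := by gcongr
    _ = _ := by ring

/-- On the imaginary axis conjugation is a ↦ −a, so reflection gives exactly |Γ(1/2+a)|² = π/|cos
πa| and |Γ(1+a)|² = π|a|/|sin πa|. -/
lemma norm_gammaQuot_sq_le {a : ℂ} (h0 : a.re = 0) (h1 : 1 ≤ |a.im|) :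
    ‖gammaQuot a‖ ^ 2 ≤ 2 / ‖a‖ := by
  have hconj : (starRingEnd ℂ) a = -a := by
    apply Complex.ext <;> simp [h0]
  have ha : ‖a‖ = |a.im| := by
    have : a = a.im * Complex.I := by apply Complex.ext <;> simp [h0]
    rw [this, norm_mul, Complex.norm_I, Complex.norm_real]
    simp
  have ha0 : a ≠ 0 := by
    rw [← norm_pos_iff, ha]
    linarith
  have c1 : ‖Complex.Gamma (a + 1 / 2)‖ ^ 2 = Real.pi / ‖Complex.cos (Real.pi * a)‖ := by
    have e : Complex.Gamma (1 / 2 - a) = (starRingEnd ℂ) (Complex.Gamma (1 / 2 + a)) := by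
      rw [← Complex.Gamma_conj, map_add, hconj]
      congr 1
      rw [map_div₀, map_one, map_ofNat, ← sub_eq_add_neg]
    have h2 := congrArg norm (Gamma_half_reflect a)
    rw [e, norm_mul, RCLike.norm_conj, norm_div, Complex.norm_real,
      Real.norm_of_nonneg Real.pi_pos.le, ← sq] at h2
    rwa [add_comm]
  have c2 : ‖Complex.Gamma (a + 1)‖ ^ 2 = ‖a‖ * (Real.pi / ‖Complex.sin (Real.pi * a)‖) := by
    have e : Complex.Gamma (1 - a) = (starRingEnd ℂ) (Complex.Gamma (1 + a)) := by
      rw [← Complex.Gamma_conj, map_add, hconj]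
      congr 1
      simp [sub_eq_add_neg]
    have h2 : ‖a * (Complex.Gamma a * Complex.Gamma (1 - a))‖ =
        ‖a * (Real.pi / Complex.sin (Real.pi * a))‖ := by rw [Complex.Gamma_mul_Gamma_one_sub]
    rw [← mul_assoc, ← Complex.Gamma_add_one _ ha0, e, norm_mul, RCLike.norm_conj, norm_mul,
      norm_div, Complex.norm_real, Real.norm_of_nonneg Real.pi_pos.le, add_comm 1 a, ← sq] at h2
    exact h2
  have hi := abs_im_pi_mul h1
  have c3 := norm_sin_le_two_mul_norm_cos hi
  have c4 := hi.trans (abs_im_le_norm_cos _)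
  have c5 := hi.trans (abs_im_le_norm_sin _)
  have ha1 : 0 < ‖a‖ := norm_pos_iff.2 ha0
  rw [gammaQuot, norm_div, div_pow, c1, c2]
  generalize ‖Complex.sin (Real.pi * a)‖ = s at *
  generalize ‖Complex.cos (Real.pi * a)‖ = c at *
  have hpi := Real.pi_pos
  rw [div_le_div_iff₀ (by positivity) ha1]
  have : Real.pi / c * ‖a‖ = Real.pi / (c * s) * ‖a‖ * s := by field_simp
  rw [this]
  have : 2 * (‖a‖ * (Real.pi / s)) = Real.pi / (c * s) * ‖a‖ * (2 * c) := by field_simp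
  rw [this]
  gcongr

/-- `((1/2)_a / (1)_a)³ / 64^a`. -/
def dFun (a : ℂ) : ℂ := (gammaQuot a / (Real.sqrt Real.pi : ℂ)) ^ 3 * (64 : ℂ) ^ (-a)

lemma norm_dFun_le (a : ℂ) (ha : -(3 / 4) ≤ a.re) : ‖dFun a‖ ≤ ‖gammaQuot a‖ ^ 3 * 64 := by
  rw [dFun, norm_mul, norm_pow, norm_div, Complex.norm_real,
    Real.norm_of_nonneg (Real.sqrt_nonneg _)]
  have h1 : 1 ≤ Real.sqrt Real.pi := Real.one_le_sqrt.2 (by linarith [Real.pi_gt_three])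
  have h2 : ‖(64 : ℂ) ^ (-a)‖ ≤ 64 := by
    have := Complex.norm_cpow_eq_rpow_re_of_pos (x := 64) (by norm_num) (-a)
    push_cast at this
    rw [this]
    calc (64 : ℝ) ^ (-a).re ≤ 64 ^ (1 : ℝ) :=
          Real.rpow_le_rpow_of_exponent_le (by norm_num) (by simp; linarith)
      _ = 64 := Real.rpow_one _
  gcongr
  exact div_le_self (norm_nonneg _) h1

lemma cos_ne_zero_of_one_le_abs_im {a : ℂ} (h : 1 ≤ |a.im|) : Complex.cos (Real.pi * a) ≠ 0 := by
  have := (abs_im_pi_mul h).trans (abs_im_le_norm_cos _)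
  rw [← norm_pos_iff]
  linarith

lemma norm_pFun_le : ∃ C : ℝ, 0 ≤ C ∧ ∀ a : ℂ, -(3 / 4) ≤ a.re → a.re ≤ 3 / 8 → 1 ≤ |a.im| →
    ‖pFun a‖ ≤ C * (‖gammaQuot a‖ ^ 3 * (‖a‖ + 1)) * ‖Complex.cos (Real.pi * a)‖ ^ 2 := by
  obtain ⟨C, hC, h⟩ := norm_gDiff_le
  refine ⟨64 * C, by positivity, fun a h1 h2 h3 => ?_⟩
  rw [pFun_eq (cos_ne_zero_of_one_le_abs_im h3), ← dFun, norm_mul, norm_mul, norm_pow]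
  calc _ ≤ ‖Complex.cos (Real.pi * a)‖ ^ 2 * (‖gammaQuot a‖ ^ 3 * 64) * (C * (‖a‖ + 1)) := by
        gcongr
        · exact norm_dFun_le a h1
        · exact h a h1 h2
    _ = _ := by ring

/-- The cube of `gammaQuot` is O(N^(−3/2)) there and outweighs the linear growth of `gDiff`; 32/N is
(2/N)³(2N)². -/
lemma pFun_decay : ∃ ε : ℕ → ℝ, Tendsto ε atTop (𝓝 0) ∧ ∀ N : ℕ, 1 ≤ N → ∀ a : ℂ, a.re = 0 →
    |a.im| = N → ‖pFun a‖ ≤ ε N * ‖Complex.cos (Real.pi * a)‖ ^ 2 := by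
  obtain ⟨C, hC, h⟩ := norm_pFun_le
  refine ⟨fun N => C * Real.sqrt (32 / N), ?_, fun N hN a h0 h1 => ?_⟩
  · have h1 : Tendsto (fun N : ℕ => Real.sqrt (32 / N)) atTop (𝓝 (Real.sqrt 0)) :=
      (Real.continuous_sqrt.tendsto 0).comp (tendsto_const_div_atTop_nhds_zero_nat 32)
    simpa using h1.const_mul C
  · have hN : (1 : ℝ) ≤ N := by exact_mod_cast hN
    have hi : 1 ≤ |a.im| := by rw [h1]; exact hN
    have ha : ‖a‖ = N := by
      have : a = a.im * Complex.I := by apply Complex.ext <;> simp [h0]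
      rw [this, norm_mul, Complex.norm_I, Complex.norm_real, ← h1]
      simp
    refine (h a (by rw [h0]; norm_num) (by rw [h0]; norm_num) hi).trans ?_
    refine mul_le_mul_of_nonneg_right (mul_le_mul_of_nonneg_left ?_ hC) (by positivity)
    refine Real.le_sqrt_of_sq_le ?_
    have h2 := norm_gammaQuot_sq_le h0 hi
    rw [ha] at h2 ⊢
    calc (‖gammaQuot a‖ ^ 3 * ((N : ℝ) + 1)) ^ 2 = (‖gammaQuot a‖ ^ 2) ^ 3 * ((N : ℝ) + 1) ^ 2 := by
          ring
      _ ≤ (2 / (N : ℝ)) ^ 3 * (2 * (N : ℝ)) ^ 2 := by gcongr; linarith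
      _ = _ := by field_simp; norm_num

/-- The terms are 2/((n+1)(n+2)). -/
lemma tsum_wTail_neg_half : ∑' n, wTail (-1 / 2) n = 2 := by
  have h : ∀ n : ℕ, wTail (-1 / 2) n = 2 / ((n : ℂ) + 1) - 2 / (((n + 1 : ℕ) : ℂ) + 1) := by
    intro n
    induction n with
    | zero => norm_num [wTail]
    | succ n ih =>
      have n1 : (n : ℂ) + 1 ≠ 0 := by exact_mod_cast n.succ_ne_zero
      have n2 : (n : ℂ) + 1 + 1 ≠ 0 := by exact_mod_cast (n + 1).succ_ne_zero
      have n3 : (n : ℂ) + 1 + 1 + 1 ≠ 0 := by exact_mod_cast (n + 2).succ_ne_zero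
      rw [wTail_succ, ih]
      push_cast
      rw [show (-1 / 2 + 3 / 2 + (n : ℂ)) = n + 1 by ring,
        show 2 * (-1 / 2) + 2 + (n : ℂ) = n + 1 by ring,
        show 5 / 2 - -1 / 2 + (n : ℂ) = n + 1 + 1 + 1 by ring]
      field_simp
      ring
  have hs := (summable_wTail (a := -1 / 2) (by norm_num) (by norm_num)).hasSum.tendsto_sum_nat
  simp only [h] at hs ⊢
  simp only [Finset.sum_range_sub' (fun n : ℕ => 2 / ((n : ℂ) + 1))] at hs
  refine tendsto_nhds_unique hs ?_
  have : Tendsto (fun n : ℕ => (2 : ℂ) / (((0 : ℕ) : ℂ) + 1) - 2 / ((n : ℂ) + 1)) atTop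
      (𝓝 (2 / (((0 : ℕ) : ℂ) + 1) - 0)) := by
    refine Tendsto.sub tendsto_const_nhds ?_
    have := (tendsto_const_div_atTop_nhds_zero_nat (2 : ℂ)).comp (tendsto_add_atTop_nat 1)
    refine this.congr fun n => ?_
    simp
  simpa using this

lemma deriv_gDiff_neg_half : deriv gDiff (-1 / 2) = 2 := by
  -- With the zeros at −1/2 displayed as factors a + 1/2, the value of g at 1/2 drops out of the
  -- derivative; only the sum of `wTail` at −1/2 is needed.
  have e : gDiff =ᶠ[𝓝 (-1 / 2)] fun a => 42 * a + 5 +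
      (a + 1 / 2) * ((a + 1 / 2) ^ 2 / (64 * (a + 1) ^ 3) * g (a + 1)) -
      128 * a ^ 2 / (2 * a - 1) * (1 + (a + 1 / 2) * ((2 * (3 / 2 - a))⁻¹ * ∑' n, wTail a n)) := by
    filter_upwards [(isOpen_strip (-(3 / 4)) (3 / 8)).mem_nhds (x := -1 / 2) (by norm_num)]
      with a ha
    rw [gDiff, tsum_wTerm ha.1.le ha.2.le, g_eq, dRatio]
    ring
  rw [e.deriv_eq]
  have d0 : HasDerivAt (fun a : ℂ => a + 1 / 2) 1 (-1 / 2) := (hasDerivAt_id _).add_const _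
  have d1 : DifferentiableAt ℂ
      (fun a => (a + 1 / 2) ^ 2 / (64 * (a + 1) ^ 3) * g (a + 1)) (-1 / 2) := by
    have h1 := differentiableAt_g (a := -1 / 2 + 1) (by norm_num)
    have h2 : DifferentiableAt ℂ (fun a => g (a + 1)) (-1 / 2) := by fun_prop
    fun_prop (disch := norm_num)
  have d2 : DifferentiableAt ℂ (fun a => (2 * (3 / 2 - a))⁻¹ * ∑' n, wTail a n) (-1 / 2) := by
    have h1 := differentiableAt_tsum_wTail (a := -1 / 2) (by norm_num) (by norm_num)
    fun_prop (disch := norm_num)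
  have d3 : HasDerivAt (fun a : ℂ => 128 * a ^ 2 / (2 * a - 1)) 48 (-1 / 2) := by
    have h1 : HasDerivAt (fun a : ℂ => 128 * a ^ 2) (128 * (2 * (-1 / 2))) (-1 / 2) := by
      simpa using (hasDerivAt_pow 2 (-1 / 2 : ℂ)).const_mul 128
    have h2 : HasDerivAt (fun a : ℂ => 2 * a - 1) 2 (-1 / 2) := by
      simpa using ((hasDerivAt_id (-1 / 2 : ℂ)).const_mul 2).sub_const 1
    exact (h1.div h2 (by norm_num)).congr_deriv (by norm_num)
  have d4 : HasDerivAt (fun a : ℂ => 42 * a + 5) 42 (-1 / 2) := by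
    simpa using ((hasDerivAt_id (-1 / 2 : ℂ)).const_mul 42).add_const 5
  have d5 := (d4.add (d0.mul d1.hasDerivAt)).sub (d3.mul ((d0.mul d2.hasDerivAt).const_add 1))
  have d6 := d5.deriv
  refine Eq.trans ?_ (d6.trans ?_)
  · rfl
  · simp only [tsum_wTail_neg_half]
    norm_num

lemma pFun_neg_half : pFun (-1 / 2) = 16 / Real.pi := by
  have e : (64 : ℂ) ^ (1 / 2 : ℂ) = 8 := by
    rw [show (64 : ℂ) = 8 ^ (2 : ℕ) by norm_num]
    have := Complex.natCast_cpow_natCast_mul 8 2 (1 / 2)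
    push_cast at this
    rw [← this]
    norm_num
  have hs := sqrt_pi_ne_zero
  rw [pFun, dslope_same, deriv_gDiff_neg_half, pFactor,
    show (3 / 2 + -1 / 2 : ℂ) = 1 by norm_num, show (1 / 2 - -1 / 2 : ℂ) = 1 by norm_num,
    show (1 + -1 / 2 : ℂ) = 1 / 2 by norm_num, Complex.Gamma_one, Gamma_half_eq_sqrt,
    show (-(-1 / 2) : ℂ) = 1 / 2 by norm_num, e, ← sqrt_pi_sq]
  field_simp
  norm_num

theorem pFun_eq_const {a : ℂ} (h1 : -(3 / 4) < a.re) (h2 : a.re < 3 / 8) :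
    pFun a = 16 / Real.pi := by
  obtain ⟨H, dH, pH, eH⟩ := exists_periodic_extension
    (fun a h1 h2 => differentiableAt_pFun h1 h2) (fun a h1 h2 => pFun_add_one h1 h2)
  obtain ⟨C1, hC1, b1⟩ := norm_pFun_le
  obtain ⟨C2, hC2, b2⟩ := norm_gammaQuot_le
  have hb : ∀ z : ℂ, 1 ≤ |z.im| → ‖H z‖ ≤
      (2 * (C1 * C2 ^ 3)) * (1 + |z.im|) * ‖Complex.cos (Real.pi * z)‖ ^ 2 := by
    intro z hz
    have pC : ∀ z : ℂ, Complex.cos (Real.pi * (z + 1)) ^ 2 = Complex.cos (Real.pi * z) ^ 2 := by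
      intro z
      rw [mul_add, mul_one, Complex.cos_add_pi, neg_sq]
    have f1 := Int.floor_le (z.re + 11 / 16)
    have f2 := Int.lt_floor_add_one (z.re + 11 / 16)
    set n := ⌊z.re + 11 / 16⌋
    have e1 := periodic_int pH z (-n)
    have e2 := periodic_int (F := fun z => Complex.cos (Real.pi * z) ^ 2) pC z (-n)
    have hre : (z + ((-n : ℤ) : ℂ)).re = z.re - n := by
      rw [Complex.add_re, Complex.intCast_re]; push_cast; ring
    have him : (z + ((-n : ℤ) : ℂ)).im = z.im := by
      rw [Complex.add_im, Complex.intCast_im, add_zero]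
    beta_reduce at e2
    rw [← norm_pow, ← e1, ← e2, norm_pow, ← him]
    rw [← him] at hz
    generalize z + ((-n : ℤ) : ℂ) = w at *
    have g1 : -(3 / 4) < w.re := by linarith
    have g2 : w.re < 3 / 8 := by linarith
    have hw : ‖w‖ ≤ 1 + |w.im| := by
      have := Complex.norm_le_abs_re_add_abs_im w
      have : |w.re| ≤ 1 := abs_le.2 ⟨by linarith, by linarith⟩
      linarith
    rw [eH w g1 g2]
    refine (b1 w g1.le g2.le hz).trans (mul_le_mul_of_nonneg_right ?_ (by positivity))
    calc C1 * (‖gammaQuot w‖ ^ 3 * (‖w‖ + 1)) ≤ C1 * (C2 ^ 3 * (2 * (1 + |w.im|))) := by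
          gcongr
          · exact b2 w g1.le hz
          · linarith [abs_nonneg w.im]
      _ = _ := by ring
  obtain ⟨A, B, κ, hABκ⟩ := eq_trig_of_periodic dH pH (by positivity) hb
  obtain ⟨ε, hε, bε⟩ := pFun_decay
  have bI : ∀ N : ℕ, 1 ≤ N → (N : ℝ) ≤ ‖Complex.cos (Real.pi * (N * Complex.I))‖ ∧
      ‖Complex.cos (Real.pi * (N * Complex.I))‖ ≤ 2 * ‖Complex.sin (Real.pi * (N * Complex.I))‖ ∧
      ‖H (N * Complex.I)‖ ≤ ε N * ‖Complex.cos (Real.pi * (N * Complex.I))‖ ^ 2 ∧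
      ‖H (-(N * Complex.I))‖ ≤ ε N * ‖Complex.cos (Real.pi * (N * Complex.I))‖ ^ 2 := by
    intro N hN
    have hN' : (1 : ℝ) ≤ N := by exact_mod_cast hN
    have r0 : ((N : ℂ) * Complex.I).re = 0 := by simp
    have i0 : |((N : ℂ) * Complex.I).im| = N := by simp
    refine ⟨?_, norm_cos_le_two_mul_norm_sin (abs_im_pi_mul (by rw [i0]; exact hN')), ?_, ?_⟩
    · refine le_trans ?_ (abs_im_le_norm_cos _)
      rw [Complex.im_ofReal_mul, abs_mul, i0, abs_of_pos Real.pi_pos]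
      nlinarith [Real.pi_gt_three]
    · rw [eH _ (by rw [r0]; norm_num) (by rw [r0]; norm_num)]
      exact bε N hN _ r0 i0
    · rw [eH _ (by rw [Complex.neg_re, r0]; norm_num) (by rw [Complex.neg_re, r0]; norm_num)]
      have := bε N hN (-(N * Complex.I)) (by rw [Complex.neg_re, r0, neg_zero])
        (by rw [Complex.neg_im, abs_neg, i0])
      rwa [mul_neg, Complex.cos_neg] at this
  -- The odd part of H at ±iN is a multiple κ of 4 sin · cos, comparable with cos², whereas H is at
  -- most ε N times |cos|².
  have hκ : κ = 0 := by
    rw [← norm_le_zero_iff]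
    refine ge_of_tendsto hε ?_
    filter_upwards [eventually_ge_atTop 1] with N hN
    obtain ⟨c1, c2, c3, c4⟩ := bI N hN
    have hN' : (1 : ℝ) ≤ N := by exact_mod_cast hN
    have e : H (N * Complex.I) - H (-(N * Complex.I)) =
        4 * κ * Complex.sin (Real.pi * (N * Complex.I)) *
          Complex.cos (Real.pi * (N * Complex.I)) := by
      rw [hABκ, hABκ, mul_neg, mul_neg, Complex.sin_neg, Complex.sin_neg, mul_assoc 2,
        Complex.sin_two_mul]
      ring
    have e2 := congrArg norm e
    rw [norm_mul, norm_mul, norm_mul] at e2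
    have e3 := norm_sub_le (H (N * Complex.I)) (H (-(N * Complex.I)))
    rw [e2] at e3
    norm_num at e3
    generalize ‖Complex.sin (Real.pi * (N * Complex.I))‖ = s at *
    generalize ‖Complex.cos (Real.pi * (N * Complex.I))‖ = c at *
    have hc : 0 < c ^ 2 := by nlinarith
    rw [← mul_le_mul_iff_of_pos_right hc]
    have : ‖κ‖ * c ^ 2 ≤ 2 * ‖κ‖ * s * c := by
      nlinarith [mul_nonneg (norm_nonneg κ) (by linarith : 0 ≤ c)]
    linarith
  -- The even part isolates 2B cos² up to the constant 2(A + B), which is negligible against |cos|²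
  -- ≥ N².
  have hB : B = 0 := by
    rw [← norm_le_zero_iff]
    have t : Tendsto (fun N : ℕ => ε N + ‖A + B‖ / N) atTop (𝓝 (0 + 0)) :=
      hε.add (tendsto_const_div_atTop_nhds_zero_nat _)
    rw [add_zero] at t
    refine ge_of_tendsto t ?_
    filter_upwards [eventually_ge_atTop 1] with N hN
    obtain ⟨c1, c2, c3, c4⟩ := bI N hN
    have hN' : (1 : ℝ) ≤ N := by exact_mod_cast hN
    have e : 2 * B * Complex.cos (Real.pi * (N * Complex.I)) ^ 2 =
        2 * (A + B) - (H (N * Complex.I) + H (-(N * Complex.I))) := by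
      have := Complex.sin_sq_add_cos_sq (Real.pi * (N * Complex.I))
      rw [hABκ, hABκ, mul_neg, mul_neg, Complex.sin_neg, Complex.sin_neg]
      linear_combination 2 * B * this
    have e2 := congrArg norm e
    rw [norm_mul, norm_mul, norm_pow] at e2
    have e3 : ‖2 * (A + B) - (H (N * Complex.I) + H (-(N * Complex.I)))‖ ≤
        2 * ‖A + B‖ + (‖H (N * Complex.I)‖ + ‖H (-(N * Complex.I))‖) := by
      refine (norm_sub_le _ _).trans ?_
      rw [norm_mul, Complex.norm_two]
      gcongr
      exact norm_add_le _ _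
    rw [← e2, Complex.norm_two] at e3
    generalize ‖Complex.cos (Real.pi * (N * Complex.I))‖ = c at *
    have hc : 0 < c ^ 2 := by nlinarith
    rw [← mul_le_mul_iff_of_pos_right hc, add_mul]
    have : ‖A + B‖ ≤ ‖A + B‖ / N * c ^ 2 := by
      rw [div_mul_eq_mul_div, le_div_iff₀ (by linarith)]
      gcongr
      nlinarith
    linarith
  have hconst : ∀ z, H z = A := fun z => by rw [hABκ, hκ, hB]; ring
  rw [← eH a h1 h2, hconst, ← pFun_neg_half, ← eH _ (by norm_num) (by norm_num), hconst]

/-! ### The third form on Re a < 1/2. -/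

lemma cos_pi_mul_ne_zero_iff {a : ℂ} :
    Complex.cos (Real.pi * a) ≠ 0 ↔ ∀ m : ℤ, a ≠ m + 1 / 2 := by
  have hpi : (Real.pi : ℂ) ≠ 0 := by exact_mod_cast Real.pi_ne_zero
  rw [Ne, Complex.cos_eq_zero_iff, not_exists]
  refine forall_congr' fun m => not_congr ⟨fun h => ?_, fun h => ?_⟩
  · apply mul_left_cancel₀ hpi
    rw [h]; ring
  · rw [h]; ring

lemma add_half_ne_zero_of_cos {a : ℂ} (hc : Complex.cos (Real.pi * a) ≠ 0) (j : ℕ) :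
    a + 1 / 2 + j ≠ 0 := fun h =>
  cos_pi_mul_ne_zero_iff.1 hc (-(j : ℤ) - 1) (by push_cast; linear_combination h)

lemma half_sub_ne_zero_of_cos {a : ℂ} (hc : Complex.cos (Real.pi * a) ≠ 0) (j : ℕ) :
    1 / 2 - a + j ≠ 0 := fun h =>
  cos_pi_mul_ne_zero_iff.1 hc j (by push_cast; linear_combination -h)

lemma two_mul_add_one_ne_zero {a : ℂ} (ha : ∀ m : ℕ, a ≠ -((m : ℂ) + 1))
    (hc : Complex.cos (Real.pi * a) ≠ 0) (j : ℕ) : 2 * a + 1 + j ≠ 0 := by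
  intro h
  obtain ⟨k, rfl | rfl⟩ := j.even_or_odd'
  · exact add_half_ne_zero_of_cos hc k (by push_cast at h; linear_combination h / 2)
  · exact ha k (by push_cast at h; linear_combination h / 2)

lemma dFun_add_one {a : ℂ} (h0 : a + 1 / 2 ≠ 0) (h1 : a + 1 ≠ 0) :
    dFun (a + 1) = dRatio a * dFun a := by
  have e1 := Complex.Gamma_add_one _ h0
  have e2 := Complex.Gamma_add_one _ h1
  have e4 : (64 : ℂ) ^ (-(a + 1)) = (64 : ℂ) ^ (-a) / 64 := by
    rw [neg_add, ← sub_eq_add_neg, Complex.cpow_sub _ _ (by norm_num), Complex.cpow_one]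
  rw [dFun, dFun, gammaQuot, gammaQuot, dRatio, e4, e2,
    show a + 1 + 1 / 2 = a + 1 / 2 + 1 by ring, e1]
  generalize a + 1 / 2 = p at *
  generalize a + 1 = q at *
  field_simp

lemma cos_sq_mul_dFun_mul_gDiff_add_one {a : ℂ} (ha : ∀ m : ℕ, a ≠ -((m : ℂ) + 1))
    (hc : Complex.cos (Real.pi * a) ≠ 0) (hr : a.re < -(1 / 2)) :
    Complex.cos (Real.pi * (a + 1)) ^ 2 * dFun (a + 1) * gDiff (a + 1) =
      Complex.cos (Real.pi * a) ^ 2 * dFun a * gDiff a := by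
  have n1 : a + 1 ≠ 0 := fun h => ha 0 (by push_cast; linear_combination h)
  have n0 : a + 1 / 2 ≠ 0 := by simpa using add_half_ne_zero_of_cos hc 0
  rw [gDiff_eq (add_half_ne_zero_of_cos hc) (two_mul_add_one_ne_zero ha hc)
    (half_sub_ne_zero_of_cos hc) hr, dFun_add_one n0 n1, mul_add, mul_one, Complex.cos_add_pi]
  ring

/-- The shift equation carries the constant leftwards from the strip, one unit per induction step.
-/
lemma cos_sq_mul_dFun_mul_gDiff_of_gt (n : ℕ) : ∀ {a : ℂ}, (∀ m : ℕ, a ≠ -((m : ℂ) + 1)) →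
    Complex.cos (Real.pi * a) ≠ 0 → a.re < 3 / 8 → -(3 / 4) - n < a.re →
    Complex.cos (Real.pi * a) ^ 2 * dFun a * gDiff a = 16 / Real.pi := by
  induction n with
  | zero =>
    intro a _ hc h1 h2
    rw [← pFun_eq_const (by simpa using h2) h1, pFun_eq hc, dFun]
  | succ n ih =>
    intro a ha hc h1 h2
    rcases lt_or_ge (-(3 / 4)) a.re with h | h
    · rw [← pFun_eq_const h h1, pFun_eq hc, dFun]
    · rw [← cos_sq_mul_dFun_mul_gDiff_add_one ha hc (by linarith)]
      refine ih (fun m hm => ha (m + 1) (by push_cast; linear_combination hm)) ?_ ?_ ?_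
      · rw [mul_add, mul_one, Complex.cos_add_pi]
        exact neg_ne_zero.2 hc
      · rw [Complex.add_re, Complex.one_re]; linarith
      · rw [Complex.add_re, Complex.one_re]; push_cast at h2; linarith

lemma cos_sq_mul_dFun_mul_gDiff {a : ℂ} (ha : ∀ m : ℕ, a ≠ -((m : ℂ) + 1))
    (hc : Complex.cos (Real.pi * a) ≠ 0) (hr : a.re < 1 / 2) :
    Complex.cos (Real.pi * a) ^ 2 * dFun a * gDiff a = 16 / Real.pi := by
  rcases lt_or_ge a.re (3 / 8) with h | h
  · obtain ⟨n, hn⟩ := exists_nat_gt (-(3 / 4) - a.re)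
    exact cos_sq_mul_dFun_mul_gDiff_of_gt n ha hc h (by linarith)
  -- For 3/8 ≤ Re a < 1/2 the value is carried over from a − 1, where Re(a − 1) < −1/2 allows the
  -- shift equation.
  · have hb : ∀ m : ℕ, a - 1 ≠ -((m : ℂ) + 1) := fun m hm => by
      have := congrArg Complex.re hm
      norm_num at this
      have : (0 : ℝ) ≤ m := m.cast_nonneg
      linarith
    have hcb : Complex.cos (Real.pi * (a - 1)) ≠ 0 := by
      rw [mul_sub, mul_one, Complex.cos_sub_pi]
      exact neg_ne_zero.2 hc
    have hre : (a - 1).re = a.re - 1 := by simp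
    have := cos_sq_mul_dFun_mul_gDiff_add_one hb hcb (by rw [hre]; linarith)
    rw [sub_add_cancel] at this
    rw [this]
    exact cos_sq_mul_dFun_mul_gDiff_of_gt 0 hb hcb (by rw [hre]; linarith)
      (by rw [hre]; push_cast; linarith)

lemma sixty_four_cpow_neg (a : ℂ) : (64 : ℂ) ^ (-a) = 1 / ((16 : ℂ) ^ a * 4 ^ a) := by
  have h := Complex.natCast_mul_natCast_cpow 16 4 a
  push_cast at h
  rw [← h, Complex.cpow_neg, one_div]
  norm_num

theorem f_third_form {a : ℂ} (ha : ∀ m : ℕ, a ≠ -((m : ℂ) + 1))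
    (h : Complex.cos (2 * Real.pi * a) ≠ 0) (hc : Complex.cos (Real.pi * a) ≠ 0)
    (hr : a.re < 1 / 2) :
    Summable (vTerm a) ∧ Summable (wTerm a) ∧
      f a =
        32 / (Real.pi : ℂ) ^ 2 * ((16 : ℂ) ^ a / Complex.cos (Real.pi * a) ^ 2) *
            (1 / Complex.cos (2 * Real.pi * a)) *
            (riseC 1 a ^ 5 / (riseC (1 / 2) a ^ 3 * riseC (1 / 4) a * riseC (3 / 4) a)) +
          512 * a ^ 3 / (4 * a - 1) * (∑' n : ℕ, vTerm a n) +
          256 / (Real.pi : ℂ) * (1 / ((4 : ℂ) ^ a * Complex.cos (2 * Real.pi * a))) *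
            (riseC 1 a ^ 2 / (riseC (1 / 4) a * riseC (3 / 4) a)) *
            (a ^ 2 / (2 * a - 1)) * ∑' n : ℕ, wTerm a n := by
  obtain ⟨sv, e⟩ := f_second_form ha h
  refine ⟨sv, summable_wTerm (add_half_ne_zero_of_cos hc) (two_mul_add_one_ne_zero ha hc)
    (three_halves_sub_add_ne_zero (half_sub_ne_zero_of_cos hc)) hr, ?_⟩
  have hd := cos_sq_mul_dFun_mul_gDiff ha hc hr
  have hg : g a = gDiff a + 128 * a ^ 2 / (2 * a - 1) * ∑' n, wTerm a n := by
    rw [gDiff]; ring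
  have hpi : (Real.pi : ℂ) ≠ 0 := by exact_mod_cast Real.pi_ne_zero
  have h4 : (4 : ℂ) ^ a ≠ 0 := by simp [Complex.cpow_eq_zero_iff]
  have h16 : (16 : ℂ) ^ a ≠ 0 := by simp [Complex.cpow_eq_zero_iff]
  have hG : riseC 1 a ≠ 0 := by
    rw [riseC, Complex.Gamma_one, div_one, add_comm]
    exact Gamma_ne_zero_of_add (add_one_add_ne_zero ha)
  have hH : riseC (1 / 2) a ≠ 0 := by
    rw [riseC, add_comm]
    exact div_ne_zero (Gamma_ne_zero_of_add (add_half_ne_zero_of_cos hc))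
      (Complex.Gamma_ne_zero_of_re_pos (by norm_num))
  have hdF : dFun a = (riseC (1 / 2) a / riseC 1 a) ^ 3 / ((16 : ℂ) ^ a * 4 ^ a) := by
    rw [dFun, gammaQuot, sixty_four_cpow_neg, riseC, riseC, Complex.Gamma_one,
      Gamma_half_eq_sqrt, add_comm a, add_comm a, div_one]
    ring
  have hgd : gDiff a = 16 / Real.pi * ((16 : ℂ) ^ a * 4 ^ a) *
      (riseC 1 a ^ 3 / riseC (1 / 2) a ^ 3) / Complex.cos (Real.pi * a) ^ 2 := by
    rw [← hd, hdF]
    field_simp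
  rw [e, hg, hgd, gCoeff]
  generalize riseC 1 a = x at *
  generalize riseC (1 / 2) a = y at *
  generalize riseC (1 / 4) a = z at *
  generalize riseC (3 / 4) a = w at *
  generalize Complex.cos (Real.pi * a) = c at *
  generalize Complex.cos (2 * Real.pi * a) = d at *
  generalize (4 : ℂ) ^ a = p at *
  generalize (16 : ℂ) ^ a = q at *
  generalize (Real.pi : ℂ) = π at *
  -- The only cancellation needed is that of 4^a, between `gDiff` and `gCoeff`.
  have k1 : p * p⁻¹ = 1 := mul_inv_cancel₀ h4
  simp only [div_eq_mul_inv, mul_inv, one_mul]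
  linear_combination 32 * π⁻¹ ^ 2 * d⁻¹ * x ^ 5 * z⁻¹ * w⁻¹ * y⁻¹ ^ 3 * c⁻¹ ^ 2 * q * k1

/-! ### The limit at 0. -/

lemma norm_rise_ge {x : ℂ} {y : ℝ} (hy : 0 ≤ y) (h : y ≤ x.re) (n : ℕ) :
    ‖rise y n‖ ≤ ‖rise x n‖ := by
  rw [rise_eq_prod, rise_eq_prod, norm_prod, norm_prod]
  refine Finset.prod_le_prod (fun _ _ => norm_nonneg _) fun j _ => ?_
  have e : (y : ℂ) + j = ((y + j : ℝ) : ℂ) := by push_cast; rfl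
  rw [e, Complex.norm_real, Real.norm_of_nonneg (by positivity)]
  refine le_trans ?_ ((le_abs_self _).trans (Complex.abs_re_le_norm _))
  rw [Complex.add_re, Complex.natCast_re]
  linarith

lemma re_natCast_pos_ne_zero {y : ℝ} (hy : 0 < y) (j : ℕ) : (y : ℂ) + j ≠ 0 :=
  add_natCast_ne_zero_of_re_pos (by simpa using hy) j

/-- 7/8 and 5/4 bound Re(a+1) and Re(3/2−2a) from below on ‖a‖ ≤ 1/8; the exponent is still −3/2. -/
lemma summable_vMaj : Summable fun n =>
    rise (1 / 2) n ^ 3 / (rise ((7 / 8 : ℝ) : ℂ) n ^ 2 * rise ((5 / 4 : ℝ) : ℂ) n) := by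
  have h1 := rise_div_isBigO half_add_natCast_ne_zero
    (re_natCast_pos_ne_zero (show (0 : ℝ) < 7 / 8 by norm_num))
  have h2 := rise_div_isBigO half_add_natCast_ne_zero
    (re_natCast_pos_ne_zero (show (0 : ℝ) < 5 / 4 by norm_num))
  have h3 := isBigO_natCast_rpow_mul (isBigO_natCast_rpow_mul h1 h1) h2
  refine summable_of_isBigO_nat (g := fun n : ℕ => (n : ℝ) ^ (-(3 / 2) : ℝ))
    (Real.summable_nat_rpow.2 (by norm_num)) ?_
  refine (h3.congr_left fun n => ?_).congr_right fun n => ?_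
  · ring
  · congr 1
    norm_num

lemma norm_vTerm_le {a : ℂ} (ha : ‖a‖ ≤ 1 / 8) (n : ℕ) : ‖vTerm a n‖ ≤
    ‖rise (1 / 2) n ^ 3 / (rise ((7 / 8 : ℝ) : ℂ) n ^ 2 * rise ((5 / 4 : ℝ) : ℂ) n)‖ := by
  have hr := abs_le.1 ((Complex.abs_re_le_norm a).trans ha)
  have h1 := norm_rise_ge (x := a + 1) (y := 7 / 8) (by norm_num)
    (by rw [Complex.add_re, Complex.one_re]; linarith) n
  have h2 := norm_rise_ge (x := 3 / 2 - 2 * a) (y := 5 / 4) (by norm_num)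
    (by norm_num; linarith) n
  have p1 : 0 < ‖rise ((7 / 8 : ℝ) : ℂ) n‖ :=
    norm_pos_iff.2 (rise_ne_zero (re_natCast_pos_ne_zero (by norm_num)) n)
  have p2 : 0 < ‖rise ((5 / 4 : ℝ) : ℂ) n‖ :=
    norm_pos_iff.2 (rise_ne_zero (re_natCast_pos_ne_zero (by norm_num)) n)
  rw [vTerm, norm_div, norm_div, norm_mul, norm_mul, norm_pow, norm_pow, norm_pow]
  gcongr

lemma differentiableAt_vTerm {a : ℂ} (ha : ‖a‖ < 1 / 8) (n : ℕ) :
    DifferentiableAt ℂ (fun a => vTerm a n) a := by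
  have hr := abs_le.1 ((Complex.abs_re_le_norm a).trans ha.le)
  have n1 : rise (a + 1) n ≠ 0 := rise_ne_zero
    (add_natCast_ne_zero_of_re_pos (by rw [Complex.add_re, Complex.one_re]; linarith)) n
  have n2 : rise (3 / 2 - 2 * a) n ≠ 0 := rise_ne_zero
    (add_natCast_ne_zero_of_re_pos (by norm_num; linarith)) n
  have d1 : Differentiable ℂ fun a : ℂ => rise (a + 1) n :=
    (differentiable_rise n).comp (by fun_prop : Differentiable ℂ fun a : ℂ => a + 1)
  have d2 : Differentiable ℂ fun a : ℂ => rise (3 / 2 - 2 * a) n :=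
    (differentiable_rise n).comp (by fun_prop : Differentiable ℂ fun a : ℂ => 3 / 2 - 2 * a)
  unfold vTerm
  exact (differentiableAt_const _).div (((d1 a).pow 2).mul (d2 a)) (mul_ne_zero (pow_ne_zero 2 n1) n2)

lemma continuousAt_tsum_vTerm : ContinuousAt (fun a => ∑' n, vTerm a n) 0 := by
  refine tendsto_tsum_of_dominated_convergence summable_vMaj.norm
    (fun n => (differentiableAt_vTerm (by norm_num) n).continuousAt) ?_
  filter_upwards [Metric.closedBall_mem_nhds (0 : ℂ) (by norm_num : (0 : ℝ) < 1 / 8)] with a ha n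
  exact norm_vTerm_le (by simpa using ha) n

lemma cos_two_pi_mul_ne_zero_of_norm_lt {a : ℂ} (ha : ‖a‖ < 1 / 4) :
    Complex.cos (2 * Real.pi * a) ≠ 0 := by
  rw [show (2 : ℂ) * Real.pi * a = Real.pi * (2 * a) by ring, cos_pi_mul_ne_zero_iff]
  intro m hm
  have h1 : ‖(2 * a : ℂ)‖ < 1 / 2 := by
    rw [norm_mul, Complex.norm_two]; linarith
  have e : (m : ℂ) + 1 / 2 = ((2 * m + 1 : ℤ) : ℂ) / 2 := by push_cast; ring
  rw [hm, e, norm_div, Complex.norm_two, Complex.norm_intCast] at h1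
  have : |((2 * m + 1 : ℤ) : ℝ)| < 1 := by linarith
  rw [← Int.cast_abs] at this
  have : |2 * m + 1| < 1 := by exact_mod_cast this
  rw [Int.abs_lt_one_iff] at this
  omega

lemma ne_neg_of_norm_lt_one {a : ℂ} (ha : ‖a‖ < 1) (m : ℕ) : a ≠ -((m : ℂ) + 1) := by
  rintro rfl
  rw [norm_neg, ← Nat.cast_succ, Complex.norm_natCast] at ha
  have : m.succ < 1 := by exact_mod_cast ha
  omega

lemma rise_natCast_half (n : ℕ) : rise (1 / 2) n = (n.centralBinom : ℂ) * n.factorial / 4 ^ n := by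
  induction n with
  | zero => simp [Nat.centralBinom]
  | succ n ih =>
    have h := congrArg (Nat.cast : ℕ → ℂ) (Nat.succ_mul_centralBinom_succ n)
    push_cast at h
    rw [rise_succ, ih, Nat.factorial_succ, pow_succ]
    push_cast
    field_simp
    linear_combination -2 * (n.factorial : ℂ) * h

lemma rise_three_halves (n : ℕ) : rise (3 / 2) n = rise (1 / 2) n * (2 * n + 1) := by
  rw [show (3 / 2 : ℂ) = 1 / 2 + 1 by norm_num, rise_add_one (by norm_num)]
  ring

lemma vTerm_zero (n : ℕ) : vTerm 0 n =
    (((n.centralBinom : ℝ) ^ 2 / (16 ^ n * (2 * (n : ℝ) + 1)) : ℝ) : ℂ) := by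
  have h1 : (n.factorial : ℂ) ≠ 0 := by exact_mod_cast n.factorial_ne_zero
  have h2 : (n.centralBinom : ℂ) ≠ 0 := by exact_mod_cast n.centralBinom_ne_zero
  have h3 : (2 * n + 1 : ℂ) ≠ 0 := by exact_mod_cast (2 * n).succ_ne_zero
  have h4 : (16 : ℂ) ^ n = 4 ^ n * 4 ^ n := by rw [← mul_pow]; norm_num
  rw [vTerm, zero_add, mul_zero, sub_zero, rise_three_halves, rise_one_left, rise_natCast_half]
  push_cast
  rw [h4]
  field_simp

theorem summable_centralBinom_sq :
    Summable fun n : ℕ => (n.centralBinom : ℝ) ^ 2 / (16 ^ n * (2 * (n : ℝ) + 1)) := by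
  have h : Summable (vTerm 0) :=
    Summable.of_norm_bounded summable_vMaj.norm fun n => norm_vTerm_le (by norm_num) n
  rw [← Complex.summable_ofReal]
  exact h.congr vTerm_zero

lemma tsum_vTerm_zero : ∑' n, vTerm 0 n =
    ((∑' n : ℕ, (n.centralBinom : ℝ) ^ 2 / (16 ^ n * (2 * (n : ℝ) + 1)) : ℝ) : ℂ) := by
  rw [Complex.ofReal_tsum]
  exact tsum_congr vTerm_zero

/-- Divided by a³, the second form leaves 512/(4a−1) · Σ `vTerm`, which is continuous at 0. -/
theorem tendsto_f_sub_gCoeff_mul_g :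
    Tendsto (fun a : ℂ => f a / a ^ 3 - gCoeff a * (g a / a ^ 3)) (𝓝[≠] 0)
      (𝓝 ((-512 * ∑' n : ℕ, (Nat.centralBinom n : ℝ) ^ 2 / (16 ^ n * (2 * (n : ℝ) + 1)) : ℝ) :
        ℂ)) := by
  have h : ContinuousAt (fun a : ℂ => 512 / (4 * a - 1) * ∑' n, vTerm a n) 0 :=
    (ContinuousAt.div (by fun_prop) (by fun_prop) (by norm_num)).mul continuousAt_tsum_vTerm
  have h2 := h.tendsto.mono_left (nhdsWithin_le_nhds (s := {0}ᶜ))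
  rw [tsum_vTerm_zero] at h2
  have e : (512 : ℂ) / (4 * 0 - 1) = ((-512 : ℝ) : ℂ) := by norm_num
  rw [e, ← Complex.ofReal_mul] at h2
  refine h2.congr' ?_
  filter_upwards [self_mem_nhdsWithin, mem_nhdsWithin_of_mem_nhds
    (Metric.ball_mem_nhds (0 : ℂ) (by norm_num : (0 : ℝ) < 1 / 4))] with a ha hb
  rw [mem_ball_zero_iff] at hb
  have ha : a ≠ 0 := ha
  rw [(f_second_form (ne_neg_of_norm_lt_one (by linarith))
    (cos_two_pi_mul_ne_zero_of_norm_lt hb)).2, add_div, ← mul_div_assoc (gCoeff a),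
    add_sub_cancel_left, mul_comm (512 / (4 * a - 1)), mul_comm (512 * a ^ 3 / (4 * a - 1)),
    mul_div_assoc]
  congr 1
  field_simp

/-! ### The arcsine series and Catalan's constant. -/

/-- The Taylor coefficients `binom(2j, j) / 4^j` of `(1 - x)^(-1/2)`. -/
def binomCoef (j : ℕ) : ℝ := j.centralBinom / 4 ^ j

lemma binomCoef_zero : binomCoef 0 = 1 := by simp [binomCoef, Nat.centralBinom]

lemma binomCoef_pos (j : ℕ) : 0 < binomCoef j := by
  have : (0 : ℝ) < j.centralBinom := by exact_mod_cast j.centralBinom_pos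
  rw [binomCoef]; positivity

lemma binomCoef_succ (j : ℕ) :
    2 * ((j : ℝ) + 1) * binomCoef (j + 1) = (2 * j + 1) * binomCoef j := by
  have h := congrArg (Nat.cast : ℕ → ℝ) (Nat.succ_mul_centralBinom_succ j)
  push_cast at h
  rw [binomCoef, binomCoef, pow_succ]
  field_simp
  linear_combination 2 * h

lemma binomCoef_le_one (j : ℕ) : binomCoef j ≤ 1 := by
  induction j with
  | zero => rw [binomCoef_zero]
  | succ j ih =>
    have h := binomCoef_succ j
    have := binomCoef_pos (j + 1)
    have hj : (0 : ℝ) ≤ j := j.cast_nonneg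
    nlinarith

/-- The remainder `1 - cos θ ∑_{j<n} c_j sin^{2j} θ`. -/
def invCosRem (n : ℕ) (θ : ℝ) : ℝ :=
  1 - Real.cos θ * ∑ j ∈ Finset.range n, binomCoef j * Real.sin θ ^ (2 * j)

lemma continuous_invCosRem (n : ℕ) : Continuous (invCosRem n) := by
  unfold invCosRem
  fun_prop

/-- By the recurrence for `binomCoef`, each new summand cancels the previous derivative and leaves a
single term. -/
lemma hasDerivAt_invCosRem (n : ℕ) (θ : ℝ) :
    HasDerivAt (invCosRem (n + 1)) ((2 * n + 1) * binomCoef n * Real.sin θ ^ (2 * n + 1)) θ := by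
  induction n with
  | zero =>
    have e : invCosRem (0 + 1) = fun θ => 1 - Real.cos θ := by
      funext θ
      simp [invCosRem, binomCoef_zero]
    rw [e]
    simpa [binomCoef_zero] using (Real.hasDerivAt_cos θ).const_sub 1
  | succ n ih =>
    have e : invCosRem (n + 1 + 1) = fun θ => invCosRem (n + 1) θ -
        Real.cos θ * (binomCoef (n + 1) * Real.sin θ ^ (2 * n + 2)) := by
      funext θ
      rw [invCosRem, Finset.sum_range_succ, invCosRem]
      ring
    rw [e]
    have h := ih.sub ((Real.hasDerivAt_cos θ).mul
      (((Real.hasDerivAt_sin θ).pow (2 * n + 2)).const_mul (binomCoef (n + 1))))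
    refine h.congr_deriv ?_
    have hc := binomCoef_succ n
    have hs := Real.sin_sq_add_cos_sq θ
    have e2 : Real.cos θ ^ 2 = 1 - Real.sin θ ^ 2 := by linarith
    rw [show 2 * n + 2 - 1 = 2 * n + 1 by omega]
    rw [Pi.pow_apply]
    push_cast
    linear_combination -(Real.sin θ ^ (2 * n + 1)) * hc -
      binomCoef (n + 1) * (2 * n + 2) * Real.sin θ ^ (2 * n + 1) * e2

lemma invCosRem_zero (n : ℕ) : invCosRem (n + 1) 0 = 0 := by
  rw [invCosRem, Finset.sum_range_succ']
  simp [binomCoef_zero]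

/-- The derivative is nonnegative, and on [0, θ] it is bounded using the monotonicity of sine; the
bound tends to 0 when sin θ < 1. -/
lemma invCosRem_succ_bounds (n : ℕ) {θ : ℝ} (h0 : 0 ≤ θ) (h1 : θ ≤ Real.pi / 2) :
    0 ≤ invCosRem (n + 1) θ ∧
      invCosRem (n + 1) θ ≤ (2 * n + 1) * Real.sin θ ^ (2 * n + 1) * θ := by
  have hpi := Real.pi_pos
  have hsin : ∀ x ∈ Set.Icc 0 θ, 0 ≤ Real.sin x ∧ Real.sin x ≤ Real.sin θ := fun x hx =>
    ⟨Real.sin_nonneg_of_nonneg_of_le_pi hx.1 (by linarith [hx.2]),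
      Real.sin_le_sin_of_le_of_le_pi_div_two (by linarith [hx.1]) h1 hx.2⟩
  have hd : DifferentiableOn ℝ (invCosRem (n + 1)) (Set.Icc 0 θ) := fun x _ =>
    (hasDerivAt_invCosRem n x).differentiableAt.differentiableWithinAt
  have hcont := (continuous_invCosRem (n + 1)).continuousOn (s := Set.Icc 0 θ)
  have hp := (binomCoef_pos n).le
  have m0 : (0 : ℝ) ∈ Set.Icc 0 θ := ⟨le_rfl, h0⟩
  have m1 : θ ∈ Set.Icc 0 θ := ⟨h0, le_rfl⟩
  constructor
  · rw [← invCosRem_zero n]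
    refine monotoneOn_of_deriv_nonneg (convex_Icc 0 θ) hcont (hd.mono interior_subset)
      (fun x hx => ?_) m0 m1 h0
    have := (hsin x (interior_subset hx)).1
    rw [(hasDerivAt_invCosRem n x).deriv]
    positivity
  · have h := (convex_Icc 0 θ).image_sub_le_mul_sub_of_deriv_le hcont (hd.mono interior_subset)
      (C := (2 * n + 1) * Real.sin θ ^ (2 * n + 1)) (fun x hx => ?_) 0 m0 θ m1 h0
    · rwa [invCosRem_zero, sub_zero, sub_zero] at h
    · obtain ⟨s0, s1⟩ := hsin x (interior_subset hx)
      rw [(hasDerivAt_invCosRem n x).deriv]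
      gcongr
      exact mul_le_of_le_one_right (by positivity) (binomCoef_le_one n)

lemma invCosRem_le_one (n : ℕ) {θ : ℝ} (h0 : 0 ≤ θ) (h1 : θ ≤ Real.pi / 2) :
    invCosRem n θ ≤ 1 := by
  have hc := Real.cos_nonneg_of_neg_pi_div_two_le_of_le (by linarith) h1
  have hs := Real.sin_nonneg_of_nonneg_of_le_pi h0 (by linarith)
  rw [invCosRem, sub_le_self_iff]
  exact mul_nonneg hc (Finset.sum_nonneg fun j _ => mul_nonneg (binomCoef_pos j).le (by positivity))

lemma abs_invCosRem_le_one (n : ℕ) {θ : ℝ} (h0 : 0 ≤ θ) (h1 : θ ≤ Real.pi / 2) :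
    |invCosRem n θ| ≤ 1 := by
  rw [abs_le]
  refine ⟨?_, invCosRem_le_one n h0 h1⟩
  rcases n with _ | n
  · simp [invCosRem]
  · linarith [(invCosRem_succ_bounds n h0 h1).1]

lemma tendsto_invCosRem {θ : ℝ} (h0 : 0 ≤ θ) (h1 : θ < Real.pi / 2) :
    Tendsto (fun n => invCosRem n θ) atTop (𝓝 0) := by
  rw [← tendsto_add_atTop_iff_nat 1]
  have hs0 := Real.sin_nonneg_of_nonneg_of_le_pi h0 (by linarith)
  have hs1 : Real.sin θ < 1 := by
    rw [← Real.sin_pi_div_two]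
    exact Real.sin_lt_sin_of_lt_of_le_pi_div_two (by linarith) le_rfl h1
  have t := ((tendsto_self_mul_const_pow_of_lt_one hs0 hs1).comp
    (tendsto_atTop_mono (fun n => by omega : ∀ n : ℕ, n ≤ 2 * n + 1) tendsto_id)).mul_const θ
  rw [zero_mul] at t
  refine squeeze_zero (fun n => (invCosRem_succ_bounds n h0 h1.le).1) (fun n => ?_) t
  refine (invCosRem_succ_bounds n h0 h1.le).2.trans_eq ?_
  simp

/-- The power series of `arcsin`, at `sin θ`. -/
lemma hasSum_arcsin {θ : ℝ} (h0 : 0 ≤ θ) (h1 : θ ≤ Real.pi / 2) :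
    HasSum (fun j : ℕ => binomCoef j * Real.sin θ ^ (2 * j + 1) / (2 * j + 1)) θ := by
  have hs := Real.sin_nonneg_of_nonneg_of_le_pi h0 (by linarith)
  rw [hasSum_iff_tendsto_nat_of_nonneg
    (fun j => div_nonneg (mul_nonneg (binomCoef_pos j).le (by positivity)) (by positivity))]
  have hi : ∀ n, ∫ x in (0 : ℝ)..θ, invCosRem n x =
      θ - ∑ j ∈ Finset.range n, binomCoef j * Real.sin θ ^ (2 * j + 1) / (2 * j + 1) := by
    intro n
    have hd : ∀ x ∈ Set.uIcc 0 θ, HasDerivAt (fun θ => θ -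
        ∑ j ∈ Finset.range n, binomCoef j * Real.sin θ ^ (2 * j + 1) / (2 * j + 1))
        (invCosRem n x) x := by
      intro x _
      refine (hasDerivAt_id x).sub ?_
      rw [Finset.mul_sum]
      refine HasDerivAt.fun_sum fun j _ => ?_
      refine ((((Real.hasDerivAt_sin x).pow (2 * j + 1)).const_mul (binomCoef j)).div_const
        (2 * (j : ℝ) + 1)).congr_deriv ?_
      have : (2 * (j : ℝ) + 1) ≠ 0 := by positivity
      rw [Nat.add_sub_cancel]
      push_cast
      field_simp
    rw [intervalIntegral.integral_eq_sub_of_hasDerivAt hd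
      ((continuous_invCosRem n).intervalIntegrable _ _)]
    simp
  have t : Tendsto (fun n => ∫ x in (0 : ℝ)..θ, invCosRem n x) atTop
      (𝓝 (∫ x in (0 : ℝ)..θ, (0 : ℝ))) := by
    refine intervalIntegral.tendsto_integral_filter_of_dominated_convergence (fun _ => 1)
      (Eventually.of_forall fun n => (continuous_invCosRem n).aestronglyMeasurable)
      (Eventually.of_forall fun n => Eventually.of_forall fun x hx => ?_)
      (by simp) ?_
    · rw [Set.uIoc_of_le h0] at hx
      exact abs_invCosRem_le_one n hx.1.le (hx.2.trans h1)
    -- At π/2 the remainder is always 1, but this is one point; hence the series also holds at the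
    -- endpoint θ = π/2.
    · have : ∀ᵐ x : ℝ, x ≠ Real.pi / 2 := by
        simp [MeasureTheory.ae_iff]
      filter_upwards [this] with x hx hx2
      rw [Set.uIoc_of_le h0] at hx2
      exact tendsto_invCosRem hx2.1.le (lt_of_le_of_ne (hx2.2.trans h1) hx)
  have t2 := t.const_sub θ
  simp only [hi, sub_sub_cancel, intervalIntegral.integral_zero, sub_zero] at t2
  exact t2

/-- The arcsine series at 1. It serves as the dominating series below and evaluates Σ `wTerm` at 0.
-/
lemma hasSum_binomCoef_div : HasSum (fun j : ℕ => binomCoef j / (2 * j + 1)) (Real.pi / 2) := by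
  simpa using hasSum_arcsin (θ := Real.pi / 2) (by positivity) le_rfl

lemma integral_sin_pow_half (n : ℕ) :
    ∫ x in (0 : ℝ)..Real.pi / 2, Real.sin x ^ (2 * n) = Real.pi / 2 * binomCoef n := by
  have h1 : ∫ x in (0 : ℝ)..Real.pi / 2, Real.sin x ^ (2 * n) =
      ∫ x in (0 : ℝ)..Real.pi / 2, Real.cos x ^ (2 * n) := by
    have := intervalIntegral.integral_comp_sub_left (a := 0) (b := Real.pi / 2)
      (fun x => Real.sin x ^ (2 * n)) (Real.pi / 2)
    simp only [Real.sin_pi_div_two_sub, sub_self, sub_zero] at this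
    exact this.symm
  have h2 : ∀ n, ∏ i ∈ Finset.range n, (2 * (i : ℝ) + 1) / (2 * i + 2) = binomCoef n := by
    intro n
    induction n with
    | zero => simp [binomCoef_zero]
    | succ n ih =>
      rw [Finset.prod_range_succ, ih]
      have := binomCoef_succ n
      field_simp
      linarith
  rw [h1, EulerSine.integral_cos_pow_eq, integral_sin_pow_even, h2]
  ring

lemma abs_div_sin_le {θ : ℝ} (h : θ ∈ Set.Ioc 0 (Real.pi / 2)) : |θ / Real.sin θ| ≤ Real.pi / 2 := by
  have hs : 0 < Real.sin θ := Real.sin_pos_of_pos_of_lt_pi h.1 (by linarith [h.2, Real.pi_pos])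
  have := Real.mul_le_sin h.1.le h.2
  rw [abs_of_pos (div_pos h.1 hs), div_le_iff₀ hs]
  calc θ = Real.pi / 2 * (2 / Real.pi * θ) := by field_simp
    _ ≤ _ := by gcongr

lemma intervalIntegrable_div_sin :
    IntervalIntegrable (fun θ => θ / Real.sin θ) MeasureTheory.volume 0 (Real.pi / 2) := by
  rw [intervalIntegrable_iff_integrableOn_Ioc_of_le (by positivity)]
  refine MeasureTheory.Measure.integrableOn_of_bounded (M := Real.pi / 2) (by simp)
    (measurable_id.div Real.measurable_sin).aestronglyMeasurable ?_
  rw [MeasureTheory.ae_restrict_iff' measurableSet_Ioc]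
  exact Eventually.of_forall fun θ h => abs_div_sin_le h

/-- Divide the arcsine series by sin θ and integrate termwise: Wallis' integral supplies the second
factor `binomCoef j`. -/
lemma hasSum_binomCoef_sq : HasSum (fun j : ℕ => Real.pi / 2 * (binomCoef j ^ 2 / (2 * j + 1)))
    (∫ θ in (0 : ℝ)..Real.pi / 2, θ / Real.sin θ) := by
  have h := intervalIntegral.hasSum_integral_of_dominated_convergence
    (μ := MeasureTheory.volume) (a := 0) (b := Real.pi / 2)
    (F := fun (j : ℕ) θ => binomCoef j / (2 * j + 1) * Real.sin θ ^ (2 * j))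
    (f := fun θ => θ / Real.sin θ) (fun j _ => binomCoef j / (2 * j + 1))
    (fun j => (by fun_prop : Continuous fun θ =>
      binomCoef j / (2 * (j : ℝ) + 1) * Real.sin θ ^ (2 * j)).aestronglyMeasurable)
    (fun j => Eventually.of_forall fun θ _ => ?_)
    (Eventually.of_forall fun _ _ => hasSum_binomCoef_div.summable)
    (by simp) (Eventually.of_forall fun θ hθ => ?_)
  · refine (congrArg (fun u => HasSum u _) (funext fun j => ?_)).mp h
    rw [intervalIntegral.integral_const_mul, integral_sin_pow_half]
    ring
  · have hp : 0 ≤ binomCoef j / (2 * (j : ℝ) + 1) := div_nonneg (binomCoef_pos j).le (by positivity)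
    rw [norm_mul, norm_pow, Real.norm_of_nonneg hp]
    exact mul_le_of_le_one_right hp (pow_le_one₀ (norm_nonneg _) (Real.abs_sin_le_one θ))
  · rw [Set.uIoc_of_le (by positivity)] at hθ
    have hs : 0 < Real.sin θ :=
      Real.sin_pos_of_pos_of_lt_pi hθ.1 (by linarith [hθ.2, Real.pi_pos])
    refine (congrArg (fun u => HasSum u _) (funext fun j => ?_)).mp
      ((hasSum_arcsin hθ.1.le hθ.2).div_const (Real.sin θ))
    rw [pow_succ]
    field_simp

lemma integral_mul_sin_odd (k : ℕ) :
    ∫ θ in (0 : ℝ)..Real.pi / 2, θ * Real.sin ((2 * k + 1) * θ) =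
      (-1) ^ k / (2 * (k : ℝ) + 1) ^ 2 := by
  have hm : (2 * (k : ℝ) + 1) ≠ 0 := by positivity
  generalize hmk : (2 * (k : ℝ) + 1) = m at *
  have hd : ∀ x ∈ Set.uIcc 0 (Real.pi / 2), HasDerivAt
      (fun θ => Real.sin (m * θ) / m ^ 2 - θ * (Real.cos (m * θ) / m)) (x * Real.sin (m * x)) x := by
    intro x _
    have h1 : HasDerivAt (fun θ => m * θ) m x := by simpa using (hasDerivAt_id x).const_mul m
    have h2 := (h1.sin.div_const (m ^ 2)).sub ((hasDerivAt_id x).mul (h1.cos.div_const m))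
    refine h2.congr_deriv ?_
    simp only [id]
    field_simp
    ring
  rw [intervalIntegral.integral_eq_sub_of_hasDerivAt hd
    ((by fun_prop : Continuous fun x => x * Real.sin (m * x)).intervalIntegrable _ _)]
  have e : m * (Real.pi / 2) = Real.pi / 2 + k * Real.pi := by rw [← hmk]; ring
  rw [e, Real.cos_add_nat_mul_pi, Real.sin_add_nat_mul_pi]
  simp

lemma two_mul_sum_sin_odd (N : ℕ) (θ : ℝ) :
    2 * Real.sin θ * ∑ k ∈ Finset.range N, Real.sin ((2 * k + 1) * θ) =
      1 - Real.cos (2 * N * θ) := by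
  induction N with
  | zero => simp
  | succ N ih =>
    rw [Finset.sum_range_succ, mul_add, ih]
    have h1 := Real.cos_sub ((2 * N + 1) * θ) θ
    have h2 := Real.cos_add ((2 * N + 1) * θ) θ
    rw [show (2 * (N : ℝ) + 1) * θ - θ = 2 * N * θ by ring] at h1
    rw [show (2 * (N : ℝ) + 1) * θ + θ = 2 * (N + 1) * θ by ring] at h2
    push_cast
    linarith

/-- 2 Σ sin((2k+1)θ) equals 1/sin θ up to the oscillating error cos(2Nθ)/sin θ; multiply by θ and
integrate. -/
lemma two_mul_sum_eq_integral (N : ℕ) :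
    2 * ∑ k ∈ Finset.range N, (-1 : ℝ) ^ k / (2 * (k : ℝ) + 1) ^ 2 =
      (∫ θ in (0 : ℝ)..Real.pi / 2, θ / Real.sin θ) -
        ∫ θ in (0 : ℝ)..Real.pi / 2, Real.cos (2 * N * θ) * (θ / Real.sin θ) := by
  rw [← intervalIntegral.integral_sub intervalIntegrable_div_sin
    (intervalIntegrable_div_sin.continuousOn_mul (by fun_prop))]
  simp only [← integral_mul_sin_odd]
  rw [← intervalIntegral.integral_finsetSum (f := fun (k : ℕ) θ => θ * Real.sin ((2 * k + 1) * θ))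
    fun k _ => (by fun_prop : Continuous fun θ =>
      θ * Real.sin ((2 * (k : ℝ) + 1) * θ)).intervalIntegrable _ _,
    ← intervalIntegral.integral_const_mul]
  refine intervalIntegral.integral_congr_ae (Eventually.of_forall fun θ hθ => ?_)
  rw [Set.uIoc_of_le (by positivity)] at hθ
  have hs : Real.sin θ ≠ 0 :=
    (Real.sin_pos_of_pos_of_lt_pi hθ.1 (by linarith [hθ.2, Real.pi_pos])).ne'
  have h := two_mul_sum_sin_odd N θ
  rw [← Finset.mul_sum]
  generalize ∑ k ∈ Finset.range N, Real.sin ((2 * k + 1) * θ) = S at *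
  generalize Real.cos (2 * N * θ) = c at *
  field_simp
  linear_combination θ * h

/-- Riemann–Lebesgue for θ/sin θ cut off to (0, π/2]; frequency N/π produces the phase 2Nθ, and the
real part is taken. -/
lemma tendsto_integral_cos_mul_div_sin : Tendsto
    (fun N : ℕ => ∫ θ in (0 : ℝ)..Real.pi / 2, Real.cos (2 * N * θ) * (θ / Real.sin θ))
    atTop (𝓝 0) := by
  set F : ℝ → ℂ := Set.indicator (Set.Ioc 0 (Real.pi / 2)) fun θ => ((θ / Real.sin θ : ℝ) : ℂ)
    with hF
  have h := Real.tendsto_integral_exp_smul_cocompact F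
  have t : Tendsto (fun N : ℕ => (N : ℝ) / Real.pi) atTop (cocompact ℝ) :=
    (tendsto_natCast_atTop_atTop.atTop_div_const Real.pi_pos).mono_right atTop_le_cocompact
  have h2 := (Complex.continuous_re.tendsto 0).comp (h.comp t)
  rw [Complex.zero_re] at h2
  refine h2.congr fun N => ?_
  have hI : MeasureTheory.IntegrableOn (fun θ : ℝ => ((θ / Real.sin θ : ℝ) : ℂ))
      (Set.Ioc 0 (Real.pi / 2)) := ((intervalIntegrable_iff_integrableOn_Ioc_of_le
        (by positivity)).1 intervalIntegrable_div_sin).ofReal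
  have e : (fun v : ℝ => Real.fourierChar (-(v * (N / Real.pi))) • F v) =
      Set.indicator (Set.Ioc 0 (Real.pi / 2)) fun θ =>
        Complex.exp (((-(2 * N * θ) : ℝ) : ℂ) * Complex.I) * ((θ / Real.sin θ : ℝ) : ℂ) := by
    funext v
    rw [hF]
    by_cases hv : v ∈ Set.Ioc 0 (Real.pi / 2)
    · rw [Set.indicator_of_mem hv, Set.indicator_of_mem hv, Circle.smul_def, Real.fourierChar_apply,
        smul_eq_mul]
      congr 4
      have := Real.pi_ne_zero
      field_simp
    · rw [Set.indicator_of_notMem hv, Set.indicator_of_notMem hv, smul_zero]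
  simp only [Function.comp_apply, e]
  rw [MeasureTheory.integral_indicator measurableSet_Ioc, intervalIntegral.integral_of_le
    (by positivity), ← Complex.reCLM_apply, ← ContinuousLinearMap.integral_comp_comm]
  · refine MeasureTheory.integral_congr_ae (Eventually.of_forall fun θ => ?_)
    beta_reduce
    rw [Complex.reCLM_apply, Complex.re_mul_ofReal, Complex.exp_ofReal_mul_I_re, Real.cos_neg]
  · refine hI.bdd_mul (c := 1) (by fun_prop : Continuous fun θ : ℝ =>
      Complex.exp (((-(2 * N * θ) : ℝ) : ℂ) * Complex.I)).aestronglyMeasurable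
      (Eventually.of_forall fun θ => ?_)
    rw [Complex.norm_exp_ofReal_mul_I]

lemma integral_div_sin : ∫ θ in (0 : ℝ)..Real.pi / 2, θ / Real.sin θ = 2 * catalanG := by
  have s : Summable fun k : ℕ => (-1 : ℝ) ^ k / (2 * (k : ℝ) + 1) ^ 2 := by
    have h2 : Summable fun k : ℕ => 1 / ((k : ℝ) + 1) ^ 2 := by
      have := (summable_nat_add_iff 1).2 (Real.summable_one_div_nat_pow.2 (one_lt_two))
      simpa using this
    refine Summable.of_norm_bounded h2 fun k => ?_
    rw [norm_div, norm_pow, norm_neg, norm_one, one_pow, Real.norm_of_nonneg (by positivity)]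
    gcongr
    linarith [k.cast_nonneg (α := ℝ)]
  have h1 := s.hasSum.tendsto_sum_nat.const_mul 2
  simp only [two_mul_sum_eq_integral] at h1
  have h2 := tendsto_integral_cos_mul_div_sin.const_sub
    (∫ θ in (0 : ℝ)..Real.pi / 2, θ / Real.sin θ)
  rw [sub_zero] at h2
  exact tendsto_nhds_unique h2 h1

theorem tsum_centralBinom_sq :
    -512 * ∑' n : ℕ, (Nat.centralBinom n : ℝ) ^ 2 / (16 ^ n * (2 * (n : ℝ) + 1)) =
      -2048 * (catalanG / Real.pi) := by
  have h := hasSum_binomCoef_sq.tsum_eq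
  rw [tsum_mul_left, integral_div_sin] at h
  have e : ∀ n : ℕ, (Nat.centralBinom n : ℝ) ^ 2 / (16 ^ n * (2 * (n : ℝ) + 1)) =
      binomCoef n ^ 2 / (2 * n + 1) := by
    intro n
    rw [binomCoef, div_pow, ← pow_mul, mul_comm n 2, pow_mul, div_div]
    norm_num
  simp only [e]
  have hpi := Real.pi_ne_zero
  field_simp
  linear_combination (-1024) * h

lemma tsum_wTerm_zero : ∑' n, wTerm 0 n = Real.pi / 2 := by
  have h := hasSum_binomCoef_div.tsum_eq
  have e : ∀ n : ℕ, wTerm 0 n = ((binomCoef n / (2 * n + 1) : ℝ) : ℂ) := by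
    intro n
    have h1 : (n.factorial : ℂ) ≠ 0 := by exact_mod_cast n.factorial_ne_zero
    have h2 : (n.centralBinom : ℂ) ≠ 0 := by exact_mod_cast n.centralBinom_ne_zero
    have h3 : (2 * n + 1 : ℂ) ≠ 0 := by exact_mod_cast (2 * n).succ_ne_zero
    rw [wTerm, zero_add, mul_zero, sub_zero, zero_add, rise_three_halves, rise_one_left,
      rise_natCast_half, binomCoef]
    push_cast
    field_simp
  simp only [e]
  rw [← Complex.ofReal_tsum, h]
  push_cast
  rfl

/-! ### The digamma function and its derivative at 1 and 1/2. -/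

lemma isOpen_re_pos : IsOpen {s : ℂ | 0 < s.re} := isOpen_lt continuous_const Complex.continuous_re

lemma differentiableAt_Gamma_of_re_pos {s : ℂ} (hs : 0 < s.re) :
    DifferentiableAt ℂ Complex.Gamma s :=
  Complex.differentiableAt_Gamma s fun m h =>
    add_natCast_ne_zero_of_re_pos hs m (by rw [h]; ring)

lemma hasDerivAt_Gamma_of_re_pos {s : ℂ} (hs : 0 < s.re) :
    HasDerivAt Complex.Gamma (Complex.Gamma s * Complex.digamma s) s := by
  refine (differentiableAt_Gamma_of_re_pos hs).hasDerivAt.congr_deriv ?_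
  rw [Complex.digamma_def, logDeriv_apply,
    mul_div_cancel₀ _ (Complex.Gamma_ne_zero_of_re_pos hs)]

lemma differentiableAt_digamma {s : ℂ} (hs : 0 < s.re) : DifferentiableAt ℂ Complex.digamma s := by
  have h1 : DifferentiableOn ℂ Complex.Gamma {s : ℂ | 0 < s.re} := fun z hz =>
    (differentiableAt_Gamma_of_re_pos hz).differentiableWithinAt
  have h2 := (h1.deriv isOpen_re_pos).differentiableAt (isOpen_re_pos.mem_nhds hs)
  exact h2.div (differentiableAt_Gamma_of_re_pos hs) (Complex.Gamma_ne_zero_of_re_pos hs)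

/-- Differentiate the constant Γ(1/2+a)Γ(1/2−a)cos πa. -/
lemma digamma_half_reflect {a : ℂ} (h1 : -(1 / 2) < a.re) (h2 : a.re < 1 / 2) :
    (Complex.digamma (1 / 2 + a) - Complex.digamma (1 / 2 - a)) * Complex.cos (Real.pi * a) =
      Real.pi * Complex.sin (Real.pi * a) := by
  have r1 : 0 < (1 / 2 + a).re := by norm_num; linarith
  have r2 : 0 < (1 / 2 - a).re := by norm_num; linarith
  have d1 := (hasDerivAt_Gamma_of_re_pos r1).comp a ((hasDerivAt_id a).const_add (1 / 2))
  have d2 := (hasDerivAt_Gamma_of_re_pos r2).comp a ((hasDerivAt_id a).const_sub (1 / 2))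
  have d3 := ((hasDerivAt_id a).const_mul (Real.pi : ℂ)).ccos
  have d4 := (d1.mul d2).mul d3
  have e : ((Complex.Gamma ∘ fun a => 1 / 2 + id a) * (Complex.Gamma ∘ fun a => 1 / 2 - id a)) *
      (fun a => Complex.cos (Real.pi * id a)) =ᶠ[𝓝 a] fun _ => (Real.pi : ℂ) := by
    filter_upwards [(isOpen_strip (-(1 / 2)) (1 / 2)).mem_nhds ⟨h1, h2⟩] with z hz
    have h := Gamma_half_reflect z
    have hc : Complex.cos (Real.pi * z) ≠ 0 := by
      intro hc
      rw [hc, div_zero] at h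
      have r1 : 0 < (1 / 2 + z).re := by have := hz.1; norm_num; linarith
      have r2 : 0 < (1 / 2 - z).re := by have := hz.2; norm_num; linarith
      exact mul_ne_zero (Complex.Gamma_ne_zero_of_re_pos r1)
        (Complex.Gamma_ne_zero_of_re_pos r2) h
    simp only [Pi.mul_apply, Function.comp_apply, id, h]
    field_simp
  have h := (d4.congr_of_eventuallyEq e.symm).unique (hasDerivAt_const a _)
  simp only [Pi.mul_apply, Function.comp_apply, id] at h
  have n1 := Complex.Gamma_ne_zero_of_re_pos r1
  have n2 := Complex.Gamma_ne_zero_of_re_pos r2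
  apply mul_left_cancel₀ (mul_ne_zero n1 n2)
  linear_combination h

lemma deriv_digamma_half : deriv Complex.digamma (1 / 2) = Real.pi ^ 2 / 2 := by
  have d : HasDerivAt Complex.digamma (deriv Complex.digamma (1 / 2)) (1 / 2) :=
    (differentiableAt_digamma (by norm_num)).hasDerivAt
  have d1 : HasDerivAt (fun a => Complex.digamma (1 / 2 + a)) (deriv Complex.digamma (1 / 2)) 0 :=
    HasDerivAt.comp_const_add (1 / 2) 0 (by simpa using d)
  have d2 : HasDerivAt (fun a => Complex.digamma (1 / 2 - a)) (-deriv Complex.digamma (1 / 2)) 0 :=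
    HasDerivAt.comp_const_sub (1 / 2) 0 (by simpa using d)
  have d3 : HasDerivAt (fun a => Complex.cos (Real.pi * a)) 0 0 := by
    simpa using ((hasDerivAt_id (0 : ℂ)).const_mul (Real.pi : ℂ)).ccos
  have d4 : HasDerivAt (fun a => Real.pi * Complex.sin (Real.pi * a)) ((Real.pi : ℂ) * Real.pi) 0 := by
    simpa using (((hasDerivAt_id (0 : ℂ)).const_mul (Real.pi : ℂ)).csin).const_mul (Real.pi : ℂ)
  have d5 := (d1.sub d2).mul d3
  have h := d5.unique (d4.congr_of_eventuallyEq (by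
    filter_upwards [(isOpen_strip (-(1 / 2)) (1 / 2)).mem_nhds (x := 0) (by norm_num)] with z hz
    exact digamma_half_reflect hz.1 hz.2))
  simp only [mul_zero, Complex.cos_zero, add_zero, mul_one] at h
  linear_combination h / 2

lemma digamma_two_mul {s : ℂ} (hs : 0 < s.re) : Complex.digamma s + Complex.digamma (s + 1 / 2) =
    2 * Complex.digamma (2 * s) - 2 * Complex.log 2 := by
  have r1 : 0 < (s + 1 / 2).re := by norm_num; linarith
  have r2 : 0 < (2 * s).re := by norm_num; linarith
  have d1 := hasDerivAt_Gamma_of_re_pos hs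
  have d2 := (hasDerivAt_Gamma_of_re_pos r1).comp s ((hasDerivAt_id s).add_const (1 / 2))
  have d3 := (hasDerivAt_Gamma_of_re_pos r2).comp s ((hasDerivAt_id s).const_mul 2)
  have d4 := (((hasDerivAt_id s).const_mul 2).const_sub 1).const_cpow (c := (2 : ℂ))
    (Or.inl two_ne_zero)
  have d5 := (d3.mul d4).mul_const (Real.sqrt Real.pi : ℂ)
  have h := (d1.mul d2).unique (d5.congr_of_eventuallyEq
    (Eventually.of_forall fun z => Complex.Gamma_mul_Gamma_add_half z))
  have h2 := Complex.Gamma_mul_Gamma_add_half s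
  simp only [Function.comp_apply, id] at h
  have n1 := Complex.Gamma_ne_zero_of_re_pos hs
  have n2 := Complex.Gamma_ne_zero_of_re_pos r1
  apply mul_left_cancel₀ (mul_ne_zero n1 n2)
  linear_combination h - (2 * Complex.digamma (2 * s) - 2 * Complex.log 2) * h2

/-- Differentiating the duplication formula at s = 1/2 gives ψ′(1/2) + ψ′(1) = 4ψ′(1). -/
lemma deriv_digamma_one : deriv Complex.digamma 1 = Real.pi ^ 2 / 6 := by
  have d : HasDerivAt Complex.digamma (Real.pi ^ 2 / 2) (1 / 2) := by
    rw [← deriv_digamma_half]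
    exact (differentiableAt_digamma (by norm_num)).hasDerivAt
  have d0 : HasDerivAt Complex.digamma (deriv Complex.digamma 1) 1 :=
    (differentiableAt_digamma (by norm_num)).hasDerivAt
  have d1 : HasDerivAt (fun s => Complex.digamma (s + 1 / 2)) (deriv Complex.digamma 1) (1 / 2) :=
    HasDerivAt.comp_add_const (1 / 2) (1 / 2) (by
      norm_num only
      exact d0)
  have d2 : HasDerivAt (fun s => Complex.digamma (2 * s)) (deriv Complex.digamma 1 * 2) (1 / 2) := by
    have h : HasDerivAt (fun s : ℂ => 2 * s) 2 (1 / 2) := by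
      simpa using (hasDerivAt_id (1 / 2 : ℂ)).const_mul 2
    exact HasDerivAt.comp (h₂ := Complex.digamma) (1 / 2) (by
      norm_num only
      exact d0) h
  have h := (d.add d1).unique (((d2.const_mul 2).sub_const
    (2 * Complex.log 2)).congr_of_eventuallyEq (by
      filter_upwards [isOpen_re_pos.mem_nhds (show (0 : ℝ) < (1 / 2 : ℂ).re by norm_num)] with z hz
      exact digamma_two_mul hz))
  linear_combination -h / 3

/-! ### Second-order expansion of f at 0. -/

/-- The gamma factor of the leading term of `f` near `0`. -/
def leadTerm (a : ℂ) : ℂ := (64 : ℂ) ^ a * Complex.Gamma (1 + a) ^ 5 *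
  Complex.Gamma (1 / 2 - 2 * a) * Complex.Gamma (1 / 2 - a) ^ 2 / Complex.Gamma (1 / 2 + a)

/-- The logarithmic derivative of `leadTerm`. -/
def leadLog (a : ℂ) : ℂ := Complex.log 64 + 5 * Complex.digamma (1 + a) -
  2 * Complex.digamma (1 / 2 - 2 * a) - 2 * Complex.digamma (1 / 2 - a) -
    Complex.digamma (1 / 2 + a)

lemma hasDerivAt_leadTerm {a : ℂ} (h : ‖a‖ < 1 / 8) :
    HasDerivAt leadTerm (leadTerm a * leadLog a) a := by
  have hr := abs_lt.1 ((Complex.abs_re_le_norm a).trans_lt h)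
  have r1 : 0 < (1 + a).re := by norm_num; linarith
  have r2 : 0 < (1 / 2 - 2 * a).re := by norm_num; linarith
  have r3 : 0 < (1 / 2 - a).re := by norm_num; linarith
  have r4 : 0 < (1 / 2 + a).re := by norm_num; linarith
  have n4 := Complex.Gamma_ne_zero_of_re_pos r4
  have i := hasDerivAt_id a
  have d0 := i.const_cpow (c := (64 : ℂ)) (Or.inl (by norm_num))
  have d1 := ((hasDerivAt_Gamma_of_re_pos r1).comp a (i.const_add 1)).pow 5
  have d2 := (hasDerivAt_Gamma_of_re_pos r2).comp a ((i.const_mul 2).const_sub (1 / 2))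
  have d3 := ((hasDerivAt_Gamma_of_re_pos r3).comp a (i.const_sub (1 / 2))).pow 2
  have d4 := (hasDerivAt_Gamma_of_re_pos r4).comp a (i.const_add (1 / 2))
  have d := (((d0.mul d1).mul d2).mul d3).div d4 n4
  refine d.congr_deriv ?_
  simp only [Pi.mul_apply, Pi.pow_apply, Function.comp_apply, id, leadTerm, leadLog]
  field_simp
  push_cast
  ring

lemma leadTerm_zero : leadTerm 0 = Real.pi := by
  have hs := sqrt_pi_ne_zero
  simp only [leadTerm, Complex.cpow_zero, add_zero, mul_zero, sub_zero, Complex.Gamma_one,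
    Gamma_half_eq_sqrt, ← sqrt_pi_sq]
  field_simp

lemma log_sixty_four : Complex.log 64 = 6 * Complex.log 2 := by
  have h : Real.log 64 = 6 * Real.log 2 := by
    rw [show (64 : ℝ) = 2 ^ 6 by norm_num, Real.log_pow]; norm_num
  have h1 := Complex.ofReal_log (x := 64) (by norm_num)
  have h2 := Complex.ofReal_log (x := 2) (by norm_num)
  push_cast at h1 h2
  rw [← h1, ← h2, h]
  push_cast
  rfl

/-- Euler's constant cancels, the digamma values entering as 5(ψ(1) − ψ(1/2)) = 10 log 2. -/
lemma leadLog_zero : leadLog 0 = 16 * Complex.log 2 := by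
  simp only [leadLog, add_zero, mul_zero, sub_zero, Complex.digamma_one, Complex.digamma_one_half,
    log_sixty_four]
  ring

lemma hasDerivAt_leadLog : HasDerivAt leadLog (10 / 3 * Real.pi ^ 2) 0 := by
  have dh : HasDerivAt Complex.digamma (Real.pi ^ 2 / 2) (1 / 2) := by
    rw [← deriv_digamma_half]
    exact (differentiableAt_digamma (by norm_num)).hasDerivAt
  have d1 : HasDerivAt Complex.digamma (Real.pi ^ 2 / 6) 1 := by
    rw [← deriv_digamma_one]
    exact (differentiableAt_digamma (by norm_num)).hasDerivAt
  have e1 : HasDerivAt (fun a => Complex.digamma (1 + a)) (Real.pi ^ 2 / 6) 0 :=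
    HasDerivAt.comp_const_add 1 0 (by simpa using d1)
  have e2 : HasDerivAt (fun a => Complex.digamma (1 / 2 + a)) (Real.pi ^ 2 / 2) 0 :=
    HasDerivAt.comp_const_add (1 / 2) 0 (by simpa using dh)
  have e3 : HasDerivAt (fun a => Complex.digamma (1 / 2 - a)) (-(Real.pi ^ 2 / 2)) 0 :=
    HasDerivAt.comp_const_sub (1 / 2) 0 (by simpa using dh)
  have e4 : HasDerivAt (fun a => Complex.digamma (1 / 2 - 2 * a)) (Real.pi ^ 2 / 2 * (-2)) 0 := by
    have h : HasDerivAt (fun s : ℂ => 1 / 2 - 2 * s) (-2) 0 :=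
      (((hasDerivAt_id (0 : ℂ)).const_mul 2).const_sub (1 / 2)).congr_deriv (by norm_num)
    exact HasDerivAt.comp (h₂ := Complex.digamma) 0 (by simpa using dh) h
  refine (((((e1.const_mul 5).const_add (Complex.log 64)).sub (e4.const_mul 2)).sub
    (e3.const_mul 2)).sub e2).congr_deriv ?_
  ring

lemma cos_pi_mul_ne_zero_of_norm_lt {a : ℂ} (ha : ‖a‖ < 1 / 2) :
    Complex.cos (Real.pi * a) ≠ 0 := by
  have := cos_two_pi_mul_ne_zero_of_norm_lt (a := a / 2) (by
    rw [norm_div, Complex.norm_two]; linarith)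
  rwa [show (2 : ℂ) * Real.pi * (a / 2) = Real.pi * a by ring] at this

/-- The constancy of the periodic function solves for `gDiff`, and reflection removes the cosine. -/
lemma gCoeff_mul_gDiff {a : ℂ} (ha : ‖a‖ < 1 / 8) :
    gCoeff a * gDiff a = 32 / (Real.pi : ℂ) ^ 3 * leadTerm a := by
  have hr := abs_lt.1 ((Complex.abs_re_le_norm a).trans_lt ha)
  have hc := cos_pi_mul_ne_zero_of_norm_lt (show ‖a‖ < 1 / 2 by linarith)
  have hd := cos_sq_mul_dFun_mul_gDiff (ne_neg_of_norm_lt_one (by linarith)) hc (by linarith)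
  have hG := gCoeff_eq (cos_two_pi_mul_ne_zero_of_norm_lt (show ‖a‖ < 1 / 4 by linarith))
  have hR := Gamma_half_reflect a
  have n1 := Complex.Gamma_ne_zero_of_re_pos (s := 1 + a) (by norm_num; linarith)
  have n2 := Complex.Gamma_ne_zero_of_re_pos (s := 1 / 2 + a) (by norm_num; linarith)
  have n3 := Complex.Gamma_ne_zero_of_re_pos (s := 1 / 2 - a) (by norm_num; linarith)
  have h64 : (64 : ℂ) ^ a ≠ 0 := by simp [Complex.cpow_eq_zero_iff]
  have hpi : (Real.pi : ℂ) ≠ 0 := by exact_mod_cast Real.pi_ne_zero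
  have hs := sqrt_pi_ne_zero
  have hcos : Complex.cos (Real.pi * a) =
      Real.pi / (Complex.Gamma (1 / 2 + a) * Complex.Gamma (1 / 2 - a)) := by
    rw [hR]; field_simp
  rw [hcos, dFun, gammaQuot, Complex.cpow_neg, add_comm a, add_comm a, ← sqrt_pi_sq] at hd
  rw [Gamma_half_eq_sqrt, add_comm a] at hG
  have hg : gDiff a = 16 * Complex.Gamma (1 + a) ^ 3 * Complex.Gamma (1 / 2 - a) ^ 2 * 64 ^ a /
      ((Real.sqrt Real.pi : ℂ) ^ 3 * Complex.Gamma (1 / 2 + a)) := by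
    clear hG hR hcos
    generalize Complex.Gamma (1 / 2 + a) = p at *
    generalize Complex.Gamma (1 / 2 - a) = q at *
    generalize Complex.Gamma (1 + a) = r at *
    field_simp at hd ⊢
    linear_combination hd
  rw [hG, hg, leadTerm, ← sqrt_pi_sq]
  field_simp
  ring

/-- The coefficient of `a²` in the correction to the leading term of `f` near `0`. -/
def restTerm (a : ℂ) : ℂ := a * (512 / (4 * a - 1)) * ∑' n, vTerm a n +
  gCoeff a * (128 / (2 * a - 1)) * ∑' n, wTerm a n

/-- Both series carry a factor a², so only the value of `restTerm` at 0 affects the second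
derivative, and nothing of it the first. -/
lemma f_eq_leadTerm_add {a : ℂ} (ha : ‖a‖ < 1 / 8) :
    f a = 32 / (Real.pi : ℂ) ^ 3 * leadTerm a + a ^ 2 * restTerm a := by
  have hg : g a = gDiff a + 128 * a ^ 2 / (2 * a - 1) * ∑' n, wTerm a n := by
    rw [gDiff]; ring
  rw [(f_second_form (ne_neg_of_norm_lt_one (by linarith))
    (cos_two_pi_mul_ne_zero_of_norm_lt (by linarith))).2, ← gCoeff_mul_gDiff ha, hg, restTerm]
  ring

lemma differentiableOn_gCoeff : DifferentiableOn ℂ gCoeff (Metric.ball 0 (1 / 8)) := by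
  have h : DifferentiableOn ℂ (fun a : ℂ => 2 * (Complex.Gamma (a + 1) ^ 2 *
      Complex.Gamma (1 / 2 - 2 * a) / Complex.Gamma (1 / 2) ^ 3)) (Metric.ball 0 (1 / 8)) := by
    intro a ha
    rw [mem_ball_zero_iff] at ha
    have hr := abs_lt.1 ((Complex.abs_re_le_norm a).trans_lt ha)
    have d1 := differentiableAt_Gamma_of_re_pos (s := a + 1) (by norm_num; linarith)
    have d2 := differentiableAt_Gamma_of_re_pos (s := 1 / 2 - 2 * a) (by norm_num; linarith)
    refine DifferentiableAt.differentiableWithinAt ?_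
    fun_prop
  refine h.congr fun a ha => ?_
  rw [mem_ball_zero_iff] at ha
  exact gCoeff_eq (cos_two_pi_mul_ne_zero_of_norm_lt (by linarith))

lemma differentiableOn_restTerm : DifferentiableOn ℂ restTerm (Metric.ball 0 (1 / 8)) := by
  have hv : DifferentiableOn ℂ (fun a => ∑' n, vTerm a n) (Metric.ball 0 (1 / 8)) :=
    Complex.differentiableOn_tsum_of_summable_norm summable_vMaj.norm
      (fun n a ha => (differentiableAt_vTerm (by simpa using ha) n).differentiableWithinAt)
      Metric.isOpen_ball fun n a ha => norm_vTerm_le (mem_ball_zero_iff.1 ha).le n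
  intro a ha
  have d1 := hv a ha
  have d2 := differentiableOn_gCoeff a ha
  rw [mem_ball_zero_iff] at ha
  have hr := abs_lt.1 ((Complex.abs_re_le_norm a).trans_lt ha)
  have d3 := (differentiableAt_tsum_wTerm (a := a) (by linarith) (by linarith)
    ).differentiableWithinAt (s := Metric.ball 0 (1 / 8))
  have n1 := two_mul_sub_one_ne_zero (a := a) (by linarith)
  have n2 : 4 * a - 1 ≠ 0 := by
    have := two_mul_sub_one_ne_zero (a := 2 * a) (by norm_num; linarith)
    rwa [show 2 * (2 * a) - 1 = 4 * a - 1 by ring] at this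
  unfold restTerm
  fun_prop (disch := assumption)

lemma gCoeff_zero : gCoeff 0 = 2 / Real.pi := by
  have h : ∀ x : ℂ, 0 < x.re → riseC x 0 = 1 := fun x hx => by
    rw [riseC, add_zero, div_self (Complex.Gamma_ne_zero_of_re_pos hx)]
  rw [gCoeff, h 1 (by norm_num), h (1 / 4) (by norm_num), h (3 / 4) (by norm_num)]
  simp

lemma restTerm_zero : restTerm 0 = -128 := by
  have hpi : (Real.pi : ℂ) ≠ 0 := by exact_mod_cast Real.pi_ne_zero
  rw [restTerm, gCoeff_zero, tsum_wTerm_zero]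
  field_simp
  norm_num

lemma hasDerivAt_f {a : ℂ} (ha : ‖a‖ < 1 / 8) : HasDerivAt f
    (32 / (Real.pi : ℂ) ^ 3 * (leadTerm a * leadLog a) +
      (2 * a * restTerm a + a ^ 2 * deriv restTerm a)) a := by
  have hU : Metric.ball (0 : ℂ) (1 / 8) ∈ 𝓝 a :=
    Metric.isOpen_ball.mem_nhds (mem_ball_zero_iff.2 ha)
  have h1 := (differentiableOn_restTerm.differentiableAt hU).hasDerivAt
  have h2 : HasDerivAt (fun a : ℂ => a ^ 2) (2 * a) a := by simpa using hasDerivAt_pow 2 a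
  refine (((hasDerivAt_leadTerm ha).const_mul (32 / (Real.pi : ℂ) ^ 3)).add
    (h2.mul h1)).congr_of_eventuallyEq ?_
  filter_upwards [hU] with z hz
  exact f_eq_leadTerm_add (mem_ball_zero_iff.1 hz)

theorem f_zero : f 0 = ((32 / Real.pi ^ 2 : ℝ) : ℂ) := by
  have hpi : (Real.pi : ℂ) ≠ 0 := by exact_mod_cast Real.pi_ne_zero
  rw [f_eq_leadTerm_add (by norm_num), leadTerm_zero]
  push_cast
  field_simp
  ring

theorem hasDerivAt_f_zero : HasDerivAt f ((512 / Real.pi ^ 2 * Real.log 2 : ℝ) : ℂ) 0 := by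
  have hpi : (Real.pi : ℂ) ≠ 0 := by exact_mod_cast Real.pi_ne_zero
  refine (hasDerivAt_f (by norm_num)).congr_deriv ?_
  rw [leadTerm_zero, leadLog_zero]
  push_cast
  rw [← Complex.ofNat_log]
  field_simp
  ring

theorem hasDerivAt_deriv_f_zero : HasDerivAt (deriv f)
    ((64 / (3 * Real.pi ^ 2) * (384 * Real.log 2 ^ 2 - 7 * Real.pi ^ 2) : ℝ) : ℂ) 0 := by
  have hpi : (Real.pi : ℂ) ≠ 0 := by exact_mod_cast Real.pi_ne_zero
  have hU : Metric.ball (0 : ℂ) (1 / 8) ∈ 𝓝 0 := Metric.ball_mem_nhds 0 (by norm_num)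
  have e : deriv f =ᶠ[𝓝 0] fun a => 32 / (Real.pi : ℂ) ^ 3 * (leadTerm a * leadLog a) +
      (2 * a * restTerm a + a ^ 2 * deriv restTerm a) := by
    filter_upwards [hU] with a ha
    exact (hasDerivAt_f (mem_ball_zero_iff.1 ha)).deriv
  have h1 := (differentiableOn_restTerm.differentiableAt hU).hasDerivAt
  have h2 := ((differentiableOn_restTerm.deriv Metric.isOpen_ball).differentiableAt hU).hasDerivAt
  have h3 : HasDerivAt (fun a : ℂ => a ^ 2) (2 * 0) 0 := by simpa using hasDerivAt_pow 2 (0 : ℂ)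
  have h4 : HasDerivAt (fun a : ℂ => 2 * a) 2 0 := by
    simpa using (hasDerivAt_id (0 : ℂ)).const_mul 2
  have h5 := (hasDerivAt_leadTerm (a := 0) (by norm_num)).mul hasDerivAt_leadLog
  refine (((h5.const_mul (32 / (Real.pi : ℂ) ^ 3)).add ((h4.mul h1).add
    (h3.mul h2))).congr_of_eventuallyEq e).congr_deriv ?_
  -- The value is (32/π²)((16 log 2)² + 10π²/3) + 2 · (−128).
  rw [leadTerm_zero, leadLog_zero, restTerm_zero]
  push_cast
  rw [← Complex.ofNat_log]
  field_simp
  ring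

end GuilleraSeries

end

theorem mainTheorem10 :
    -- convergence of the series defining `f` and `g`
    (∀ a : ℂ, (∀ m : ℕ, a ≠ -((m : ℂ) + 1)) →
      Summable (GuilleraSeries.fTerm a) ∧ Summable (GuilleraSeries.gTerm a)) ∧
    -- first form
    (∀ a : ℂ, 0 < a.re →
      Summable (GuilleraSeries.uTerm a) ∧
      GuilleraSeries.f a = 32 * a * ∑' n : ℕ, GuilleraSeries.uTerm a n) ∧
    -- second form
    (∀ a : ℂ, (∀ m : ℕ, a ≠ -((m : ℂ) + 1)) → Complex.cos (2 * Real.pi * a) ≠ 0 →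
      Summable (GuilleraSeries.vTerm a) ∧
      GuilleraSeries.f a = GuilleraSeries.gCoeff a * GuilleraSeries.g a +
        512 * a ^ 3 / (4 * a - 1) * ∑' n : ℕ, GuilleraSeries.vTerm a n) ∧
    -- third form
    (∀ a : ℂ, (∀ m : ℕ, a ≠ -((m : ℂ) + 1)) → Complex.cos (2 * Real.pi * a) ≠ 0 →
      Complex.cos (Real.pi * a) ≠ 0 → a.re < 1 / 2 →
      Summable (GuilleraSeries.vTerm a) ∧ Summable (GuilleraSeries.wTerm a) ∧
      GuilleraSeries.f a =
        32 / (Real.pi : ℂ) ^ 2 * ((16 : ℂ) ^ a / Complex.cos (Real.pi * a) ^ 2) *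
            (1 / Complex.cos (2 * Real.pi * a)) *
            (GuilleraSeries.riseC 1 a ^ 5 /
              (GuilleraSeries.riseC (1 / 2) a ^ 3 * GuilleraSeries.riseC (1 / 4) a *
                GuilleraSeries.riseC (3 / 4) a)) +
          512 * a ^ 3 / (4 * a - 1) * (∑' n : ℕ, GuilleraSeries.vTerm a n) +
          256 / (Real.pi : ℂ) * (1 / ((4 : ℂ) ^ a * Complex.cos (2 * Real.pi * a))) *
            (GuilleraSeries.riseC 1 a ^ 2 /
              (GuilleraSeries.riseC (1 / 4) a * GuilleraSeries.riseC (3 / 4) a)) *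
            (a ^ 2 / (2 * a - 1)) * ∑' n : ℕ, GuilleraSeries.wTerm a n) ∧
    -- evaluation at `1/2`
    GuilleraSeries.f (1 / 2) = ((16 * Real.pi ^ 2 / 3 : ℝ) : ℂ) ∧
    -- the limit at `0`
    Tendsto
      (fun a : ℂ => GuilleraSeries.f a / a ^ 3 -
        GuilleraSeries.gCoeff a * (GuilleraSeries.g a / a ^ 3))
      (𝓝[≠] 0)
      (𝓝 ((-512 * ∑' n : ℕ, (Nat.centralBinom n : ℝ) ^ 2 / (16 ^ n * (2 * (n : ℝ) + 1)) : ℝ) :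
        ℂ)) ∧
    Summable (fun n : ℕ => (Nat.centralBinom n : ℝ) ^ 2 / (16 ^ n * (2 * (n : ℝ) + 1))) ∧
    -512 * ∑' n : ℕ, (Nat.centralBinom n : ℝ) ^ 2 / (16 ^ n * (2 * (n : ℝ) + 1)) =
      -2048 * (GuilleraSeries.catalanG / Real.pi) ∧
    -- values at `0` of `f` and of its first two derivatives
    GuilleraSeries.f 0 = ((32 / Real.pi ^ 2 : ℝ) : ℂ) ∧
    AnalyticAt ℂ GuilleraSeries.f 0 ∧
    HasDerivAt GuilleraSeries.f ((512 / Real.pi ^ 2 * Real.log 2 : ℝ) : ℂ) 0 ∧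
    HasDerivAt (deriv GuilleraSeries.f)
      ((64 / (3 * Real.pi ^ 2) * (384 * Real.log 2 ^ 2 - 7 * Real.pi ^ 2) : ℝ) : ℂ) 0 := by
  open GuilleraSeries in
  exact ⟨fun a _ => ⟨summable_fTerm a, summable_gTerm a⟩,
    fun _ ha => ⟨summable_uTerm ha, f_first_form ha⟩,
    fun _ ha h => f_second_form ha h,
    fun _ ha h hc hr => f_third_form ha h hc hr,
    f_half, tendsto_f_sub_gCoeff_mul_g, summable_centralBinom_sq, tsum_centralBinom_sq,
    f_zero, analyticAt_f, hasDerivAt_f_zero, hasDerivAt_deriv_f_zero⟩
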